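/- Conventions. For a group $G$ let $\Gamma^1(G)=G$, $\Gamma^{k+1}(G)=[\Gamma^k(G),G]$, and let $E_0^*(G)=\bigoplus_{k\ge 1}\Gamma^k(G)/\Gamma^{k+1}(G)$, the Lie algebra over $\mathbb Z$ whose bracket is induced by the commutator; a homomorphism $\rho$ induces a morphism of Lie algebras $E_0^*(\rho)$. Let $F_n$ be the free group on $x_1,\dots,x_n$, let $B_m$ be Artin's braid group on $m$ strands with its standard generators $\sigma_1,\dots,\sigma_{m-1}$, and let $P_m\subset B_m$ be the pure braid group, i.e. the kernel of $B_m\to\Sigma_m$. For $1\le r<s\le m$ let $A_{r,s}=\alpha\sigma_r^2\alpha^{-1}\in P_m$ with $\alpha=\sigma_{s-1}\sigma_{s-2}\cdots\sigma_{r+1}$. For $0\le t\le m-1$ let $s_t:P_m\to P_{m+1}$ be the homomorphism that doubles the strand number $t+1$. The homomorphisms $\Theta_n:F_n\to P_{n+1}$ are the components of the morphism of simplicial groups from Milnor's free group construction $F[S^1]$ on the simplicial circle to $(P_{n+1})_{n\ge 0}$ that sends the nondegenerate $1$-simplex to $A_{1,2}$. Explicitly, $\Theta_0$ is trivial, $\Theta_1(x_1)=A_{1,2}$,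 and for $n\ge 1$ one has $\Theta_{n+1}(x_q)=s_0(\Theta_n(x_q))$ for $1\le q\le n$ and $\Theta_{n+1}(x_{n+1})=s_n(\Theta_n(x_n))$. For $n\ge 1$ let $d_n:F_n\to F_{n-1}$ be the homomorphism with $d_n(x_1)=1$ and $d_n(x_q)=x_{q-1}$ for $q\ge 2$, and let $L[x_1^{B}]$ (with $B=E_0^*(F_{n-1})$) be the kernel of $E_0^*(d_n):E_0^*(F_n)\to E_0^*(F_{n-1})$. Let $L[B_{1,n+1},\dots,B_{n,n+1}]$ be the free Lie algebra over $\mathbb Z$ on symbols $B_{i,n+1}$, and let $\varphi_n:L[B_{1,n+1},\dots,B_{n,n+1}]\to E_0^*(P_{n+1})$ be the morphism of Lie algebras that sends $B_{i,n+1}$ to the class of $A_{i,n+1}$ in $\Gamma^1/\Gamma^2$. Let $\Lambda_n=\sum_{i=1}^n B_{i,n+1}$, let $C=L[B_{2,n+1},\dots,B_{n,n+1}]$, and let $L[\Lambda_n^{C}]$ be the kernel of the morphism of Lie algebras $p:L[B_{1,n+1},\dots,B_{n,n+1}]\to C$ with $p(B_{j,n+1})=B_{j,n+1}$ for $j>1$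 and $p(B_{1,n+1})=-\sum_{j=2}^n B_{j,n+1}$; thus $p(\Lambda_n)=0$. Theorem. (1) For every $n\ge 0$ the morphism of Lie algebras $E_0^*(\Theta_n):E_0^*(F_n)\to E_0^*(P_{n+1})$ is a monomorphism, and the homomorphism $\Theta_n:F_n\to P_{n+1}$ is a monomorphism. (2) For every $n\ge 1$ the morphism $\varphi_n$ is injective, so that $L[\Lambda_n^{C}]$ may be regarded as a Lie subalgebra of $E_0^*(P_{n+1})$, and $E_0^*(\Theta_n)$ restricts to an isomorphism of Lie algebras $L[x_1^{B}]\to L[\Lambda_n^{C}]$; that is, there is an isomorphism of Lie algebras $e:L[x_1^{B}]\to L[\Lambda_n^{C}]$ with $\varphi_n(e(z))=E_0^*(\Theta_n)(z)$ for all $z\in L[x_1^{B}]$. -/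

import Mathlib

open scoped DirectSum commutatorElement

noncomputable section

namespace LCS

/-- The descending central series of `G`, shifted by one: `Gam G k` is the `(k + 1)`-st stage, so
`Gam G 0 = G` and `Gam G (k + 1) = [Gam G k, G]`. -/
abbrev Gam (G : Type*) [Group G] (k : ℕ) : Subgroup G := (⊤ : Subgroup G).lowerCentralSeries k

variable {G : Type*} [Group G]

theorem commutator_mem_succ {k : ℕ} {x : G} (hx : x ∈ Gam G k) (y : G) : ⁅x, y⁆ ∈ Gam G (k + 1) :=
  Subgroup.commutator_mem_commutator hx (Subgroup.mem_top y)

theorem commutator_le (k l : ℕ) : ⁅Gam G k, Gam G l⁆ ≤ Gam G (k + l + 1) := by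
  induction l generalizing k with
  | zero => exact le_rfl
  | succ l ih =>
    have hN : (Gam G (k + (l + 1) + 1)).Normal := inferInstance
    have key : ∀ A : Subgroup G, A ≤ Gam G (k + (l + 1) + 1) ↔
        A.map (QuotientGroup.mk' (Gam G (k + (l + 1) + 1))) = ⊥ := by
      intro A
      rw [Subgroup.map_eq_bot_iff, QuotientGroup.ker_mk']
    rw [Gam, Gam, Subgroup.lowerCentralSeries_succ, Subgroup.commutator_comm, key]
    simp only [Subgroup.map_commutator]
    apply Subgroup.commutator_commutator_eq_bot_of_rotate
    · simp only [← Subgroup.map_commutator]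
      rw [← key, Subgroup.commutator_comm (⊤ : Subgroup G)]
      refine (ih (k + 1)).trans (Subgroup.lowerCentralSeries_antitone _ (by omega))
    · simp only [← Subgroup.map_commutator]
      rw [← key]
      refine (Subgroup.commutator_mono (ih k) le_rfl).trans ?_
      exact le_of_eq (by rw [← Subgroup.lowerCentralSeries_succ]; rfl)

theorem commutator_mem {k l : ℕ} {x y : G} (hx : x ∈ Gam G k) (hy : y ∈ Gam G l) :
    ⁅x, y⁆ ∈ Gam G (k + l + 1) :=
  commutator_le k l (Subgroup.commutator_mem_commutator hx hy)

theorem mem_of_le {k l : ℕ} (h : k ≤ l) {x : G} (hx : x ∈ Gam G l) : x ∈ Gam G k :=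
  Subgroup.lowerCentralSeries_antitone _ h hx

theorem conj_mem {k : ℕ} {x : G} (hx : x ∈ Gam G k) (g : G) : g * x * g⁻¹ ∈ Gam G k :=
  Subgroup.Normal.conj_mem inferInstance x hx g

variable (G) in
/-- The quotient of a stage of the descending central series by the next stage. -/
abbrev Quo (k : ℕ) : Type _ := Gam G k ⧸ (Gam G (k + 1)).subgroupOf (Gam G k)

/-- The class of an element of a stage. -/
def cls (k : ℕ) (x : G) (hx : x ∈ Gam G k) : Quo G k := QuotientGroup.mk ⟨x, hx⟩

theorem cls_eq {k : ℕ} {x y : G} (hx : x ∈ Gam G k) (hy : y ∈ Gam G k)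
    (h : x⁻¹ * y ∈ Gam G (k + 1)) : cls k x hx = cls k y hy :=
  QuotientGroup.eq.2 (Subgroup.mem_subgroupOf.2 h)

theorem cls_eq_one {k : ℕ} {x : G} (hx : x ∈ Gam G k) (h : x ∈ Gam G (k + 1)) :
    cls k x hx = 1 :=
  (QuotientGroup.eq_one_iff _).2 (Subgroup.mem_subgroupOf.2 h)

theorem cls_mul {k : ℕ} {x y : G} (hx : x ∈ Gam G k) (hy : y ∈ Gam G k) :
    cls k (x * y) (mul_mem hx hy) = cls k x hx * cls k y hy := rfl

theorem cls_conj {k : ℕ} {x : G} (hx : x ∈ Gam G k) (g : G) :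
    cls k (g * x * g⁻¹) (conj_mem hx g) = cls k x hx := by
  refine (cls_eq _ _ ?_).symm
  have h := commutator_mem_succ (inv_mem hx) g
  simpa [commutatorElement_def, mul_assoc] using h

theorem exists_cls {k : ℕ} (a : Quo G k) : ∃ (x : G) (hx : x ∈ Gam G k), a = cls k x hx := by
  obtain ⟨⟨x, hx⟩, rfl⟩ := QuotientGroup.mk_surjective a
  exact ⟨x, hx, rfl⟩

instance (k : ℕ) : CommGroup (Quo G k) :=
  { (inferInstance : Group (Quo G k)) with
    mul_comm := by
      intro a b
      obtain ⟨x, hx, rfl⟩ := exists_cls a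
      obtain ⟨y, hy, rfl⟩ := exists_cls b
      rw [← cls_mul, ← cls_mul]
      refine cls_eq _ _ ?_
      have h := commutator_mem_succ (inv_mem hy) x⁻¹
      simpa [commutatorElement_def, mul_assoc] using h }

theorem cls_commutator_mul_right {k l : ℕ} {x y z : G} (hx : x ∈ Gam G k) (hy : y ∈ Gam G l)
    (hz : z ∈ Gam G l) : cls (k + l + 1) ⁅x, y * z⁆ (commutator_mem hx (mul_mem hy hz)) =
      cls _ ⁅x, y⁆ (commutator_mem hx hy) * cls _ ⁅x, z⁆ (commutator_mem hx hz) := by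
  rw [← cls_conj (commutator_mem hx hz) y, ← cls_mul]
  congr 1
  simp [commutatorElement_def, mul_assoc]

theorem cls_commutator_mul_left {k l : ℕ} {x y z : G} (hx : x ∈ Gam G k) (hy : y ∈ Gam G k)
    (hz : z ∈ Gam G l) : cls (k + l + 1) ⁅x * y, z⁆ (commutator_mem (mul_mem hx hy) hz) =
      cls _ ⁅x, z⁆ (commutator_mem hx hz) * cls _ ⁅y, z⁆ (commutator_mem hy hz) := by
  rw [mul_comm, ← cls_conj (commutator_mem hy hz) x, ← cls_mul]
  congr 1
  simp [commutatorElement_def, mul_assoc]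

/-- The bracket of a fixed element with a class. -/
def brInner (k l : ℕ) (x : Gam G k) : Quo G l →* Quo G (k + l + 1) :=
  QuotientGroup.lift _
    (MonoidHom.mk' (fun y : Gam G l => cls (k + l + 1) ⁅x.1, y.1⁆ (commutator_mem x.2 y.2))
      (fun y z => cls_commutator_mul_right x.2 y.2 z.2))
    (fun y hy => cls_eq_one _ (mem_of_le (by omega)
      (commutator_mem x.2 (Subgroup.mem_subgroupOf.1 hy))))

/-- The bracket of classes, induced by `(x, y) ↦ ⁅x, y⁆ = x * y * x⁻¹ * y⁻¹`. The commutator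
`x⁻¹ * y⁻¹ * x * y = ⁅x⁻¹, y⁻¹⁆` induces the same bracket, by biadditivity. -/
def br (k l : ℕ) : Quo G k →* Quo G l →* Quo G (k + l + 1) :=
  QuotientGroup.lift _
    (MonoidHom.mk' (brInner k l) (fun x y => by
      ext z
      exact cls_commutator_mul_left x.2 y.2 z.2))
    (fun x hx => by
      ext z
      exact cls_eq_one _ (mem_of_le (by omega)
        (commutator_mem (Subgroup.mem_subgroupOf.1 hx) z.2)))

theorem br_cls {k l : ℕ} {x y : G} (hx : x ∈ Gam G k) (hy : y ∈ Gam G l) :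
    br k l (cls k x hx) (cls l y hy) = cls (k + l + 1) ⁅x, y⁆ (commutator_mem hx hy) := rfl

variable (G) in
/-- The direct sum of the quotients of successive stages of the descending central series; the
summand with index `k` is the one of weight `k + 1`. -/
def E0 : Type _ := ⨁ k : ℕ, Additive (Quo G k)

instance : AddCommGroup (E0 G) := inferInstanceAs (AddCommGroup (⨁ k : ℕ, Additive (Quo G k)))

/-- The inclusion of the summand with index `k`. -/
def E0.of (k : ℕ) : Additive (Quo G k) →+ E0 G := DirectSum.of (fun k => Additive (Quo G k)) k

/-- The class of `x` in the summand with index `k`, for `x` in the corresponding stage. -/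
def E0.mk (k : ℕ) (x : G) (hx : x ∈ Gam G k) : E0 G := E0.of k (Additive.ofMul (cls k x hx))

theorem E0.mk_congr {k l : ℕ} {x y : G} (hx : x ∈ Gam G k) (hy : y ∈ Gam G l) (h : k = l)
    (hxy : x = y) : E0.mk k x hx = E0.mk l y hy := by
  subst h; subst hxy; rfl

theorem E0.mk_mul {k : ℕ} {x y : G} (hx : x ∈ Gam G k) (hy : y ∈ Gam G k) :
    E0.mk k (x * y) (mul_mem hx hy) = E0.mk k x hx + E0.mk k y hy := by
  rw [E0.mk, cls_mul, ofMul_mul, map_add]; rfl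

theorem E0.mk_inv {k : ℕ} {x : G} (hx : x ∈ Gam G k) :
    E0.mk k x⁻¹ (inv_mem hx) = - E0.mk k x hx := by
  rw [eq_neg_iff_add_eq_zero, ← E0.mk_mul]
  simp only [inv_mul_cancel]
  rw [E0.mk, cls_eq_one _ (one_mem _), ofMul_one, map_zero]

theorem E0.mk_conj {k : ℕ} {x : G} (hx : x ∈ Gam G k) (g : G) :
    E0.mk k (g * x * g⁻¹) (conj_mem hx g) = E0.mk k x hx := by
  rw [E0.mk, cls_conj hx]; rfl

theorem E0.induction {p : E0 G → Prop} (u : E0 G) (h0 : p 0)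
    (hm : ∀ k x hx, p (E0.mk k x hx)) (ha : ∀ u v, p u → p v → p (u + v)) : p u := by
  refine DirectSum.induction_on (motive := p) u h0 ?_ ha
  intro k a
  obtain ⟨x, hx, h⟩ := exists_cls a.toMul
  have : a = Additive.ofMul (cls k x hx) := h
  rw [this]
  exact hm k x hx

/-- The additive map out of `E0 G` with given components. -/
def E0.lift {A : Type*} [AddCommGroup A] (f : ∀ k, Additive (Quo G k) →+ A) : E0 G →+ A :=
  DirectSum.toAddMonoid f

theorem E0.lift_of {A : Type*} [AddCommGroup A] (f : ∀ k, Additive (Quo G k) →+ A) (k : ℕ)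
    (a : Additive (Quo G k)) : E0.lift f (E0.of k a) = f k a :=
  DirectSum.toAddMonoid_of f k a

/-- The biadditive extension of `br` to the direct sum. -/
def E0.bracket : E0 G →+ E0 G →+ E0 G :=
  E0.lift fun k => (E0.lift fun l => AddMonoidHom.flip
    (AddMonoidHom.mk' (fun a : Additive (Quo G k) =>
      (E0.of (k + l + 1)).comp (MonoidHom.toAdditive (br k l a.toMul)))
      (fun a b => by
        refine AddMonoidHom.ext fun z => ?_
        change E0.of _ (Additive.ofMul (br k l (a.toMul * b.toMul) z.toMul)) = _
        rw [map_mul, MonoidHom.mul_apply, ofMul_mul, map_add]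
        rfl))).flip

instance : Bracket (E0 G) (E0 G) := ⟨fun u v => E0.bracket u v⟩

theorem E0.mk_lie_mk {k l : ℕ} {x y : G} (hx : x ∈ Gam G k) (hy : y ∈ Gam G l) :
    ⁅E0.mk k x hx, E0.mk l y hy⁆ = E0.mk (k + l + 1) ⁅x, y⁆ (commutator_mem hx hy) := by
  change E0.bracket _ _ = _
  rw [E0.bracket, E0.mk, E0.mk, E0.lift_of, AddMonoidHom.flip_apply, E0.lift_of]
  rfl

theorem E0.add_lie (u v w : E0 G) : ⁅u + v, w⁆ = ⁅u, w⁆ + ⁅v, w⁆ := by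
  change E0.bracket _ _ = E0.bracket _ _ + E0.bracket _ _
  rw [map_add]; rfl

theorem E0.lie_add (u v w : E0 G) : ⁅u, v + w⁆ = ⁅u, v⁆ + ⁅u, w⁆ :=
  map_add (E0.bracket u) v w

theorem E0.lie_zero (u : E0 G) : ⁅u, (0 : E0 G)⁆ = 0 := map_zero (E0.bracket u)

theorem E0.zero_lie (u : E0 G) : ⁅(0 : E0 G), u⁆ = 0 := by
  change E0.bracket _ _ = _
  rw [map_zero]; rfl

theorem E0.lie_skew (u v : E0 G) : ⁅u, v⁆ + ⁅v, u⁆ = 0 := by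
  induction u using E0.induction with
  | h0 => rw [E0.lie_zero, E0.zero_lie, add_zero]
  | ha u w hu hw => rw [E0.add_lie, E0.lie_add, add_add_add_comm, hu, hw, add_zero]
  | hm k x hx =>
    induction v using E0.induction with
    | h0 => rw [E0.lie_zero, E0.zero_lie, add_zero]
    | ha u w hu hw => rw [E0.add_lie, E0.lie_add, add_add_add_comm, hu, hw, add_zero]
    | hm l y hy =>
      rw [E0.mk_lie_mk, E0.mk_lie_mk, ← neg_eq_iff_add_eq_zero, ← E0.mk_inv]
      exact E0.mk_congr _ _ (by omega) (commutatorElement_inv _ _)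

theorem E0.lie_self (u : E0 G) : ⁅u, u⁆ = 0 := by
  induction u using E0.induction with
  | h0 => rw [E0.lie_zero]
  | ha u w hu hw => rw [E0.add_lie, E0.lie_add, E0.lie_add, hu, hw, zero_add, add_zero, E0.lie_skew]
  | hm k x hx =>
    rw [E0.mk_lie_mk, E0.mk, cls_eq_one, ofMul_one, map_zero]
    rw [commutatorElement_self]
    exact one_mem _

theorem E0.jacobi_mk {k l m : ℕ} {x y z : G} (hx : x ∈ Gam G k) (hy : y ∈ Gam G l)
    (hz : z ∈ Gam G m) :
    ⁅⁅E0.mk k x hx, E0.mk l y hy⁆, E0.mk m z hz⁆ + ⁅⁅E0.mk l y hy, E0.mk m z hz⁆, E0.mk k x hx⁆ +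
      ⁅⁅E0.mk m z hz, E0.mk k x hx⁆, E0.mk l y hy⁆ = 0 := by
  have h1 : ⁅⁅E0.mk k x hx, E0.mk l y hy⁆, E0.mk m z hz⁆ =
      E0.mk (k + l + 1 + m + 1) ⁅⁅x, y⁆, y * z * y⁻¹⁆
        (commutator_mem (commutator_mem hx hy) (conj_mem hz y)) := by
    rw [← E0.mk_conj hz y, E0.mk_lie_mk, E0.mk_lie_mk]
  have h2 : ⁅⁅E0.mk l y hy, E0.mk m z hz⁆, E0.mk k x hx⁆ =
      E0.mk (k + l + 1 + m + 1) ⁅⁅y, z⁆, z * x * z⁻¹⁆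
        (mem_of_le (by omega) (commutator_mem (commutator_mem hy hz) (conj_mem hx z))) := by
    rw [← E0.mk_conj hx z, E0.mk_lie_mk, E0.mk_lie_mk]
    exact E0.mk_congr _ _ (by omega) rfl
  have h3 : ⁅⁅E0.mk m z hz, E0.mk k x hx⁆, E0.mk l y hy⁆ =
      E0.mk (k + l + 1 + m + 1) ⁅⁅z, x⁆, x * y * x⁻¹⁆
        (mem_of_le (by omega) (commutator_mem (commutator_mem hz hx) (conj_mem hy x))) := by
    rw [← E0.mk_conj hy x, E0.mk_lie_mk, E0.mk_lie_mk]
    exact E0.mk_congr _ _ (by omega) rfl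
  rw [h1, h2, h3, ← E0.mk_mul, ← E0.mk_mul, E0.mk, cls_eq_one, ofMul_one, map_zero]
  rw [commutatorElement_commutatorElement_conj_mul]
  exact one_mem _

theorem E0.jacobi (u v w : E0 G) : ⁅⁅u, v⁆, w⁆ + ⁅⁅v, w⁆, u⁆ + ⁅⁅w, u⁆, v⁆ = 0 := by
  induction u using E0.induction with
  | h0 => simp only [E0.lie_zero, E0.zero_lie, add_zero]
  | ha u u' hu hu' =>
    simp only [E0.add_lie, E0.lie_add]
    rw [← add_zero (0 : E0 G)]
    nth_rewrite 1 [← hu]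
    rw [← hu']
    abel
  | hm k x hx =>
  induction v using E0.induction with
  | h0 => simp only [E0.lie_zero, E0.zero_lie, add_zero]
  | ha u u' hu hu' =>
    simp only [E0.add_lie, E0.lie_add]
    rw [← add_zero (0 : E0 G)]
    nth_rewrite 1 [← hu]
    rw [← hu']
    abel
  | hm l y hy =>
  induction w using E0.induction with
  | h0 => simp only [E0.lie_zero, E0.zero_lie, add_zero]
  | ha u u' hu hu' =>
    simp only [E0.add_lie, E0.lie_add]
    rw [← add_zero (0 : E0 G)]
    nth_rewrite 1 [← hu]
    rw [← hu']
    abel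
  | hm m z hz => exact E0.jacobi_mk hx hy hz

instance : LieRing (E0 G) where
  add_lie := E0.add_lie
  lie_add := E0.lie_add
  lie_self := E0.lie_self
  leibniz_lie := by
    intro u v w
    have h := E0.jacobi u v w
    have h1 := E0.lie_skew ⁅v, w⁆ u
    have h2 := E0.lie_skew v ⁅u, w⁆
    have h3 := E0.lie_skew w u
    have h4 : ⁅⁅w, u⁆, v⁆ + ⁅⁅u, w⁆, v⁆ = 0 := by rw [← E0.add_lie, h3, E0.zero_lie]
    rw [← sub_eq_zero]
    calc ⁅u, ⁅v, w⁆⁆ - (⁅⁅u, v⁆, w⁆ + ⁅v, ⁅u, w⁆⁆)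
        = (⁅⁅v, w⁆, u⁆ + ⁅u, ⁅v, w⁆⁆) - (⁅⁅u, v⁆, w⁆ + ⁅⁅v, w⁆, u⁆ + ⁅⁅w, u⁆, v⁆)
          - (⁅v, ⁅u, w⁆⁆ + ⁅⁅u, w⁆, v⁆) + (⁅⁅w, u⁆, v⁆ + ⁅⁅u, w⁆, v⁆) := by abel
      _ = 0 := by rw [h, h1, h2, h4]; abel

variable {H : Type*} [Group H]

theorem map_mem (f : G →* H) {k : ℕ} {x : G} (hx : x ∈ Gam G k) : f x ∈ Gam H k := by
  have h : f x ∈ (Gam G k).map f := Subgroup.mem_map_of_mem f hx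
  rw [Gam, Subgroup.map_lowerCentralSeries] at h
  exact Subgroup.lowerCentralSeries_mono k le_top h

/-- The map induced by a homomorphism on the quotients of successive stages. -/
def quoMap (f : G →* H) (k : ℕ) : Quo G k →* Quo H k :=
  QuotientGroup.lift _
    (MonoidHom.mk' (fun x : Gam G k => cls k (f x.1) (map_mem f x.2)) (fun x y => by
      rw [← cls_mul]
      congr 1
      simp))
    (fun x hx => cls_eq_one _ (map_mem f (Subgroup.mem_subgroupOf.1 hx)))

/-- The additive map induced by a homomorphism. -/
def E0.addMap (f : G →* H) : E0 G →+ E0 H :=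
  E0.lift fun k => (E0.of k).comp (MonoidHom.toAdditive (quoMap f k))

theorem E0.addMap_mk (f : G →* H) {k : ℕ} {x : G} (hx : x ∈ Gam G k) :
    E0.addMap f (E0.mk k x hx) = E0.mk k (f x) (map_mem f hx) := by
  rw [E0.addMap, E0.mk, E0.lift_of]; rfl

/-- The morphism of Lie algebras over the integers induced by a homomorphism of groups. -/
def E0.map (f : G →* H) : E0 G →ₗ⁅ℤ⁆ E0 H :=
  { (E0.addMap f).toIntLinearMap with
    map_lie' := by
      intro u v
      change E0.addMap f ⁅u, v⁆ = ⁅E0.addMap f u, E0.addMap f v⁆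
      induction u using E0.induction with
      | h0 => simp
      | ha u u' hu hu' => simp [hu, hu']
      | hm k x hx =>
      induction v using E0.induction with
      | h0 => simp
      | ha u u' hu hu' => simp [hu, hu']
      | hm l y hy =>
        simp only [E0.mk_lie_mk, E0.addMap_mk]
        exact E0.mk_congr _ _ rfl (map_commutatorElement _ _ _) }

end LCS

namespace Braid

/-- Artin's relations for the braid group on `n` strands, with generators numbered from `0`. -/
def rels (n : ℕ) : Set (FreeGroup (Fin (n - 1))) :=
  {r | ∃ i j : Fin (n - 1), (i : ℕ) + 2 ≤ j ∧
      r = FreeGroup.of i * FreeGroup.of j * (FreeGroup.of j * FreeGroup.of i)⁻¹} ∪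
  {r | ∃ i j : Fin (n - 1), (j : ℕ) = i + 1 ∧
      r = FreeGroup.of i * FreeGroup.of j * FreeGroup.of i *
        (FreeGroup.of j * FreeGroup.of i * FreeGroup.of j)⁻¹}

/-- The braid group on `n` strands. -/
abbrev BraidGroup (n : ℕ) : Type := PresentedGroup (rels n)

/-- The generator which exchanges the strands in the positions `i` and `i + 1`, positions being
numbered from `0`; by convention it is `1` if there are no such positions. -/
def sig (n i : ℕ) : BraidGroup n := if h : i < n - 1 then PresentedGroup.of ⟨i, h⟩ else 1

theorem sig_comm (n : ℕ) {i j : ℕ} (h : i + 2 ≤ j) : sig n i * sig n j = sig n j * sig n i := by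
  unfold sig
  split_ifs with h1 h2
  · exact PresentedGroup.mk_eq_mk_of_mul_inv_mem (Or.inl ⟨⟨i, h1⟩, ⟨j, h2⟩, h, rfl⟩)
  all_goals simp

theorem sig_braid {n i : ℕ} (h : i + 2 < n) :
    sig n i * sig n (i + 1) * sig n i = sig n (i + 1) * sig n i * sig n (i + 1) := by
  have h1 : i < n - 1 := by omega
  have h2 : i + 1 < n - 1 := by omega
  rw [sig, sig, dif_pos h1, dif_pos h2]
  exact PresentedGroup.mk_eq_mk_of_mul_inv_mem (Or.inr ⟨⟨i, h1⟩, ⟨i + 1, h2⟩, rfl, rfl⟩)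

/-- The homomorphism out of the braid group with given values on the generators. -/
def lift {n : ℕ} {H : Type*} [Group H] (f : Fin (n - 1) → H)
    (hc : ∀ i j : Fin (n - 1), (i : ℕ) + 2 ≤ j → f i * f j = f j * f i)
    (hb : ∀ i j : Fin (n - 1), (j : ℕ) = i + 1 → f i * f j * f i = f j * f i * f j) :
    BraidGroup n →* H :=
  PresentedGroup.toGroup (f := f) (by
    rintro r (⟨i, j, h, rfl⟩ | ⟨i, j, h, rfl⟩)
    · simp [hc i j h]
    · have := hb i j h
      simp [this])

theorem lift_of {n : ℕ} {H : Type*} [Group H] (f : Fin (n - 1) → H) (hc) (hb) (i : Fin (n - 1)) :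
    lift f hc hb (PresentedGroup.of i) = f i := PresentedGroup.toGroup.of _

/-- The transposition of the positions `i` and `i + 1`. -/
def adj {n : ℕ} (i : Fin (n - 1)) : Equiv.Perm (Fin n) :=
  Equiv.swap ⟨i, by omega⟩ ⟨i + 1, by omega⟩

theorem adj_val {n : ℕ} (i : Fin (n - 1)) (k : Fin n) : (adj i k : ℕ) =
    if (k : ℕ) = i then (i : ℕ) + 1 else if (k : ℕ) = i + 1 then (i : ℕ) else k := by
  unfold adj
  rw [Equiv.swap_apply_def]
  simp only [Fin.ext_iff]
  split_ifs <;> simp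

theorem adj_comm {n : ℕ} (i j : Fin (n - 1)) (h : (i : ℕ) + 2 ≤ j) :
    adj i * adj j = adj j * adj i := by
  ext k
  simp only [Equiv.Perm.mul_apply, adj_val]
  split_ifs <;> omega

theorem adj_braid {n : ℕ} (i j : Fin (n - 1)) (h : (j : ℕ) = i + 1) :
    adj i * adj j * adj i = adj j * adj i * adj j := by
  ext k
  simp only [Equiv.Perm.mul_apply, adj_val, h]
  rcases (by omega : (k : ℕ) = i ∨ (k : ℕ) = i + 1 ∨ (k : ℕ) = i + 2 ∨
      ((k : ℕ) ≠ i ∧ (k : ℕ) ≠ i + 1 ∧ (k : ℕ) ≠ i + 2)) with hk | hk | hk | ⟨h1, h2, h3⟩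
  · simp [hk, (show (i : ℕ) ≠ i + 1 + 1 by omega), (show (i : ℕ) + 1 + 1 ≠ i by omega)]
  · simp [hk, (show (i : ℕ) ≠ i + 1 + 1 by omega), (show (i : ℕ) + 1 + 1 ≠ i by omega)]
  · simp [hk, (show (i : ℕ) ≠ i + 1 + 1 by omega)]
  · simp [h1, h2, h3]

/-- The permutation of the positions induced by a braid. -/
def toPerm (n : ℕ) : BraidGroup n →* Equiv.Perm (Fin n) := lift adj adj_comm adj_braid

/-- The pure braid group on `n` strands. -/
abbrev PureBraidGroup (n : ℕ) : Type := (toPerm n).ker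

theorem toPerm_sig_val {n i : ℕ} (h : i < n - 1) (k : Fin n) : (toPerm n (sig n i) k : ℕ) =
    if (k : ℕ) = i then i + 1 else if (k : ℕ) = i + 1 then i else k := by
  rw [sig, dif_pos h, toPerm, lift_of, adj_val]

theorem toPerm_sig_sq (n i : ℕ) : toPerm n (sig n i ^ 2) = 1 := by
  unfold sig
  split_ifs with h
  · rw [map_pow, toPerm, lift_of, adj, pow_two, Equiv.swap_mul_self]
  · simp

/-- The product `sig (s - 1) * sig (s - 2) * ⋯ * sig (r + 1)`. -/
def alpha (n r s : ℕ) : BraidGroup n :=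
  ((List.range' (r + 1) (s - 1 - r)).reverse.map (sig n)).prod

/-- The pure braid in which the strand `s` links once around the strand `r`, for
`r < s`; strands are numbered from `0`. -/
def A (n : ℕ) (r s : ℕ) : PureBraidGroup n :=
  ⟨alpha n r s * sig n r ^ 2 * (alpha n r s)⁻¹, by
    rw [MonoidHom.mem_ker, map_mul, map_mul, toPerm_sig_sq, mul_one, ← map_mul, mul_inv_cancel,
      map_one]⟩

/-- The generator `sig n i` with the strand that starts in the position `k` doubled. A product of
braids is read as a composition of functions, so that the right hand factor comes first. -/
def dblSig (n i k : ℕ) : BraidGroup (n + 1) :=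
  if k < i then sig (n + 1) (i + 1)
  else if k = i then sig (n + 1) i * sig (n + 1) (i + 1)
  else if k = i + 1 then sig (n + 1) (i + 1) * sig (n + 1) i
  else sig (n + 1) i

/-- The permutation `(k, b) ↦ (k', c * b)`, where `k'` is the position in which the strand of
`sig n i` ends that starts in `k`, and `c` is `sig n i` with this strand doubled. -/
def dblGen {n : ℕ} (i : Fin (n - 1)) : Equiv.Perm (Fin n × BraidGroup (n + 1)) where
  toFun x := (adj i x.1, dblSig n i x.1 * x.2)
  invFun x := (adj i x.1, (dblSig n i (adj i x.1))⁻¹ * x.2)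
  left_inv x := by simp [adj]
  right_inv x := by simp [adj]

theorem dblSig_comm {n : ℕ} (i j : Fin (n - 1)) (h : (i : ℕ) + 2 ≤ j) (k : Fin n) :
    dblSig n i (adj j k) * dblSig n j k = dblSig n j (adj i k) * dblSig n i k := by
  have h1 := sig_comm (n + 1) h
  have h2 := sig_comm (n + 1) (i := i + 1) (j := j + 1) (by omega)
  have h3 := sig_comm (n + 1) (i := i) (j := j + 1) (by omega)
  rcases (by omega : (k : ℕ) < i ∨ (k : ℕ) = i ∨ (k : ℕ) = i + 1 ∨
      ((i : ℕ) + 1 < k ∧ (k : ℕ) < j) ∨ (k : ℕ) = j ∨ (k : ℕ) = j + 1 ∨ (j : ℕ) + 1 < k) with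
    hk | hk | hk | ⟨hk, hk'⟩ | hk | hk | hk
  · have e1 : (adj i k : ℕ) = k := by rw [adj_val, if_neg (by omega), if_neg (by omega)]
    have e2 : (adj j k : ℕ) = k := by rw [adj_val, if_neg (by omega), if_neg (by omega)]
    simp only [dblSig, e1, e2, if_pos hk, if_pos (show (k : ℕ) < j by omega), h2]
  · have e1 : (adj i k : ℕ) = i + 1 := by rw [adj_val, if_pos hk]
    have e2 : (adj j k : ℕ) = i := by rw [adj_val, if_neg (by omega), if_neg (by omega), hk]
    simp only [dblSig, e1, e2, hk, lt_irrefl, if_true, if_false,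
      if_pos (show (i : ℕ) + 1 < j by omega), if_pos (show (i : ℕ) < j by omega)]
    rw [mul_assoc, h2, ← mul_assoc, h3, mul_assoc]
  · have e1 : (adj i k : ℕ) = i := by rw [adj_val, if_neg (by omega), if_pos hk]
    have e2 : (adj j k : ℕ) = i + 1 := by rw [adj_val, if_neg (by omega), if_neg (by omega), hk]
    simp only [dblSig, e1, e2, hk, Nat.not_lt.2 (Nat.le_succ _), Nat.succ_ne_self, if_true, if_false,
      if_pos (show (i : ℕ) + 1 < j by omega), if_pos (show (i : ℕ) < j by omega)]
    rw [mul_assoc, h3, ← mul_assoc, h2, mul_assoc]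
  · have e1 : (adj i k : ℕ) = k := by rw [adj_val, if_neg (by omega), if_neg (by omega)]
    have e2 : (adj j k : ℕ) = k := by rw [adj_val, if_neg (by omega), if_neg (by omega)]
    simp only [dblSig, e1, e2, if_pos hk', if_neg (show ¬ (k : ℕ) < i by omega),
      if_neg (show ¬ (k : ℕ) = i by omega), if_neg (show ¬ (k : ℕ) = i + 1 by omega), h3]
  · have e1 : (adj i k : ℕ) = j := by rw [adj_val, if_neg (by omega), if_neg (by omega), hk]
    have e2 : (adj j k : ℕ) = j + 1 := by rw [adj_val, if_pos hk]
    simp only [dblSig, e1, e2, hk, lt_irrefl, if_true, if_false,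
      if_neg (show ¬ (j : ℕ) < i by omega), if_neg (show ¬ (j : ℕ) = i by omega),
      if_neg (show ¬ (j : ℕ) = i + 1 by omega), if_neg (show ¬ (j : ℕ) + 1 < i by omega),
      if_neg (show ¬ (j : ℕ) + 1 = i by omega), if_neg (show ¬ (j : ℕ) + 1 = i + 1 by omega)]
    rw [← mul_assoc, h1, mul_assoc, h3, mul_assoc]
  · have e1 : (adj i k : ℕ) = j + 1 := by rw [adj_val, if_neg (by omega), if_neg (by omega), hk]
    have e2 : (adj j k : ℕ) = j := by rw [adj_val, if_neg (by omega), if_pos hk]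
    simp only [dblSig, e1, e2, hk, Nat.not_lt.2 (Nat.le_succ _), Nat.succ_ne_self, if_true, if_false,
      if_neg (show ¬ (j : ℕ) < i by omega), if_neg (show ¬ (j : ℕ) = i by omega),
      if_neg (show ¬ (j : ℕ) = i + 1 by omega), if_neg (show ¬ (j : ℕ) + 1 < i by omega),
      if_neg (show ¬ (j : ℕ) + 1 = i by omega), if_neg (show ¬ (j : ℕ) + 1 = i + 1 by omega)]
    rw [← mul_assoc, h3, mul_assoc, h1, mul_assoc]
  · have e1 : (adj i k : ℕ) = k := by rw [adj_val, if_neg (by omega), if_neg (by omega)]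
    have e2 : (adj j k : ℕ) = k := by rw [adj_val, if_neg (by omega), if_neg (by omega)]
    simp only [dblSig, e1, e2, if_neg (show ¬ (k : ℕ) < i by omega),
      if_neg (show ¬ (k : ℕ) = i by omega), if_neg (show ¬ (k : ℕ) = i + 1 by omega),
      if_neg (show ¬ (k : ℕ) < j by omega), if_neg (show ¬ (k : ℕ) = j by omega),
      if_neg (show ¬ (k : ℕ) = j + 1 by omega), h1]

theorem braid_word_one {H : Type*} [Group H] {a b c : H} (h1 : a * b * a = b * a * b)
    (h2 : b * c * b = c * b * c) (h3 : a * c = c * a) :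
    a * (b * c * (a * b)) = b * c * (a * b * c) :=
  calc a * (b * c * (a * b)) = a * b * (c * a) * b := by simp only [mul_assoc]
    _ = (a * b * a) * c * b := by rw [← h3]; simp only [mul_assoc]
    _ = b * a * (b * c * b) := by rw [h1]; simp only [mul_assoc]
    _ = b * (a * c) * b * c := by rw [h2]; simp only [mul_assoc]
    _ = b * c * (a * b * c) := by rw [h3]; simp only [mul_assoc]

theorem braid_word_two {H : Type*} [Group H] {a b c : H} (h1 : a * b * a = b * a * b)
    (h2 : b * c * b = c * b * c) (h3 : a * c = c * a) :
    a * b * (c * (b * a)) = c * b * (a * (b * c)) :=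
  calc a * b * (c * (b * a)) = a * (b * c * b) * a := by simp only [mul_assoc]
    _ = (a * c) * b * (c * a) := by rw [h2]; simp only [mul_assoc]
    _ = c * (a * b * a) * c := by rw [← h3]; rw [h3]; simp only [mul_assoc]; rw [h3]
    _ = c * b * (a * (b * c)) := by rw [h1]; simp only [mul_assoc]

theorem braid_word_three {H : Type*} [Group H] {a b c : H} (h1 : a * b * a = b * a * b)
    (h2 : b * c * b = c * b * c) (h3 : a * c = c * a) :
    b * a * (c * b * a) = c * (b * a * (c * b)) :=
  calc b * a * (c * b * a) = b * (a * c) * b * a := by simp only [mul_assoc]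
    _ = b * c * (a * b * a) := by rw [h3]; simp only [mul_assoc]
    _ = (b * c * b) * a * b := by rw [h1]; simp only [mul_assoc]
    _ = c * b * (c * a) * b := by rw [h2]; simp only [mul_assoc]
    _ = c * (b * a * (c * b)) := by rw [← h3]; simp only [mul_assoc]

theorem dblSig_braid {n : ℕ} (i j : Fin (n - 1)) (h : (j : ℕ) = i + 1) (k : Fin n) :
    dblSig n i (adj j (adj i k)) * (dblSig n j (adj i k) * dblSig n i k) =
      dblSig n j (adj i (adj j k)) * (dblSig n i (adj j k) * dblSig n j k) := by
  have hj := j.2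
  have h1 := sig_braid (n := n + 1) (i := i) (by omega)
  have h2 := sig_braid (n := n + 1) (i := i + 1) (by omega)
  have h3 := sig_comm (n + 1) (i := i) (j := i + 1 + 1) (by omega)
  rcases (by omega : (k : ℕ) < i ∨ (k : ℕ) = i ∨ (k : ℕ) = i + 1 ∨ (k : ℕ) = i + 1 + 1 ∨
      (i : ℕ) + 1 + 1 < k) with hk | hk | hk | hk | hk
  · simp [dblSig, adj_val, h, hk, hk.ne, (show (k : ℕ) ≠ i + 1 by omega),
      (show (k : ℕ) ≠ i + 1 + 1 by omega), (show (k : ℕ) < i + 1 by omega)]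
    simpa only [mul_assoc] using h2
  · simp [dblSig, adj_val, h, hk, (show (i : ℕ) ≠ i + 1 + 1 by omega),
      (show (i : ℕ) + 1 + 1 ≠ i by omega), (show ¬ (i : ℕ) + 1 < i by omega),
      (show ¬ (i : ℕ) + 1 + 1 < i by omega)]
    simpa only [mul_assoc] using braid_word_one h1 h2 h3
  · simp [dblSig, adj_val, h, hk, (show (i : ℕ) ≠ i + 1 + 1 by omega),
      (show (i : ℕ) + 1 + 1 ≠ i by omega), (show ¬ (i : ℕ) + 1 < i by omega),
      (show ¬ (i : ℕ) + 1 + 1 < i by omega)]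
    simpa only [mul_assoc] using braid_word_two h1 h2 h3
  · simp [dblSig, adj_val, h, hk, (show (i : ℕ) ≠ i + 1 + 1 by omega),
      (show (i : ℕ) + 1 + 1 ≠ i by omega), (show ¬ (i : ℕ) + 1 < i by omega),
      (show ¬ (i : ℕ) + 1 + 1 < i by omega)]
    simpa only [mul_assoc] using braid_word_three h1 h2 h3
  · simp [dblSig, adj_val, h, (show ¬ (k : ℕ) < i by omega), (show ¬ (k : ℕ) < i + 1 by omega),
      (show (k : ℕ) ≠ i by omega), (show (k : ℕ) ≠ i + 1 by omega),
      (show (k : ℕ) ≠ i + 1 + 1 by omega)]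
    simpa only [mul_assoc] using h1

/-- The action of the braid group on `n` strands on pairs of a position and a braid on `n + 1`
strands which doubles the strand that starts in the given position. -/
def dbl (n : ℕ) : BraidGroup n →* Equiv.Perm (Fin n × BraidGroup (n + 1)) :=
  lift dblGen
    (fun i j h => by
      ext1 x
      refine Prod.ext (DFunLike.congr_fun (adj_comm i j h) x.1) ?_
      change dblSig n i (adj j x.1) * (dblSig n j x.1 * x.2) =
        dblSig n j (adj i x.1) * (dblSig n i x.1 * x.2)
      rw [← mul_assoc, dblSig_comm i j h, mul_assoc])
    (fun i j h => by
      ext1 x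
      refine Prod.ext (DFunLike.congr_fun (adj_braid i j h) x.1) ?_
      change dblSig n i (adj j (adj i x.1)) * (dblSig n j (adj i x.1) * (dblSig n i x.1 * x.2)) =
        dblSig n j (adj i (adj j x.1)) * (dblSig n i (adj j x.1) * (dblSig n j x.1 * x.2))
      simpa only [mul_assoc] using congrArg (· * x.2) (dblSig_braid i j h x.1))

/-- The position of the strand `j` after the strand `k` has been doubled; the second copy of the
strand `k` has the position `k + 1`. -/
def pos {n : ℕ} (k j : Fin n) : Fin (n + 1) := if j ≤ k then j.castSucc else j.succ

/-- The properties of the action which show that doubling preserves pure braids. -/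
structure DblInv {n : ℕ} (p : Equiv.Perm (Fin n)) (f : Equiv.Perm (Fin n × BraidGroup (n + 1))) :
    Prop where
  fst : ∀ x, (f x).1 = p x.1
  mul : ∀ x g, f (x.1, x.2 * g) = ((f x).1, (f x).2 * g)
  pos : ∀ x j, (toPerm (n + 1) (f x).2)⁻¹ (pos (f x).1 (p j)) = (toPerm (n + 1) x.2)⁻¹ (pos x.1 j)
  succ : ∀ x, (toPerm (n + 1) (f x).2)⁻¹ (f x).1.succ = (toPerm (n + 1) x.2)⁻¹ x.1.succ

theorem pos_val {n : ℕ} (k j : Fin n) :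
    (pos k j : ℕ) = if (j : ℕ) ≤ k then (j : ℕ) else j + 1 := by
  unfold pos
  simp only [Fin.le_def]
  split_ifs <;> simp

theorem toPerm_dblSig {n : ℕ} (i : Fin (n - 1)) (k : Fin n) (x : Fin (n + 1)) :
    (toPerm (n + 1) (dblSig n i k) x : ℕ) =
      if (k : ℕ) < i then
        if (x : ℕ) = i + 1 then (i : ℕ) + 2 else if (x : ℕ) = i + 2 then (i : ℕ) + 1 else (x : ℕ)
      else if (k : ℕ) = i then
        if (x : ℕ) = i then (i : ℕ) + 1 else if (x : ℕ) = i + 1 then (i : ℕ) + 2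
        else if (x : ℕ) = i + 2 then (i : ℕ) else (x : ℕ)
      else if (k : ℕ) = i + 1 then
        if (x : ℕ) = i then (i : ℕ) + 2 else if (x : ℕ) = i + 1 then (i : ℕ)
        else if (x : ℕ) = i + 2 then (i : ℕ) + 1 else (x : ℕ)
      else if (x : ℕ) = i then (i : ℕ) + 1 else if (x : ℕ) = i + 1 then (i : ℕ) else (x : ℕ) := by
  have h1 : (i : ℕ) < n + 1 - 1 := by omega
  have h2 : (i : ℕ) + 1 < n + 1 - 1 := by omega
  unfold dblSig
  split_ifs <;>
    simp only [map_mul, Equiv.Perm.mul_apply, toPerm_sig_val h1, toPerm_sig_val h2] <;>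
    split_ifs <;> omega

theorem dblInv_gen {n : ℕ} (i : Fin (n - 1)) : DblInv (adj i) (dblGen i) := by
  refine ⟨fun _ => rfl, fun x g => ?_, fun x j => ?_, fun x => ?_⟩
  · simp [dblGen, mul_assoc]
  · change (toPerm (n + 1) (dblSig n i x.1 * x.2))⁻¹ (pos (adj i x.1) (adj i j)) = _
    rw [map_mul, mul_inv_rev, Equiv.Perm.mul_apply]
    congr 1
    rw [Equiv.Perm.inv_eq_iff_eq]
    ext
    simp only [toPerm_dblSig, pos_val, adj_val]
    grind
  · change (toPerm (n + 1) (dblSig n i x.1 * x.2))⁻¹ (adj i x.1).succ = _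
    rw [map_mul, mul_inv_rev, Equiv.Perm.mul_apply]
    congr 1
    rw [Equiv.Perm.inv_eq_iff_eq]
    ext
    simp only [toPerm_dblSig, adj_val, Fin.val_succ]
    grind

theorem dblInv_dbl {n : ℕ} (b : BraidGroup n) : DblInv (toPerm n b) (dbl n b) := by
  have hb : b ∈ Subgroup.closure (Set.range (PresentedGroup.of (rels := rels n))) := by
    rw [PresentedGroup.closure_range_of]; trivial
  induction hb using Subgroup.closure_induction with
  | mem b hb =>
    obtain ⟨i, rfl⟩ := hb
    rw [toPerm, dbl, lift_of, lift_of]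
    exact dblInv_gen i
  | one => rw [map_one, map_one]; exact ⟨fun _ => rfl, fun _ _ => rfl, fun _ _ => rfl, fun _ => rfl⟩
  | mul a b _ _ ha hb =>
    rw [map_mul, map_mul]
    refine ⟨fun x => ?_, fun x g => ?_, fun x j => ?_, fun x => ?_⟩
    · rw [Equiv.Perm.mul_apply, ha.fst, hb.fst]; rfl
    · rw [Equiv.Perm.mul_apply, hb.mul, ha.mul]; rfl
    · rw [Equiv.Perm.mul_apply, Equiv.Perm.mul_apply, ha.pos, hb.pos]
    · rw [Equiv.Perm.mul_apply, ha.succ, hb.succ]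
  | inv a _ ha =>
    rw [map_inv, map_inv]
    refine ⟨fun x => ?_, fun x g => ?_, fun x j => ?_, fun x => ?_⟩
    · rw [Equiv.Perm.eq_inv_iff_eq, ← ha.fst]; simp
    · rw [Equiv.Perm.inv_eq_iff_eq, ha.mul]
      simp
    · rw [← ha.pos]; simp
    · rw [← ha.succ]; simp

/-- Doubling the strand `t` of a pure braid: the degeneracy operator with index `t`. -/
def degen {n : ℕ} (t : Fin n) : PureBraidGroup n →* PureBraidGroup (n + 1) :=
  MonoidHom.mk' (fun b => ⟨(dbl n b.1 (t, 1)).2, by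
    have h := dblInv_dbl b.1
    have hb : toPerm n b.1 = 1 := b.2
    rw [hb] at h
    have h1 : (dbl n b.1 (t, 1)).1 = t := h.fst _
    rw [MonoidHom.mem_ker, ← inv_eq_one]
    refine Equiv.ext fun x => ?_
    have h2 := h.succ (t, 1)
    have h3 := h.pos (t, 1)
    rw [h1] at h2 h3
    simp only [map_one, inv_one, Equiv.Perm.one_apply] at h2 h3
    rcases lt_trichotomy (x : ℕ) (t + 1) with hx | hx | hx
    · have : x = pos t ⟨x, by omega⟩ := by
        rw [pos, if_pos (by rw [Fin.le_def]; simp only; omega)]; rfl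
      rw [this]; exact h3 _
    · have : x = t.succ := Fin.ext (by simpa using hx)
      rw [this]; exact h2
    · have : x = pos t ⟨x - 1, by omega⟩ := by
        rw [pos, if_neg (by rw [Fin.le_def]; simp only; omega)]
        ext; simp only [Fin.val_succ]; omega
      rw [this]; exact h3 _⟩)
    (fun a b => by
      have ha := dblInv_dbl a.1
      have hb := dblInv_dbl b.1
      have h1 : (dbl n b.1 (t, 1)).1 = t := by
        rw [hb.fst, show toPerm n b.1 = 1 from b.2]; rfl
      ext
      change (dbl n (a.1 * b.1) (t, 1)).2 = (dbl n a.1 (t, 1)).2 * (dbl n b.1 (t, 1)).2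
      have h2 := ha.mul (t, 1) (dbl n b.1 (t, 1)).2
      rw [map_mul, Equiv.Perm.mul_apply]
      have h3 : dbl n b.1 (t, 1) = (t, 1 * (dbl n b.1 (t, 1)).2) := by
        rw [one_mul]; exact Prod.ext h1 rfl
      rw [h3, h2]
      simp)

/-- The values of `Theta (n + 1)` on the generators. The generator with index `q` of the free group
in degree `n + 1` is the simplex `⟨0, …, 0, 1, …, 1⟩` of the simplicial circle with `q + 1` entries
`1`. It is obtained from the generator with the same index in degree `n` by doubling the first entry,
and for `q = n` from the generator with index `n - 1` by doubling the last entry. -/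
def thetaGen : (n : ℕ) → Fin (n + 1) → PureBraidGroup (n + 2)
  | 0 => fun _ => A 2 0 1
  | n + 1 => Fin.lastCases (degen (Fin.last (n + 1)) (thetaGen n (Fin.last n)))
      (fun q => degen 0 (thetaGen n q))

/-- The homomorphism from the free group on `n` generators to the pure braid group on `n + 1`
strands, that is, the component in degree `n` of the morphism of simplicial groups from Milnor's
free group on the simplicial circle which sends the simplex `⟨0, 1⟩` to `A 2 0 1`. -/
def Theta : (n : ℕ) → FreeGroup (Fin n) →* PureBraidGroup (n + 1)
  | 0 => 1
  | n + 1 => FreeGroup.lift (thetaGen n)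

end Braid

namespace Braid

/-- The last face operator `F_{n + 1} → F_n` of the simplicial group of free groups: it sends the
first generator to `1` and the generator with index `q + 1` to the one with index `q`. -/
def face (n : ℕ) : FreeGroup (Fin (n + 1)) →* FreeGroup (Fin n) :=
  FreeGroup.lift (Fin.cases 1 FreeGroup.of)

/-- The class in `E0` of the pure braid `A` for the strands `i` and `n`, where `n` is the last of the
`n + 1` strands `0, …, n`. -/
def lastClass (n : ℕ) (i : Fin n) : LCS.E0 (PureBraidGroup (n + 1)) :=
  LCS.E0.mk 0 (A (n + 1) i n) (Subgroup.mem_top _)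

/-- The morphism of Lie algebras from the free Lie algebra on `n` generators which sends the
generators to the classes `lastClass n i`. -/
def fibre (n : ℕ) : FreeLieAlgebra ℤ (Fin n) →ₗ⁅ℤ⁆ LCS.E0 (PureBraidGroup (n + 1)) :=
  FreeLieAlgebra.lift ℤ (lastClass n)

/-- The morphism of free Lie algebras which sends the first generator to the negative of the sum of
the other ones and each other generator to itself; it kills the sum of all generators. -/
def proj (n : ℕ) : FreeLieAlgebra ℤ (Fin (n + 1)) →ₗ⁅ℤ⁆ FreeLieAlgebra ℤ (Fin n) :=
  FreeLieAlgebra.lift ℤ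
    (Fin.cases (-∑ j : Fin n, FreeLieAlgebra.of ℤ j) (FreeLieAlgebra.of ℤ))

end Braid

end

/-! Put N = n + 1 and consider pure braids on N + 1 strands. Let x_i be the class of the braid in
which the last strand links the i-th one, s_m = x_1 + … + x_m and z = s_N. Conjugation makes the
braid group act on the linking classes through the symmetric group (`cj_lk`). Hence the
infinitesimal braid relations, and the fact that doubling a strand replaces a linking class by the
sum of the classes of the pairs lying over it, need to be checked only for the first strands. It
follows that `Theta` sends the generators to the classes c_m, the sums over all pairs separated by
the cut after the m-th strand (`cl_thetaGen`). Moreover c_N = z, and ⁅c_m, s_l⁆ equals ⁅s_l, z⁆ -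
2⁅s_l, s_m⁆ for l ≤ m and ⁅s_m, z⁆ for m ≤ l.

The kernel of the map induced by `face` is spanned by the iterated brackets of generators with the
first one, so its image I is spanned by the iterated brackets of the c_m with z. Likewise the kernel
of `proj` has as image the span K of the iterated brackets of the s_m with z. The heart of the proof
is I = K (`adSpan_eq`). The relations give I ⊆ K at once. Conversely, one works degree by degree on
K modulo its brackets. There ⁅s_l, z⁆ acts as zero, so the commutator of the actions of c_m and s_l
is twice that of s_m and s_l if l ≤ m, and zero if m < l. The peeling argument `Peel.Data.van`
removes the smallest and the largest letter in turn and shows that every word in the s_m, applied to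
z, lies in I up to higher degree. No division by two occurs.

Injectivity rests on three facts. The Lie algebra of a free group is the free Lie algebra
(`freeMap_injective`, by Magnus expansions and the embedding of the free Lie algebra in the free
associative one). The free Lie algebra on the x_i embeds in that of the pure braid group
(`fibre_injective`, by following the last strand through Artin's automorphisms). Finitely generated
modules are Hopfian. An automorphism of the free group carries the first generator to an element
with class z, so the kernel of `face` embeds in K = I in each range of degrees; since `Theta` maps
that kernel onto I, `injective_of_range_le` makes `Theta` injective on it. If u is any element
killed by `Theta`, its bracket with the first generator lies in that kernel and hence vanishes. The
centralizer of a generator is small enough to put u in the kernel too, so u = 0. Injectivity on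
groups follows since free groups are residually nilpotent. -/

noncomputable section

attribute [local instance] LieRing.ofAssociativeRing

/-! ### Lazard elimination and the embedding of the free Lie algebra in the free associative algebra
-/

namespace FreeLie

open FreeLieAlgebra (of)

/-- The universal property of the free Lie algebra over the integers, for Lie rings. -/
def lift {X : Type} {L : Type*} [LieRing L] (f : X → L) : FreeLieAlgebra ℤ X →ₗ⁅ℤ⁆ L :=
  FreeLieAlgebra.lift ℤ f

theorem lift_of {X : Type} {L : Type*} [LieRing L] (f : X → L) (x : X) :
    lift f (of ℤ x) = f x :=
  FreeLieAlgebra.lift_of_apply f x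

theorem hom_ext {X : Type} {L : Type*} [LieRing L] {f g : FreeLieAlgebra ℤ X →ₗ⁅ℤ⁆ L}
    (h : ∀ x, f (of ℤ x) = g (of ℤ x)) : f = g :=
  FreeLieAlgebra.hom_ext h

/-- A homomorphism of rings as a morphism of Lie algebras. -/
def ofRingHom {A B : Type*} [Ring A] [Ring B] (f : A →+* B) : A →ₗ⁅ℤ⁆ B :=
  { f.toAddMonoidHom.toIntLinearMap with
    map_lie' := by
      intro a b
      simp [LieRing.of_associative_ring_bracket] }

theorem ofRingHom_apply {A B : Type*} [Ring A] [Ring B] (f : A →+* B) (a : A) :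
    ofRingHom f a = f a := rfl

/-- The canonical morphism from the free Lie algebra to the free associative algebra. -/
def toAssoc (X : Type) : FreeLieAlgebra ℤ X →ₗ⁅ℤ⁆ FreeAlgebra ℤ X :=
  lift (FreeAlgebra.ι ℤ)

theorem toAssoc_of {X : Type} (x : X) : toAssoc X (of ℤ x) = FreeAlgebra.ι ℤ x :=
  lift_of _ x

/-- Lifting the generators into `S` and then including gives the identity, by the universal
property. -/
theorem mem_of_generators {X : Type} (S : LieSubalgebra ℤ (FreeLieAlgebra ℤ X))
    (h : ∀ x, of ℤ x ∈ S) (u : FreeLieAlgebra ℤ X) : u ∈ S := by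
  have h1 : S.incl.comp (lift fun x => (⟨of ℤ x, h x⟩ : S)) =
      (LieHom.id : _ →ₗ⁅ℤ⁆ FreeLieAlgebra ℤ X) := by
    apply hom_ext
    intro x
    simp [lift_of]
  have h2 := LieHom.congr_fun h1 u
  simp only [LieHom.comp_apply, LieHom.id_apply] at h2
  rw [← h2]
  exact Subtype.property _

/-- `HasWt w d u` says that `u` is a combination of brackets of weight at most `d`, where `w` gives
the weights of the generators. -/
inductive HasWt {X : Type} (w : X → ℕ) : ℕ → FreeLieAlgebra ℤ X → Prop
  | of (x : X) : HasWt w (w x) (FreeLieAlgebra.of ℤ x)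
  | zero (d : ℕ) : HasWt w (d + 1) 0
  | add {d : ℕ} {u v} : HasWt w d u → HasWt w d v → HasWt w d (u + v)
  | smul {d : ℕ} (c : ℤ) {u} : HasWt w d u → HasWt w d (c • u)
  | lie {a b : ℕ} {u v} : HasWt w a u → HasWt w b v → HasWt w (a + b) ⁅u, v⁆
  | mono {a b : ℕ} {u} : a ≤ b → HasWt w a u → HasWt w b u

/-- This is why the constructor `zero` starts at weight one: the case `d = 0` of `eq_zero_of_hasWt`
becomes vacuous. -/
theorem HasWt.pos {X : Type} {w : X → ℕ} (hw : ∀ x, 0 < w x) {d : ℕ} {u} (h : HasWt w d u) :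
    0 < d := by
  induction h with
  | of x => exact hw x
  | zero d => omega
  | add _ _ ih _ => exact ih
  | smul _ _ ih => exact ih
  | lie _ _ ih _ => omega
  | mono h _ ih => omega

theorem exists_hasWt {X : Type} (w : X → ℕ) (u : FreeLieAlgebra ℤ X) : ∃ d, HasWt w d u := by
  let S : LieSubalgebra ℤ (FreeLieAlgebra ℤ X) :=
    { carrier := {u | ∃ d, HasWt w d u}
      add_mem' := by
        rintro u v ⟨a, ha⟩ ⟨b, hb⟩
        exact ⟨a + b, (ha.mono (by omega)).add (hb.mono (by omega))⟩
      zero_mem' := ⟨_, .zero 0⟩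
      smul_mem' := by
        rintro c u ⟨a, ha⟩
        exact ⟨a, ha.smul c⟩
      lie_mem' := by
        rintro u v ⟨a, ha⟩ ⟨b, hb⟩
        exact ⟨_, ha.lie hb⟩ }
  exact mem_of_generators S (fun x => ⟨_, .of x⟩) u

/-- If all weights are at least two then they can be lowered by one. -/
theorem HasWt.pred {X : Type} {w : X → ℕ} (hw : ∀ x, 2 ≤ w x) {d : ℕ} {u} (h : HasWt w d u) :
    u = 0 ∨ ∃ e, e + 1 = d ∧ HasWt (fun x => w x - 1) e u := by
  induction h with
  | of x => exact Or.inr ⟨w x - 1, by have := hw x; omega, .of x⟩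
  | zero d => exact Or.inl rfl
  | add _ _ ih1 ih2 =>
    rcases ih1 with rfl | ⟨e, he, h1⟩
    · simpa using ih2
    · rcases ih2 with rfl | ⟨e', he', h2⟩
      · exact Or.inr ⟨e, he, by simpa using h1⟩
      · obtain rfl : e = e' := by omega
        exact Or.inr ⟨e, he, h1.add h2⟩
  | smul c _ ih =>
    rcases ih with rfl | ⟨e, he, h1⟩
    · simp
    · exact Or.inr ⟨e, he, h1.smul c⟩
  | lie _ _ ih1 ih2 =>
    rcases ih1 with rfl | ⟨e, he, h1⟩
    · simp
    · rcases ih2 with rfl | ⟨e', he', h2⟩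
      · simp
      -- Lowering both factors lowers the bracket by two; `mono` gives one back.
      · exact Or.inr ⟨e + e' + 1, by omega, (h1.lie h2).mono (by omega)⟩
  | mono h _ ih =>
    rcases ih with rfl | ⟨e, he, h1⟩
    · simp
    · exact Or.inr ⟨_ - 1, Nat.sub_add_cancel (by omega), h1.mono (by omega)⟩

section Elimination

variable {X : Type} (x₀ : X)

/-- The generators that remain after the generator `x₀` has been eliminated: `(x, k)` stands for the
element obtained from `x` by bracketing `k` times with `x₀`. -/
abbrev Elim : Type := {x : X // x ≠ x₀} × ℕ

/-- The element for which a generator in `Elim x₀` stands. -/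
def iterLie {L : Type*} [LieRing L] (a b : L) : ℕ → L
  | 0 => b
  | k + 1 => ⁅a, iterLie a b k⁆

theorem map_iterLie {L M : Type*} [LieRing L] [LieAlgebra ℤ L] [LieRing M] [LieAlgebra ℤ M]
    (f : L →ₗ⁅ℤ⁆ M) (a b : L) (k : ℕ) : f (iterLie a b k) = iterLie (f a) (f b) k := by
  induction k with
  | zero => rfl
  | succ k ih => rw [iterLie, LieHom.map_lie, ih, iterLie]

/-- The morphism of free Lie algebras that interprets the generators in `Elim x₀`. -/
def elimMap : FreeLieAlgebra ℤ (Elim x₀) →ₗ⁅ℤ⁆ FreeLieAlgebra ℤ X :=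
  lift fun y => iterLie (of ℤ x₀) (of ℤ y.1.1) y.2

theorem elimMap_of (y : Elim x₀) :
    elimMap x₀ (of ℤ y) = iterLie (of ℤ x₀) (of ℤ y.1.1) y.2 :=
  lift_of _ y

/-- The weights of the generators in `Elim x₀`, where `x₀` has weight one. -/
def elimWt (w : X → ℕ) (y : Elim x₀) : ℕ := w y.1.1 + y.2

/-- On a generator the bracket with `x₀` raises the index by one, and the Leibniz rule does the
rest. So the image of `elimMap` is stable under `x₀`, at the price of one unit of weight. -/
theorem exists_lie_elimMap {w : X → ℕ} {d : ℕ} {v : FreeLieAlgebra ℤ (Elim x₀)}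
    (h : HasWt (elimWt x₀ w) d v) : ∃ v', HasWt (elimWt x₀ w) (d + 1) v' ∧
      ⁅of ℤ x₀, elimMap x₀ v⁆ = elimMap x₀ v' := by
  induction h with
  | of y => exact ⟨of ℤ (y.1, y.2 + 1), HasWt.of (w := elimWt x₀ w) (y.1, y.2 + 1), by
      rw [elimMap_of, elimMap_of]; rfl⟩
  | zero d => exact ⟨0, .zero _, by simp⟩
  | add _ _ ih1 ih2 =>
    obtain ⟨v1, h1, e1⟩ := ih1
    obtain ⟨v2, h2, e2⟩ := ih2
    exact ⟨v1 + v2, h1.add h2, by simp [e1, e2]⟩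
  | smul c _ ih =>
    obtain ⟨v1, h1, e1⟩ := ih
    exact ⟨c • v1, h1.smul c, by simp [e1]⟩
  | @lie a b u v hu hv ih1 ih2 =>
    obtain ⟨v1, h1, e1⟩ := ih1
    obtain ⟨v2, h2, e2⟩ := ih2
    refine ⟨⁅v1, v⁆ + ⁅u, v2⁆, ((h1.lie hv).mono (by omega)).add ((hu.lie h2).mono (by omega)), ?_⟩
    rw [LieHom.map_lie, leibniz_lie, e1, e2, map_add, LieHom.map_lie, LieHom.map_lie]
  | mono h _ ih =>
    obtain ⟨v1, h1, e1⟩ := ih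
    exact ⟨v1, h1.mono (by omega), e1⟩

/-- Lazard elimination: the multiples of `x₀` and the image of `elimMap` contain all generators, and
their sum is closed under brackets. Only existence of the decomposition is asserted. -/
theorem exists_elim {w : X → ℕ} (hw : ∀ x, 0 < w x) {d : ℕ} {u : FreeLieAlgebra ℤ X}
    (h : HasWt w d u) : ∃ (c : ℤ) (v : FreeLieAlgebra ℤ (Elim x₀)), HasWt (elimWt x₀ w) d v ∧
      u = c • of ℤ x₀ + elimMap x₀ v := by
  induction h with
  | of x =>
    by_cases hx : x = x₀
    · subst hx
      refine ⟨1, 0, ?_, by simp⟩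
      have := HasWt.zero (w := elimWt x w) (w x - 1)
      rwa [Nat.sub_add_cancel (hw x)] at this
    · refine ⟨0, of ℤ (⟨x, hx⟩, 0), HasWt.of (w := elimWt x₀ w) (⟨x, hx⟩, 0), ?_⟩
      rw [elimMap_of]; simp [iterLie]
  | zero d => exact ⟨0, 0, .zero d, by simp⟩
  | add _ _ ih1 ih2 =>
    obtain ⟨c1, v1, h1, rfl⟩ := ih1
    obtain ⟨c2, v2, h2, rfl⟩ := ih2
    exact ⟨c1 + c2, v1 + v2, h1.add h2, by rw [add_smul, map_add]; abel⟩
  | smul c _ ih =>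
    obtain ⟨c1, v1, h1, rfl⟩ := ih
    exact ⟨c * c1, c • v1, h1.smul c, by rw [smul_add, mul_smul, map_smul]⟩
  | @lie a b u v hu hv ih1 ih2 =>
    have ha := hu.pos hw
    have hb := hv.pos hw
    obtain ⟨c1, v1, h1, rfl⟩ := ih1
    obtain ⟨c2, v2, h2, rfl⟩ := ih2
    obtain ⟨v1', h1', e1⟩ := exists_lie_elimMap x₀ h1
    obtain ⟨v2', h2', e2⟩ := exists_lie_elimMap x₀ h2
    refine ⟨0, c1 • v2' + (-c2) • v1' + ⁅v1, v2⁆,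
      -- The bracket with `x₀` costs one unit of weight, which the positive weight of the other
      -- factor covers.
      (((h2'.mono (by omega)).smul _).add ((h1'.mono (by omega)).smul _)).add (h1.lie h2), ?_⟩
    have e3 : ⁅elimMap x₀ v1, of ℤ x₀⁆ = - elimMap x₀ v1' := by rw [← e1, lie_skew]
    simp only [lie_add, add_lie, lie_smul, smul_lie, lie_self, smul_zero, zero_smul, e2, e3,
      map_add, map_smul, LieHom.map_lie, zero_add, neg_smul, smul_neg, map_neg]
    abel
  | mono h _ ih =>
    obtain ⟨v1, c, h1, e1⟩ := ih
    exact ⟨v1, c, h1.mono h, e1⟩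

/-- The homomorphism from the free algebra to dual numbers which encodes the derivation
that raises the index of each generator. -/
def shiftDual : FreeAlgebra ℤ (Elim x₀) →ₐ[ℤ] DualNumber (FreeAlgebra ℤ (Elim x₀)) :=
  FreeAlgebra.lift ℤ fun y => TrivSqZeroExt.inl (FreeAlgebra.ι ℤ y) +
    TrivSqZeroExt.inr (FreeAlgebra.ι ℤ (y.1, y.2 + 1))

theorem fst_shiftDual (a : FreeAlgebra ℤ (Elim x₀)) : (shiftDual x₀ a).fst = a := by
  induction a with
  | grade0 r => simp [← TrivSqZeroExt.inl_intCast]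
  | grade1 y => simp [shiftDual]
  | mul a b ha hb => rw [map_mul, TrivSqZeroExt.fst_mul, ha, hb]
  | add a b ha hb => rw [map_add, TrivSqZeroExt.fst_add, ha, hb]

/-- The derivation of the free algebra that raises the index of each generator. -/
def shiftDer : AddMonoid.End (FreeAlgebra ℤ (Elim x₀)) :=
  AddMonoidHom.mk' (fun a => (shiftDual x₀ a).snd)
    fun a b => by rw [map_add, TrivSqZeroExt.snd_add]

theorem shiftDer_apply (a : FreeAlgebra ℤ (Elim x₀)) : shiftDer x₀ a = (shiftDual x₀ a).snd := rfl

/-- The Leibniz rule is the multiplication rule of dual numbers, read off from the second component.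
-/
theorem shiftDer_mul (a b : FreeAlgebra ℤ (Elim x₀)) :
    shiftDer x₀ (a * b) = a * shiftDer x₀ b + shiftDer x₀ a * b := by
  simp [shiftDer_apply, fst_shiftDual]

theorem shiftDer_ι (y : Elim x₀) :
    shiftDer x₀ (FreeAlgebra.ι ℤ y) = FreeAlgebra.ι ℤ (y.1, y.2 + 1) := by
  simp [shiftDer_apply, shiftDual]

open Classical in
/-- The action of the free algebra on `X` on the free algebra on `Elim x₀`. -/
def elimAct : FreeAlgebra ℤ X →ₐ[ℤ] AddMonoid.End (FreeAlgebra ℤ (Elim x₀)) :=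
  FreeAlgebra.lift ℤ fun x => if h : x = x₀ then shiftDer x₀ else
    Module.toAddMonoidEnd _ _ (FreeAlgebra.ι ℤ ((⟨x, h⟩, 0) : Elim x₀))

/-- The commutator of a derivation with left multiplication by `a` is left multiplication by the
derivative of `a`. Hence the iterated bracket named by `(x, k)` acts as left multiplication by the
generator `(x, k)`. -/
theorem elimAct_toAssoc (v : FreeLieAlgebra ℤ (Elim x₀)) :
    elimAct x₀ (toAssoc X (elimMap x₀ v)) = Module.toAddMonoidEnd _ _ (toAssoc _ v) := by
  have h : ((ofRingHom (elimAct x₀).toRingHom).comp (toAssoc X)).comp (elimMap x₀) =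
      (ofRingHom (Module.toAddMonoidEnd (FreeAlgebra ℤ (Elim x₀)) (FreeAlgebra ℤ (Elim x₀)))).comp
        (toAssoc _) := by
    apply hom_ext
    rintro ⟨x, k⟩
    rw [LieHom.comp_apply, elimMap_of, map_iterLie]
    simp only [LieHom.comp_apply, toAssoc_of, ofRingHom_apply, AlgHom.toRingHom_eq_coe,
      RingHom.coe_coe]
    induction k with
    | zero => simp [iterLie, elimAct, x.2]
    | succ k ih =>
      rw [iterLie, ih]
      refine AddMonoidHom.ext fun a => ?_
      change (elimAct x₀ (FreeAlgebra.ι ℤ x₀)) (FreeAlgebra.ι ℤ (x, k) * a) -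
        FreeAlgebra.ι ℤ (x, k) * (elimAct x₀ (FreeAlgebra.ι ℤ x₀)) a =
          FreeAlgebra.ι ℤ (x, k + 1) * a
      simp [elimAct, shiftDer_mul, shiftDer_ι]
  exact LieHom.congr_fun h v

open Classical in
-- Send `x₀` to the variable of a polynomial ring and the other generators to zero. The target is
-- commutative, so all brackets die and only the multiple of `x₀` survives.
theorem elim_coeff_eq_zero {c : ℤ} {v : FreeLieAlgebra ℤ (Elim x₀)}
    (h : toAssoc X (c • of ℤ x₀ + elimMap x₀ v) = 0) : c = 0 := by
  let f : FreeAlgebra ℤ X →ₐ[ℤ] Polynomial ℤ :=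
    FreeAlgebra.lift ℤ fun x => if x = x₀ then Polynomial.X else 0
  have h1 : ((ofRingHom f.toRingHom).comp (toAssoc X)).comp (elimMap x₀) = 0 := by
    apply hom_ext
    rintro ⟨x, k⟩
    rw [LieHom.comp_apply, elimMap_of, map_iterLie]
    cases k with
    | zero => simp [iterLie, toAssoc_of, ofRingHom_apply, f, x.2]
    | succ k =>
      rw [iterLie, LieRing.of_associative_ring_bracket, mul_comm, sub_self]
      rfl
  have h2 : f (toAssoc X (elimMap x₀ v)) = 0 := LieHom.congr_fun h1 v
  have h3 := congrArg f h
  rw [map_add, map_add, h2, map_smul, toAssoc_of] at h3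
  have h4 := congrArg (fun p => Polynomial.coeff p 1) h3
  simpa [f] using h4

end Elimination

/-- Double induction on the weight bound `d` and the number `r` of generators of weight one. Without
such generators all weights drop by one, which lowers `d`. Otherwise eliminating one of them keeps
`d` and lowers `r`. Elimination produces infinitely many generators, so only finiteness in each
weight is required. -/
theorem eq_zero_of_hasWt (d r : ℕ) : ∀ (X : Type) (w : X → ℕ), (∀ x, 0 < w x) →
    (∀ k, {x | w x = k}.Finite) → {x | w x = 1}.ncard = r → ∀ u, HasWt w d u →
    toAssoc X u = 0 → u = 0 := by
  induction d generalizing r with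
  | zero =>
    intro X w hw _ _ u hu _
    exact absurd (hu.pos hw) (lt_irrefl _)
  | succ d ihd =>
    induction r with
    | zero =>
      intro X w hw hf hr u hu h
      have hw2 : ∀ x, 2 ≤ w x := by
        intro x
        have h1 := hw x
        have h2 : w x ≠ 1 := by
          intro hx
          rw [Set.ncard_eq_zero (hf 1)] at hr
          have : x ∈ {x | w x = 1} := hx
          rw [hr] at this
          exact this
        omega
      rcases hu.pred hw2 with rfl | ⟨e, he, h1⟩
      · rfl
      · obtain rfl : e = d := by omega
        refine ihd _ X (fun x => w x - 1) (fun x => by have := hw2 x; omega) (fun k => ?_)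
          rfl u h1 h
        refine (hf (k + 1)).subset fun x hx => ?_
        have h3 := hw2 x
        simp only [Set.mem_ofPred_eq] at hx ⊢
        omega
    | succ r ihr =>
      intro X w hw hf hr u hu h
      obtain ⟨x₀, hx₀⟩ : {x | w x = 1}.Nonempty := by
        rw [← Set.ncard_pos (hf 1)]; omega
      obtain ⟨c, v, hv, rfl⟩ := exists_elim x₀ hw hu
      obtain rfl := elim_coeff_eq_zero x₀ h
      suffices hv0 : v = 0 by simp [hv0]
      refine ihr _ (elimWt x₀ w) (fun y => ?_) (fun k => ?_) ?_ v hv ?_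
      · have := hw y.1.1
        simp only [elimWt]; omega
      · have h1 : (⋃ i ∈ Set.Iic k, {x | w x = i}).Finite :=
          (Set.finite_Iic k).biUnion fun i _ => hf i
        have h2 : {x : {x // x ≠ x₀} | w x.1 ≤ k}.Finite := by
          refine Set.Finite.subset (h1.preimage Subtype.val_injective.injOn) fun x hx => ?_
          simpa using hx
        refine (h2.prod (Set.finite_Iic k)).subset ?_
        rintro ⟨x, j⟩ hx
        simp only [elimWt, Set.mem_ofPred_eq, Set.mem_prod, Set.mem_Iic] at hx ⊢
        omega
      -- Weight one forces index zero on an original generator of weight one other than `x₀`, so the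
      -- count drops by exactly one.
      · have h1 : ((fun y : Elim x₀ => y.1.1) '' {y | elimWt x₀ w y = 1}) =
            {x | w x = 1} \ {x₀} := by
          ext x
          simp only [elimWt, Set.mem_image, Set.mem_ofPred_eq, Prod.exists, Subtype.exists,
            Set.mem_sdiff, Set.mem_singleton_iff]
          constructor
          · rintro ⟨y, hy, k, hk, rfl⟩
            exact ⟨by have := hw y; omega, hy⟩
          · rintro ⟨h1, h2⟩
            exact ⟨x, h2, 0, by omega, rfl⟩
        rw [← Set.InjOn.ncard_image (f := fun y : Elim x₀ => y.1.1), h1,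
          Set.ncard_sdiff_singleton_of_mem hx₀, hr]
        · omega
        · rintro ⟨⟨x, hx⟩, i⟩ hi ⟨⟨y, hy⟩, j⟩ hj hxy
          simp only [elimWt, Set.mem_ofPred_eq] at hi hj hxy
          subst hxy
          have := hw x
          obtain rfl : i = j := by omega
          rfl
      · have h1 := elimAct_toAssoc x₀ v
        rw [zero_smul, zero_add] at h
        rw [h, map_zero] at h1
        -- The zero element acts as zero; evaluating the action at `1` recovers the associative
        -- image of `v`.
        have h2 : 0 = toAssoc _ v * 1 := DFunLike.congr_fun h1 1
        rw [← mul_one (toAssoc _ v), ← h2]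

/-- The free Lie algebra embeds in the free associative algebra. -/
theorem toAssoc_injective (X : Type) [Finite X] : Function.Injective (toAssoc X) := by
  rw [injective_iff_map_eq_zero]
  intro u hu
  obtain ⟨d, hd⟩ := exists_hasWt (fun _ => 1) u
  exact eq_zero_of_hasWt d _ X (fun _ => 1) (fun _ => one_pos) (fun k => Set.toFinite _) rfl u hd hu

end FreeLie

end

/-! ### Magnus expansions and leading coefficients -/

noncomputable section

attribute [local instance] LieRing.ofAssociativeRing

namespace LCS

theorem mem_zero {G : Type*} [Group G] (g : G) : g ∈ Gam G 0 := Subgroup.mem_top g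

end LCS

namespace Magnus

open PowerSeries LCS

variable {R : Type} [Ring R]

/-- The unit `1 + r X` of the ring of power series. -/
def oneAdd (r : R) : R⟦X⟧ˣ where
  val := 1 + C r * X
  inv := invOfUnit (1 + C r * X) 1
  val_inv := mul_invOfUnit _ 1 (by simp)
  inv_val := MvPowerSeries.invOfUnit_mul _ 1 (by
    change constantCoeff (1 + C r * X) = _
    simp)

variable (R) in
/-- The units which are congruent to `1` modulo `X ^ k`. -/
def filt (k : ℕ) : Subgroup R⟦X⟧ˣ where
  carrier := {u | ∃ c, (u : R⟦X⟧) = 1 + X ^ k * c}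
  mul_mem' := by
    rintro u v ⟨c, hc⟩ ⟨d, hd⟩
    refine ⟨c * v + d, ?_⟩
    rw [Units.val_mul, mul_add, ← mul_assoc, hc, add_mul, one_mul]
    nth_rewrite 1 [hd]
    abel
  one_mem' := ⟨0, by simp⟩
  inv_mem' := by
    rintro u ⟨c, hc⟩
    refine ⟨-(c * ↑u⁻¹), ?_⟩
    have h : (u : R⟦X⟧) * ↑u⁻¹ = 1 := u.mul_inv
    nth_rewrite 1 [hc] at h
    rw [add_mul, one_mul, mul_assoc] at h
    rw [mul_neg, ← sub_eq_add_neg, ← h, add_sub_cancel_right]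

theorem oneAdd_mem (r : R) : oneAdd r ∈ filt R 1 := ⟨C r, by rw [pow_one, X_mul]; rfl⟩

/-- Since `X` is central, `u v - v u` is `X ^ (a + b) * (c d - d c)`; multiplying by `u⁻¹ v⁻¹` on
the right turns this difference into the commutator minus one. -/
theorem commutator_val {a b : ℕ} {u v : R⟦X⟧ˣ} {c d : R⟦X⟧} (hu : (u : R⟦X⟧) = 1 + X ^ a * c)
    (hv : (v : R⟦X⟧) = 1 + X ^ b * d) :
    ((⁅u, v⁆ : R⟦X⟧ˣ) : R⟦X⟧) = 1 + X ^ (a + b) *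
      ((c * d - d * c) * ((u⁻¹ : R⟦X⟧ˣ) : R⟦X⟧) * ((v⁻¹ : R⟦X⟧ˣ) : R⟦X⟧)) := by
  have h1 : X ^ (a + b) * (c * d - d * c) = (u : R⟦X⟧) * (v : R⟦X⟧) - (v : R⟦X⟧) * (u : R⟦X⟧) := by
    have e1 : X ^ a * c * (X ^ b * d) = X ^ (a + b) * (c * d) := by
      rw [mul_assoc, ← mul_assoc c, (commute_X_pow c b).eq, mul_assoc, ← mul_assoc, ← pow_add]
    have e2 : X ^ b * d * (X ^ a * c) = X ^ (a + b) * (d * c) := by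
      rw [mul_assoc, ← mul_assoc d, (commute_X_pow d a).eq, mul_assoc, ← mul_assoc, ← pow_add,
        add_comm b a]
    rw [hu, hv, mul_sub, ← e1, ← e2]
    noncomm_ring
  rw [← mul_assoc, ← mul_assoc, h1, commutatorElement_def]
  simp only [Units.val_mul, sub_mul]
  have h2 : (v : R⟦X⟧) * u * ↑u⁻¹ * ↑v⁻¹ = 1 := by
    rw [mul_assoc (v : R⟦X⟧), Units.mul_inv, mul_one, Units.mul_inv]
  rw [h2]
  abel

theorem constantCoeff_eq_one {k : ℕ} (hk : 0 < k) {u : R⟦X⟧ˣ} (hu : u ∈ filt R k) :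
    constantCoeff (u : R⟦X⟧) = 1 := by
  obtain ⟨c, hc⟩ := hu
  rw [hc]
  simp [hk.ne']

theorem coeff_of_eq {k : ℕ} (hk : 0 < k) {u c : R⟦X⟧} (hu : u = 1 + X ^ k * c) :
    coeff k u = constantCoeff c := by
  have h := coeff_X_pow_mul c k 0
  rw [zero_add] at h
  rw [hu, map_add, h, coeff_one, if_neg hk.ne', zero_add, coeff_zero_eq_constantCoeff_apply]

theorem coeff_mul_of_mem {k : ℕ} (hk : 0 < k) {u v : R⟦X⟧ˣ} (hu : u ∈ filt R k)
    (hv : v ∈ filt R k) :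
    coeff k ((u * v : R⟦X⟧ˣ) : R⟦X⟧) = coeff k (u : R⟦X⟧) + coeff k (v : R⟦X⟧) := by
  obtain ⟨c, hc⟩ := hu
  have h1 := constantCoeff_eq_one hk hv
  obtain ⟨d, hd⟩ := hv
  have h : ((u * v : R⟦X⟧ˣ) : R⟦X⟧) = 1 + X ^ k * (c * (v : R⟦X⟧) + d) := by
    rw [Units.val_mul, mul_add, ← mul_assoc, hc, add_mul, one_mul]
    nth_rewrite 1 [hd]
    abel
  rw [coeff_of_eq hk h, coeff_of_eq hk hc, coeff_of_eq hk hd]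
  simp [h1]

theorem coeff_eq_zero_of_mem {k : ℕ} (hk : 0 < k) {u : R⟦X⟧ˣ} (hu : u ∈ filt R (k + 1)) :
    coeff k (u : R⟦X⟧) = 0 := by
  obtain ⟨c, hc⟩ := hu
  have h : (u : R⟦X⟧) = 1 + X ^ k * (X * c) := by rw [hc, pow_succ, mul_assoc]
  rw [coeff_of_eq hk h]
  simp

variable {G : Type} [Group G]

theorem mem_filt (ρ : G →* R⟦X⟧ˣ) (hρ : ∀ g, ρ g ∈ filt R 1) {k : ℕ} {g : G} (hg : g ∈ Gam G k) :
    ρ g ∈ filt R (k + 1) := by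
  induction k generalizing g with
  | zero => exact hρ g
  | succ k ih =>
    suffices h : Gam G (k + 1) ≤ (filt R (k + 1 + 1)).comap ρ from h hg
    refine Subgroup.commutator_le.2 fun x hx y _ => ?_
    obtain ⟨c, hc⟩ := ih hx
    obtain ⟨d, hd⟩ := hρ y
    rw [Subgroup.mem_comap, map_commutatorElement]
    exact ⟨_, commutator_val hc hd⟩

variable (ρ : G →* R⟦X⟧ˣ) (hρ : ∀ g, ρ g ∈ filt R 1)

/-- The leading coefficient of a class. -/
def leadQuo (k : ℕ) : Quo G k →* Multiplicative R :=
  QuotientGroup.lift _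
    (MonoidHom.mk' (fun x : Gam G k => Multiplicative.ofAdd (coeff (k + 1) (ρ x.1 : R⟦X⟧)))
      (fun x y => by
        rw [← ofAdd_add, ← coeff_mul_of_mem k.succ_pos (mem_filt ρ hρ x.2) (mem_filt ρ hρ y.2),
          ← map_mul]
        rfl))
    (fun x hx => congrArg Multiplicative.ofAdd
      (coeff_eq_zero_of_mem k.succ_pos (mem_filt ρ hρ (Subgroup.mem_subgroupOf.1 hx))))

/-- The additive map that takes leading coefficients. -/
def leadAdd : E0 G →+ R := E0.lift fun k => MonoidHom.toAdditiveLeft (leadQuo ρ hρ k)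

theorem leadAdd_mk {k : ℕ} {x : G} (hx : x ∈ Gam G k) :
    leadAdd ρ hρ (E0.mk k x hx) = coeff (k + 1) (ρ x : R⟦X⟧) := by
  rw [leadAdd, E0.mk, E0.lift_of]; rfl

/-- The morphism of Lie algebras that takes leading coefficients. -/
def lead : E0 G →ₗ⁅ℤ⁆ R :=
  { (leadAdd ρ hρ).toIntLinearMap with
    map_lie' := by
      intro u v
      change leadAdd ρ hρ ⁅u, v⁆ = ⁅leadAdd ρ hρ u, leadAdd ρ hρ v⁆
      induction u using E0.induction with
      | h0 => simp
      | ha u u' hu hu' => simp [hu, hu']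
      | hm k x hx =>
      induction v using E0.induction with
      | h0 => simp
      | ha u u' hu hu' => simp [hu, hu']
      | hm l y hy =>
        obtain ⟨c, hc⟩ := mem_filt ρ hρ hx
        obtain ⟨d, hd⟩ := mem_filt ρ hρ hy
        have h := commutator_val hc hd
        -- The summand with index `k` has weight `k + 1`, so the bracket is read off at the exponent
        -- `(k + 1) + (l + 1)`.
        have e : k + l + 1 + 1 = k + 1 + (l + 1) := by omega
        rw [E0.mk_lie_mk, leadAdd_mk, leadAdd_mk, leadAdd_mk, map_commutatorElement, e,
          coeff_of_eq (by omega) h, coeff_of_eq (by omega) hc, coeff_of_eq (by omega) hd]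
        have h1 := constantCoeff_eq_one one_pos (inv_mem (hρ x))
        have h2 := constantCoeff_eq_one one_pos (inv_mem (hρ y))
        simp [h1, h2, LieRing.of_associative_ring_bracket] }

theorem lead_mk {k : ℕ} {x : G} (hx : x ∈ Gam G k) :
    lead ρ hρ (E0.mk k x hx) = coeff (k + 1) (ρ x : R⟦X⟧) := leadAdd_mk ρ hρ hx

/-- The representation of a free group that sends the generator `x` to `1 + e x X`. -/
def rep {X : Type} (e : X → R) : FreeGroup X →* R⟦X⟧ˣ := FreeGroup.lift fun x => oneAdd (e x)

theorem rep_mem {X : Type} (e : X → R) (g : FreeGroup X) : rep e g ∈ filt R 1 := by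
  induction g using FreeGroup.induction_on with
  | C1 => rw [map_one]; exact one_mem _
  | of x => rw [rep, FreeGroup.lift_apply_of]; exact oneAdd_mem _
  | inv_of x h => rw [map_inv]; exact inv_mem h
  | mul x y hx hy => rw [map_mul]; exact mul_mem hx hy

end Magnus

/-! ### The Lie algebra of a free group is the free Lie algebra -/

namespace LCS

/-- Each stage is generated by commutators of the previous stage with the group, so the Lie algebra
is generated by its part of weight one. -/
theorem mem_of_degree_zero {G : Type*} [Group G] (S : LieSubalgebra ℤ (E0 G))
    (h : ∀ g, E0.mk 0 g (mem_zero g) ∈ S) (u : E0 G) : u ∈ S := by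
  induction u using E0.induction with
  | h0 => exact zero_mem _
  | ha u v hu hv => exact add_mem hu hv
  | hm k x hx =>
    induction k generalizing x with
    | zero => exact h x
    | succ k ih =>
      have hx' : x ∈ Subgroup.closure {g | ∃ a ∈ Gam G k, ∃ b ∈ (⊤ : Subgroup G), ⁅a, b⁆ = g} := hx
      induction hx' using Subgroup.closure_induction with
      | mem x h1 =>
        obtain ⟨a, ha, b, hb, rfl⟩ := h1
        have h2 := S.lie_mem (ih a ha) (h b)
        rwa [E0.mk_lie_mk] at h2
      | one =>
        have : E0.mk (k + 1) (1 : G) hx = 0 := by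
          rw [E0.mk, cls_eq_one _ (one_mem _), ofMul_one, map_zero]
        rw [this]; exact zero_mem _
      | mul a b ha hb iha ihb =>
        rw [E0.mk_mul (k := k + 1) (x := a) (y := b) ha hb]
        exact add_mem (iha ha) (ihb hb)
      | inv a ha iha =>
        rw [E0.mk_inv (k := k + 1) (x := a) ha]
        exact neg_mem (iha ha)

/-- The class of a generator of a free group. -/
def gen {X : Type} (x : X) : E0 (FreeGroup X) :=
  E0.mk 0 (FreeGroup.of x) (mem_zero _)

theorem mem_of_gen {X : Type} (S : LieSubalgebra ℤ (E0 (FreeGroup X)))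
    (h : ∀ x, gen x ∈ S) (u : E0 (FreeGroup X)) : u ∈ S := by
  refine mem_of_degree_zero S (fun g => ?_) u
  induction g using FreeGroup.induction_on with
  | C1 =>
    have : E0.mk 0 (1 : FreeGroup X) (mem_zero _) = 0 := by
      rw [E0.mk, cls_eq_one _ (one_mem _), ofMul_one, map_zero]
    rw [this]; exact zero_mem _
  | of x => exact h x
  | inv_of x h => rw [E0.mk_inv (mem_zero _)]; exact neg_mem h
  | mul x y hx hy => rw [E0.mk_mul (mem_zero _) (mem_zero _)]; exact add_mem hx hy

/-- The morphism from the free Lie algebra to the Lie algebra of the free group. -/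
def freeMap (X : Type) : FreeLieAlgebra ℤ X →ₗ⁅ℤ⁆ E0 (FreeGroup X) := FreeLie.lift gen

theorem freeMap_of {X : Type} (x : X) : freeMap X (FreeLieAlgebra.of ℤ x) = gen x :=
  FreeLie.lift_of _ x

theorem freeMap_surjective (X : Type) : Function.Surjective (freeMap X) := by
  intro u
  exact mem_of_gen (freeMap X).range (fun x => ⟨_, freeMap_of x⟩) u

/-- Taking leading coefficients of Magnus expansions after `freeMap` agrees with `FreeLie.toAssoc`
on generators, and the latter is injective. -/
theorem freeMap_injective (X : Type) [Finite X] : Function.Injective (freeMap X) := by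
  have h : (Magnus.lead (Magnus.rep (FreeAlgebra.ι ℤ)) (Magnus.rep_mem _)).comp (freeMap X) =
      FreeLie.toAssoc X := by
    apply FreeLie.hom_ext
    intro x
    rw [LieHom.comp_apply, freeMap_of, gen, Magnus.lead_mk, FreeLie.toAssoc_of, Magnus.rep,
      FreeGroup.lift_apply_of]
    simp [Magnus.oneAdd, PowerSeries.coeff_one]
  intro u v huv
  apply FreeLie.toAssoc_injective X
  rw [← h, LieHom.comp_apply, LieHom.comp_apply, huv]

end LCS

/-! ### Free groups are residually nilpotent -/

namespace Magnus

open PowerSeries LCS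

/-- The operator on the free abelian group on lists which puts `x` in front of a list that does
not begin with `x` and kills the other lists. -/
def push {X : Type} [DecidableEq X] (x : X) : AddMonoid.End (List X →₀ ℤ) :=
  Finsupp.liftAddHom fun l => if l.head? = some x then 0 else Finsupp.singleAddHom (x :: l)

theorem push_single {X : Type} [DecidableEq X] {x : X} {l : List X} (h : l.head? ≠ some x) (c : ℤ) :
    push x (Finsupp.single l c) = Finsupp.single (x :: l) c := by
  refine (Finsupp.liftAddHom_apply_single _ _ _).trans ?_
  rw [if_neg h, Finsupp.singleAddHom_apply]

theorem push_single_of_head {X : Type} [DecidableEq X] {x : X} {l : List X}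
    (h : l.head? = some x) (c : ℤ) : push x (Finsupp.single l c) = 0 := by
  refine (Finsupp.liftAddHom_apply_single _ _ _).trans ?_
  rw [if_pos h]
  rfl

theorem push_mul_push {X : Type} [DecidableEq X] (x : X) : push x * push x = 0 := by
  refine Finsupp.addHom_ext fun l c => ?_
  change push x (push x (Finsupp.single l c)) = 0
  by_cases h : l.head? = some x
  · rw [push_single_of_head h, map_zero]
  · rw [push_single h, push_single_of_head rfl]

/-- As `e` squares to zero, so does `e X`, and the powers of `1 + e X` are linear in the exponent.
-/
theorem exists_rep_eq {R : Type} [Ring R] {e : R} (he : e * e = 0) (g : FreeGroup Unit)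
    (hg : g ≠ 1) :
    ∃ m : ℤ, m ≠ 0 ∧ ((FreeGroup.lift fun _ => oneAdd e) g : R⟦X⟧) = 1 + m • (C e * X) := by
  obtain ⟨m, rfl⟩ : ∃ m : ℤ, g = FreeGroup.of () ^ m :=
    ⟨FreeGroup.freeGroupUnitEquivInt g, (FreeGroup.freeGroupUnitEquivInt.symm_apply_apply g).symm⟩
  refine ⟨m, fun h => hg (by rw [h, zpow_zero]), ?_⟩
  have h0 : (C e * X : R⟦X⟧) * (C e * X) = 0 := by
    rw [mul_assoc, ← mul_assoc X, X_mul, mul_assoc, ← mul_assoc, ← map_mul, he, map_zero, zero_mul]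
  have h1 : ∀ k : ℤ, (1 + k • (C e * X) : R⟦X⟧) * (1 + C e * X) = 1 + (k + 1) • (C e * X) := by
    intro k
    simp only [mul_add, add_mul, one_mul, mul_one, smul_mul_assoc, h0, smul_zero, add_zero,
      add_smul, one_smul]
    abel
  rw [map_zpow, FreeGroup.lift_apply_of]
  clear hg
  induction m using Int.induction_on with
  | zero => simp
  | succ k ih => rw [zpow_add_one, Units.val_mul, ih, ← h1]; rfl
  | pred k ih =>
    rw [← (oneAdd e).mul_left_inj, ← Units.val_mul, ← zpow_add_one, sub_add_cancel, ih]
    refine Eq.trans ?_ (h1 _).symm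
    rw [sub_add_cancel]

theorem zsmul_mul_apply {M : Type*} [AddCommGroup M] (m : ℤ) (a b : AddMonoid.End M) (v : M) :
    (m • (a * b)) v = m • a (b v) := rfl

/-- Such a `g` has trivial expansion. If `g` is not `1`, write it as an alternating product of
nonzero powers of generators; the coefficient at the exponent given by the number of factors is a
nonzero multiple of a product of operators `push`. Neighbouring generators differ, so this product
does not kill the empty list. -/
theorem eq_one_of_forall_mem {X : Type} {g : FreeGroup X} (hg : ∀ k, g ∈ Gam (FreeGroup X) k) :
    g = 1 := by
  classical
  have h1 : rep push g = 1 := by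
    refine Units.ext (PowerSeries.ext fun k => ?_)
    obtain ⟨c, hc⟩ := mem_filt (rep push) (rep_mem push) (hg k)
    rw [hc, Units.val_one, map_add, coeff_X_pow_mul', if_neg (by omega), add_zero]
  -- The free group is viewed as a free product of infinite cyclic groups in order to have reduced
  -- words whose syllables are powers.
  let f := Monoid.CoprodI.lift fun x : X => FreeGroup.lift fun _ : Unit => oneAdd (push x)
  have h2 : rep push = f.comp (freeGroupEquivCoprodI (ι := X)).toMonoidHom := by
    ext x : 1
    simp [f, rep, freeGroupEquivCoprodI]
  let w := Monoid.CoprodI.Word.equiv (freeGroupEquivCoprodI g)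
  have hw : w.prod = freeGroupEquivCoprodI g := Monoid.CoprodI.Word.equiv.symm_apply_apply _
  have h3 : f w.prod = 1 := by
    rw [hw, ← h1, h2]; rfl
  let V : List (Σ _ : X, FreeGroup Unit) → (AddMonoid.End (List X →₀ ℤ))⟦X⟧ := fun L =>
    f (L.map fun l => Monoid.CoprodI.of (i := l.1) l.2).prod
  -- The vanishing above the length is carried along because the coefficient at the next exponent
  -- also receives the coefficient of the shorter word there.
  have key : ∀ L : List (Σ _ : X, FreeGroup Unit), (∀ l ∈ L, l.2 ≠ 1) →
      L.IsChain (fun l l' => l.1 ≠ l'.1) → ∃ m : ℤ, m ≠ 0 ∧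
        coeff L.length (V L) (Finsupp.single [] 1) = Finsupp.single (L.map Sigma.fst) m ∧
        ∀ k, L.length < k → coeff k (V L) = 0 := by
    intro L
    induction L with
    | nil =>
      intro _ _
      refine ⟨1, one_ne_zero, by simp [V], fun k hk => ?_⟩
      simp only [List.length_nil] at hk
      simp [V, coeff_one, hk.ne']
    | cons l L ih =>
      intro h1 h2
      obtain ⟨m, hm, e1, e2⟩ := ih (fun l hl => h1 l (List.mem_cons_of_mem _ hl)) h2.tail
      obtain ⟨m', hm', e3⟩ := exists_rep_eq (push_mul_push l.1) l.2 (h1 l List.mem_cons_self)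
      have e4 : ∀ k, coeff (k + 1) (V (l :: L)) =
          coeff (k + 1) (V L) + m' • (push l.1 * coeff k (V L)) := by
        intro k
        have e5 : V (l :: L) = (1 + m' • (C (push l.1) * PowerSeries.X)) * V L := by
          rw [← e3]
          simp only [V, List.map_cons, List.prod_cons, map_mul, Units.val_mul]
          congr 2
        rw [e5, add_mul, one_mul, map_add, smul_mul_assoc, map_zsmul, mul_assoc, coeff_C_mul,
          coeff_succ_X_mul]
      refine ⟨m' * m, mul_ne_zero hm' hm, ?_, fun k hk => ?_⟩
      · rw [List.length_cons, e4, e2 _ (Nat.lt_succ_self _), zero_add]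
        rw [zsmul_mul_apply, e1, push_single, List.map_cons, Finsupp.smul_single, smul_eq_mul]
        cases L with
        | nil => simp
        | cons l' L =>
          have := (List.isChain_cons_cons.1 h2).1
          simpa using fun h => this h.symm
      · obtain ⟨j, rfl⟩ : ∃ j, k = j + 1 := ⟨k - 1, by simp at hk; omega⟩
        simp only [List.length_cons] at hk
        rw [e4, e2 _ (by omega), e2 _ (by omega), mul_zero, zero_add]
        exact zsmul_zero _
  obtain ⟨m, hm, e1, -⟩ := key w.toList w.ne_one w.chain_ne
  have h4 : V w.toList = f w.prod := rfl
  rw [h4, h3, Units.val_one, coeff_one] at e1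
  by_cases hL : w.toList.length = 0
  · have h5 : w.prod = 1 := by
      rw [Monoid.CoprodI.Word.prod, List.length_eq_zero_iff.1 hL]; rfl
    rw [hw] at h5
    exact (MulEquiv.map_eq_one_iff _).1 h5
  · rw [if_neg hL] at e1
    have h5 := DFunLike.congr_fun e1 (w.toList.map Sigma.fst)
    rw [Finsupp.single_eq_same] at h5
    exact absurd h5.symm hm

end Magnus

end

/-! ### Central series of a semidirect product with trivial action on the abelianization -/

noncomputable section

namespace LCS

/-- The three subgroups lemma, applied in the quotient by `N`. -/
theorem commutator_le_of_rotate {G : Type*} [Group G] {A B C N : Subgroup G} [hN : N.Normal]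
    (h1 : ⁅⁅B, C⁆, A⁆ ≤ N) (h2 : ⁅⁅C, A⁆, B⁆ ≤ N) : ⁅⁅A, B⁆, C⁆ ≤ N := by
  have key : ∀ A : Subgroup G, A ≤ N ↔ A.map (QuotientGroup.mk' N) = ⊥ := by
    intro A
    rw [Subgroup.map_eq_bot_iff, QuotientGroup.ker_mk']
  rw [key] at h1 h2 ⊢
  simp only [Subgroup.map_commutator] at h1 h2 ⊢
  exact Subgroup.commutator_commutator_eq_bot_of_rotate h1 h2

variable {F Q : Type*} [Group F] [Group Q] {φ : Q →* MulAut F}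

open SemidirectProduct

variable (φ) in
/-- A stage of the descending central series of the normal factor of a semidirect product. -/
abbrev inlStage (k : ℕ) : Subgroup (F ⋊[φ] Q) := (Gam F k).map inl

variable (φ) in
/-- A stage of the descending central series of the complement in a semidirect product. -/
abbrev inrStage (k : ℕ) : Subgroup (F ⋊[φ] Q) := (Gam Q k).map inr

instance normal_map_inl (k : ℕ) : (inlStage φ k).Normal := by
  refine ⟨?_⟩
  rintro _ ⟨f, hf, rfl⟩ g
  refine ⟨g.left * φ g.right f * g.left⁻¹,
    conj_mem (map_mem (φ g.right).toMonoidHom hf) _, ?_⟩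
  ext <;> simp [mul_assoc]

theorem commutator_inl_le (k l : ℕ) : ⁅inlStage φ k, inlStage φ l⁆ ≤
    inlStage φ (k + l + 1) := by
  rw [← Subgroup.map_commutator]
  exact Subgroup.map_mono (commutator_le k l)

theorem inl_succ (k : ℕ) : inlStage φ (k + 1) =
    ⁅inlStage φ k, inlStage φ 0⁆ := by
  rw [inlStage, inlStage, inlStage, ← Subgroup.map_commutator]; rfl

theorem inr_succ (k : ℕ) : inrStage φ (k + 1) =
    ⁅inrStage φ k, inrStage φ 0⁆ := by
  rw [inrStage, inrStage, inrStage, ← Subgroup.map_commutator]; rfl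

/-- The hypothesis says that `Q` acts trivially on the abelianization of `F`, which is the case `k =
l = 0`. The three subgroups lemma propagates it first in `l` and then in `k`. -/
theorem commutator_inr_inl_le (hφ : ∀ q f, φ q f * f⁻¹ ∈ Gam F 1) (k l : ℕ) :
    ⁅inrStage φ k, inlStage φ l⁆ ≤ inlStage φ (k + l + 1) := by
  have h0 : ∀ l, ⁅inrStage φ 0, inlStage φ l⁆ ≤
      inlStage φ (l + 1) := by
    have hbase : ⁅inrStage φ 0, inlStage φ 0⁆ ≤
        inlStage φ 1 := by
      rw [Subgroup.commutator_le]
      rintro _ ⟨q, -, rfl⟩ _ ⟨f, -, rfl⟩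
      exact ⟨φ q f * f⁻¹, hφ q f, by ext <;> simp [commutatorElement_def]⟩
    intro l
    induction l with
    | zero => exact hbase
    | succ l ih =>
      rw [inl_succ l, Subgroup.commutator_comm]
      refine commutator_le_of_rotate ?_ ?_
      · rw [Subgroup.commutator_comm (inlStage φ 0)]
        refine (Subgroup.commutator_mono hbase le_rfl).trans ?_
        refine (commutator_inl_le 1 l).trans (le_of_eq ?_)
        congr 1; omega
      · refine (Subgroup.commutator_mono ih le_rfl).trans ?_
        exact commutator_inl_le (l + 1) 0
  induction k generalizing l with
  | zero => rw [zero_add]; exact h0 l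
  | succ k ih =>
    rw [inr_succ k]
    refine commutator_le_of_rotate ?_ ?_
    · refine (Subgroup.commutator_mono (h0 l) le_rfl).trans ?_
      rw [Subgroup.commutator_comm]
      refine (ih (l + 1)).trans (le_of_eq ?_)
      congr 1; omega
    · rw [Subgroup.commutator_comm (inlStage φ l)]
      refine (Subgroup.commutator_mono (ih l) le_rfl).trans ?_
      rw [Subgroup.commutator_comm]
      refine (h0 _).trans (le_of_eq ?_)
      congr 1; omega

/-- The pairs whose components both lie in the stage with index `k`. -/
def pairStage (φ : Q →* MulAut F) (k : ℕ) : Subgroup (F ⋊[φ] Q) where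
  carrier := {h | h.left ∈ Gam F k ∧ h.right ∈ Gam Q k}
  mul_mem' := by
    rintro a b ⟨h1, h2⟩ ⟨h3, h4⟩
    exact ⟨mul_mem h1 (map_mem (φ a.right).toMonoidHom h3), mul_mem h2 h4⟩
  one_mem' := ⟨one_mem _, one_mem _⟩
  inv_mem' := by
    rintro a ⟨h1, h2⟩
    exact ⟨map_mem (φ a.right⁻¹).toMonoidHom (inv_mem h1), inv_mem h2⟩

theorem aut_mul_inv_mem (hφ : ∀ q f, φ q f * f⁻¹ ∈ Gam F 1) {k l : ℕ} {q : Q} {f : F}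
    (hq : q ∈ Gam Q k) (hf : f ∈ Gam F l) : φ q f * f⁻¹ ∈ Gam F (k + l + 1) := by
  have h := commutator_inr_inl_le hφ k l (Subgroup.commutator_mem_commutator
    (Subgroup.mem_map_of_mem inr hq) (Subgroup.mem_map_of_mem inl hf))
  obtain ⟨f', hf', h'⟩ := h
  have h1 := congrArg SemidirectProduct.left h'
  simp [commutatorElement_def] at h1
  rwa [← h1]

theorem pairStage_normal (hφ : ∀ q f, φ q f * f⁻¹ ∈ Gam F 1) (k : ℕ) :
    (pairStage φ k).Normal := by
  refine ⟨?_⟩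
  rintro h ⟨h1, h2⟩ g
  refine ⟨?_, by simpa using conj_mem h2 g.right⟩
  have h3 : φ (g.right * h.right * g.right⁻¹) g.left⁻¹ * g.left ∈ Gam F k := by
    have := aut_mul_inv_mem hφ (conj_mem h2 g.right) (mem_zero g.left⁻¹)
    rw [inv_inv] at this
    exact mem_of_le (by omega) this
  have h4 := mul_mem (conj_mem (map_mem (φ g.right).toMonoidHom h1) g.left)
    (conj_mem h3 g.left)
  simpa [mul_assoc] using h4

/-- The argument of Falk and Randell: pairs with both components in a stage form normal subgroups,
and commutators with arbitrary elements move from one of them to the next. So no stage of `F` gets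
enlarged inside the semidirect product. -/
theorem left_mem_of_mem (hφ : ∀ q f, φ q f * f⁻¹ ∈ Gam F 1) {k : ℕ} {h : F ⋊[φ] Q}
    (hh : h ∈ Gam (F ⋊[φ] Q) k) : h.left ∈ Gam F k := by
  suffices H : ∀ k, Gam (F ⋊[φ] Q) k ≤ pairStage φ k from (H k hh).1
  intro k
  induction k with
  | zero => exact fun h _ => ⟨mem_zero _, mem_zero _⟩
  | succ k ih =>
    have := pairStage_normal hφ (k + 1)
    refine Subgroup.commutator_le.2 fun a ha b _ => ?_
    obtain ⟨h1, h2⟩ := ih ha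
    -- Modulo the normal subgroup, a commutator of products reduces to commutators of the factors
    -- from `F` and from `Q`.
    have key : ∀ x y z : F ⋊[φ] Q, ⁅x, z⁆ ∈ pairStage φ (k + 1) → ⁅y, z⁆ ∈ pairStage φ (k + 1) →
        ⁅x * y, z⁆ ∈ pairStage φ (k + 1) := by
      intro x y z hx hy
      have : ⁅x * y, z⁆ = x * ⁅y, z⁆ * x⁻¹ * ⁅x, z⁆ := by simp [commutatorElement_def, mul_assoc]
      rw [this]
      exact mul_mem (Subgroup.Normal.conj_mem inferInstance _ hy x) hx
    have key' : ∀ x y z : F ⋊[φ] Q, ⁅z, x⁆ ∈ pairStage φ (k + 1) →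
        ⁅z, y⁆ ∈ pairStage φ (k + 1) → ⁅z, x * y⁆ ∈ pairStage φ (k + 1) := by
      intro x y z hx hy
      rw [← inv_mem_iff, commutatorElement_inv] at *
      exact key x y z hx hy
    rw [← inl_left_mul_inr_right a, ← inl_left_mul_inr_right b]
    refine key _ _ _ (key' _ _ _ ?_ ?_) (key' _ _ _ ?_ ?_)
    · rw [← map_commutatorElement]
      exact ⟨commutator_mem_succ h1 b.left, one_mem _⟩
    · have h3 := aut_mul_inv_mem hφ (mem_zero b.right) h1
      rw [zero_add] at h3
      refine ⟨?_, by simp [commutatorElement_def]⟩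
      simpa [commutatorElement_def] using inv_mem h3
    · have h3 := aut_mul_inv_mem hφ h2 (mem_zero b.left)
      refine ⟨?_, by simp [commutatorElement_def]⟩
      simpa [commutatorElement_def] using h3
    · rw [← map_commutatorElement]
      exact ⟨one_mem _, commutator_mem_succ h2 b.right⟩

end LCS

/-! ### Artin's automorphisms and the cocycle of a tracked strand -/

namespace Braid

open SemidirectProduct

/-- The free group on which Artin's automorphisms are defined. -/
abbrev FN : Type := FreeGroup ℕ

/-- Artin's automorphism, on generators. -/
def artFun (i j : ℕ) : FN :=
  if j = i then .of (i + 1) else if j = i + 1 then (.of (i + 1))⁻¹ * .of i * .of (i + 1) else .of j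

/-- The inverse of Artin's automorphism, on generators. -/
def artInvFun (i j : ℕ) : FN :=
  if j = i then .of i * .of (i + 1) * (.of i)⁻¹ else if j = i + 1 then .of i else .of j

/-- Artin's automorphism of the free group. -/
def art (i : ℕ) : MulAut FN :=
  MonoidHom.toMulEquiv (FreeGroup.lift (artFun i)) (FreeGroup.lift (artInvFun i))
    (by
      ext j
      simp only [MonoidHom.comp_apply, FreeGroup.lift_apply_of, MonoidHom.id_apply]
      unfold artFun
      split_ifs with h1 h2 <;> simp [artInvFun, *, mul_assoc])
    (by
      ext j
      simp only [MonoidHom.comp_apply, FreeGroup.lift_apply_of, MonoidHom.id_apply]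
      unfold artInvFun
      split_ifs with h1 h2 <;> simp [artFun, *, mul_assoc])

theorem art_of (i j : ℕ) : art i (.of j) = artFun i j := FreeGroup.lift_apply_of

theorem art_of_self (i : ℕ) : art i (.of i) = .of (i + 1) := by simp [art_of, artFun]

theorem art_of_succ (i : ℕ) :
    art i (.of (i + 1)) = (.of (i + 1))⁻¹ * .of i * .of (i + 1) := by simp [art_of, artFun]

theorem art_of_ne {i j : ℕ} (h1 : j ≠ i) (h2 : j ≠ i + 1) : art i (.of j) = .of j := by
  simp [art_of, artFun, h1, h2]

theorem aut_ext {a b : MulAut FN} (h : ∀ j, a (.of j) = b (.of j)) : a = b := by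
  have : a.toMonoidHom = b.toMonoidHom := FreeGroup.ext_hom _ _ h
  exact MulEquiv.ext fun x => DFunLike.congr_fun this x

theorem art_comm {i j : ℕ} (h : i + 2 ≤ j) : art i * art j = art j * art i := by
  refine aut_ext fun k => ?_
  simp only [MulAut.mul_apply]
  rcases (by omega : k = i ∨ k = i + 1 ∨ k = j ∨ k = j + 1 ∨
    (k ≠ i ∧ k ≠ i + 1 ∧ k ≠ j ∧ k ≠ j + 1)) with rfl | rfl | rfl | rfl | ⟨h1, h2, h3, h4⟩
  · rw [art_of_self, art_of_ne (i := j) (by omega) (by omega),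
      art_of_ne (i := j) (by omega) (by omega), art_of_self]
  · simp only [art_of_succ, map_mul, map_inv, art_of_ne (i := j) (j := i + 1) (by omega) (by omega),
      art_of_ne (i := j) (j := i) (by omega) (by omega)]
  · rw [art_of_self, art_of_ne (i := i) (by omega) (by omega),
      art_of_ne (i := i) (by omega) (by omega), art_of_self]
  · simp only [art_of_succ, map_mul, map_inv, art_of_ne (i := i) (j := j + 1) (by omega) (by omega),
      art_of_ne (i := i) (j := j) (by omega) (by omega)]
  · simp only [art_of_ne h1 h2, art_of_ne h3 h4]

theorem art_braid (i : ℕ) :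
    art i * art (i + 1) * art i = art (i + 1) * art i * art (i + 1) := by
  refine aut_ext fun k => ?_
  simp only [MulAut.mul_apply]
  have e1 := art_of_ne (i := i) (j := i + 1 + 1) (by omega) (by omega)
  have e2 := art_of_ne (i := i + 1) (j := i) (by omega) (by omega)
  rcases (by omega : k = i ∨ k = i + 1 ∨ k = i + 1 + 1 ∨
    (k ≠ i ∧ k ≠ i + 1 ∧ k ≠ i + 1 + 1)) with rfl | rfl | rfl | ⟨h1, h2, h3⟩
  · simp only [art_of_self, e1, e2]
  · simp only [art_of_self, art_of_succ, e1, e2, map_mul, map_inv]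
  · simp only [art_of_self, art_of_succ, e1, e2, map_mul, map_inv]
    group
  · simp only [art_of_ne h1 h2, art_of_ne h2 h3]

/-- The free group with all its automorphisms adjoined. -/
abbrev Hol : Type := FN ⋊[MonoidHom.id (MulAut FN)] MulAut FN

theorem inr_mul_inl (a : MulAut FN) (x : FN) : (inr a * inl x : Hol) = inl (a x) * inr a := by
  ext <;> simp

/-- The effect of the generator with index `i` on the strand in the position `k` and on the free
group on the other strands. -/
def push (i k : ℕ) : Hol :=
  if k < i then inr (art (i - 1)) else if k = i then 1 else if k = i + 1 then inl (.of i)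
  else inr (art i)

theorem push_lt {i k : ℕ} (h : k < i + 1) : push (i + 1) k = inr (art i) := by simp [push, h]

theorem push_self (i : ℕ) : push i i = 1 := by simp [push]

theorem push_succ (i : ℕ) : push i (i + 1) = inl (.of i) := by simp [push]

theorem push_gt {i k : ℕ} (h : i + 1 < k) : push i k = inr (art i) := by
  simp [push, show ¬ k < i by omega, show k ≠ i by omega, show k ≠ i + 1 by omega]

/-- The transposition of `i` and `i + 1`, on natural numbers. -/
def sw (i k : ℕ) : ℕ := if k = i then i + 1 else if k = i + 1 then i else k

theorem sw_self (i : ℕ) : sw i i = i + 1 := by simp [sw]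
theorem sw_succ (i : ℕ) : sw i (i + 1) = i := by simp [sw]
theorem sw_ne {i k : ℕ} (h1 : k ≠ i) (h2 : k ≠ i + 1) : sw i k = k := by simp [sw, h1, h2]

/-- Far commutativity for the cocycle behind `track`. The free generators number the strands other
than the tracked one, so a crossing to the right of that strand has its index lowered by one. -/
theorem push_comm {i j : ℕ} (h : i + 2 ≤ j) (k : ℕ) :
    push i (sw j k) * push j k = push j (sw i k) * push i k := by
  obtain ⟨j, rfl⟩ : ∃ j', j = j' + 1 := ⟨j - 1, by omega⟩
  rcases (by omega : k < i ∨ k = i ∨ k = i + 1 ∨ (i + 1 < k ∧ k < j + 1) ∨ k = j + 1 ∨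
      k = j + 1 + 1 ∨ j + 1 + 1 < k) with hk | rfl | rfl | ⟨hk, hk'⟩ | rfl | rfl | hk
  · obtain ⟨i, rfl⟩ : ∃ i', i = i' + 1 := ⟨i - 1, by omega⟩
    rw [sw_ne (by omega) (by omega), sw_ne (by omega) (by omega), push_lt hk, push_lt (by omega),
      ← map_mul, art_comm (by omega), map_mul]
  · rw [sw_ne (by omega) (by omega), sw_self, push_self, push_lt (by omega), push_lt (by omega),
      one_mul, mul_one]
  · rw [sw_ne (by omega) (by omega), sw_succ, push_succ, push_lt (by omega), push_lt (by omega),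
      inr_mul_inl, art_of_ne (by omega) (by omega)]
  · rw [sw_ne (by omega) (by omega), sw_ne (by omega) (by omega), push_gt hk, push_lt (by omega),
      ← map_mul, art_comm (by omega), map_mul]
  · rw [sw_self, sw_ne (by omega) (by omega), push_self, push_gt (by omega), push_gt (by omega),
      one_mul, mul_one]
  · rw [sw_succ, sw_ne (by omega) (by omega), push_succ, push_gt (by omega), push_gt (by omega),
      inr_mul_inl, art_of_ne (by omega) (by omega)]
  · rw [sw_ne (by omega) (by omega), sw_ne (by omega) (by omega), push_gt (by omega),
      push_gt (by omega), ← map_mul, art_comm (by omega), map_mul]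

/-- The braid relation for the same cocycle. Away from the tracked strand it is Artin's relation;
otherwise at most the values of `art` on two neighbouring generators are needed. -/
theorem push_braid (i k : ℕ) :
    push i (sw (i + 1) (sw i k)) * (push (i + 1) (sw i k) * push i k) =
      push (i + 1) (sw i (sw (i + 1) k)) * (push i (sw (i + 1) k) * push (i + 1) k) := by
  rcases (by omega : k < i ∨ k = i ∨ k = i + 1 ∨ k = i + 1 + 1 ∨ i + 1 + 1 < k) with
    hk | rfl | rfl | rfl | hk
  · obtain ⟨i, rfl⟩ : ∃ i', i = i' + 1 := ⟨i - 1, by omega⟩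
    rw [sw_ne (i := i + 1) (by omega) (by omega), sw_ne (i := i + 1 + 1) (by omega) (by omega),
      sw_ne (i := i + 1) (by omega) (by omega), push_lt (by omega), push_lt (by omega),
      ← map_mul, ← map_mul, ← map_mul, ← map_mul, ← mul_assoc, art_braid, mul_assoc]
  · rw [sw_self, sw_self, sw_ne (i := k + 1) (by omega) (by omega), sw_self, push_self,
      push_self, push_lt (by omega), push_gt (by omega)]
    simp
  · rw [sw_succ, sw_self, sw_ne (i := i + 1) (by omega) (by omega),
      sw_ne (i := i) (by omega) (by omega), push_self, push_self, push_succ, push_succ,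
      push_lt (by omega), push_gt (by omega), inr_mul_inl, art_of_self]
    simp
  · rw [sw_ne (i := i) (by omega) (by omega), sw_succ, sw_succ, push_succ, push_succ,
      push_lt (by omega), push_gt (by omega), ← map_mul, inr_mul_inl, ← mul_assoc, ← map_mul,
      map_mul (art i), art_of_self, art_of_succ]
    simp [mul_assoc]
  · rw [sw_ne (i := i) (by omega) (by omega), sw_ne (i := i + 1) (by omega) (by omega),
      sw_ne (i := i) (by omega) (by omega), push_gt (by omega), push_gt (by omega),
      ← map_mul, ← map_mul, ← map_mul, ← map_mul, ← mul_assoc, art_braid, mul_assoc]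

end Braid

end

/-! ### Following the last strand of a pure braid -/

noncomputable section

namespace Braid

open SemidirectProduct LCS

theorem adj_val_eq_sw {n : ℕ} (i : Fin (n - 1)) (k : Fin n) : (adj i k : ℕ) = sw i k := adj_val i k

/-- The permutation `(k, h) ↦ (k', push i k * h)`, where `k'` is the position in which the strand of
the generator ends that starts in `k`. -/
def trackGen {n : ℕ} (i : Fin (n - 1)) : Equiv.Perm (Fin n × Hol) where
  toFun x := (adj i x.1, push i x.1 * x.2)
  invFun x := (adj i x.1, (push i (adj i x.1))⁻¹ * x.2)
  left_inv x := by simp [adj]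
  right_inv x := by simp [adj]

/-- The action of the braid group on pairs of a position and an element of `Hol`. -/
def track (n : ℕ) : BraidGroup n →* Equiv.Perm (Fin n × Hol) :=
  lift trackGen
    (fun i j h => by
      ext1 x
      refine Prod.ext (DFunLike.congr_fun (adj_comm i j h) x.1) ?_
      change push i (adj j x.1) * (push j x.1 * x.2) = push j (adj i x.1) * (push i x.1 * x.2)
      rw [← mul_assoc, ← mul_assoc, adj_val_eq_sw, adj_val_eq_sw, push_comm h])
    (fun i j h => by
      ext1 x
      refine Prod.ext (DFunLike.congr_fun (adj_braid i j h) x.1) ?_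
      change push i (adj j (adj i x.1)) * (push j (adj i x.1) * (push i x.1 * x.2)) =
        push j (adj i (adj j x.1)) * (push i (adj j x.1) * (push j x.1 * x.2))
      simp only [adj_val_eq_sw, h]
      have := congrArg (· * x.2) (push_braid i x.1)
      simpa only [mul_assoc] using this)

theorem braid_induction {n : ℕ} {p : BraidGroup n → Prop} (h1 : p 1)
    (hs : ∀ i, i < n - 1 → p (sig n i)) (hm : ∀ a b, p a → p b → p (a * b))
    (hi : ∀ a, p a → p a⁻¹) (b : BraidGroup n) : p b := by
  have hb : b ∈ Subgroup.closure (Set.range (PresentedGroup.of (rels := rels n))) := by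
    rw [PresentedGroup.closure_range_of]; trivial
  induction hb using Subgroup.closure_induction with
  | mem b hb =>
    obtain ⟨i, rfl⟩ := hb
    have := hs i i.2
    rwa [sig, dif_pos i.2] at this
  | one => exact h1
  | mul a b _ _ ha hb => exact hm a b ha hb
  | inv a _ ha => exact hi a ha

theorem track_apply {n : ℕ} (b : BraidGroup n) (k : Fin n) (h : Hol) :
    track n b (k, h) = (toPerm n b k, (track n b (k, 1)).2 * h) := by
  induction b using braid_induction generalizing k h with
  | h1 => simp
  | hs i hi =>
    rw [sig, dif_pos hi, toPerm, track, lift_of, lift_of]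
    simp [trackGen]
  | hm a b ha hb =>
    simp only [map_mul, Equiv.Perm.mul_apply]
    rw [hb, ha, hb k 1, ha _ ((track n b (k, 1)).2 * 1)]
    simp [mul_assoc]
  | hi a ha =>
    simp only [map_inv]
    rw [Equiv.Perm.inv_eq_iff_eq, ha]
    have h1 : (track n a) ((track n a)⁻¹ (k, 1)) = (k, 1) := by simp
    generalize (track n a)⁻¹ (k, 1) = x at h1 ⊢
    obtain ⟨k', h'⟩ := x
    rw [ha] at h1
    have h2 := congrArg Prod.fst h1
    have h3 := congrArg Prod.snd h1
    simp only at h2 h3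
    rw [← h2]
    simp [← mul_assoc, h3]

/-- The effect of a braid on the strand that starts in the position `k` and on the free group on the
other strands. -/
def trk {n : ℕ} (b : BraidGroup n) (k : Fin n) : Hol := (track n b (k, 1)).2

theorem trk_mul {n : ℕ} (a b : BraidGroup n) (k : Fin n) :
    trk (a * b) k = trk a (toPerm n b k) * trk b k := by
  rw [trk, map_mul, Equiv.Perm.mul_apply, track_apply b, track_apply a]
  simp [trk]

theorem trk_one {n : ℕ} (k : Fin n) : trk (1 : BraidGroup n) k = 1 := by simp [trk]

theorem trk_sig {n i : ℕ} (h : i < n - 1) (k : Fin n) : trk (sig n i) k = push i k := by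
  rw [sig, dif_pos h, trk, track, lift_of]
  simp [trackGen]

theorem trk_inv {n : ℕ} (b : BraidGroup n) (k : Fin n) :
    trk b⁻¹ (toPerm n b k) = (trk b k)⁻¹ := by
  rw [eq_inv_iff_mul_eq_one, ← trk_mul, inv_mul_cancel, trk_one]

/-- The permutation of all natural numbers induced by a braid. -/
def permNat (n : ℕ) : BraidGroup n →* Equiv.Perm ℕ :=
  (Equiv.Perm.extendDomainHom Fin.equivSubtype).comp (toPerm n)

theorem permNat_val {n : ℕ} (b : BraidGroup n) (k : Fin n) : permNat n b k = toPerm n b k :=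
  Equiv.Perm.extendDomain_apply_image _ Fin.equivSubtype k

theorem permNat_sig {n i : ℕ} (h : i < n - 1) (k : ℕ) : permNat n (sig n i) k = sw i k := by
  by_cases hk : k < n
  · have := permNat_val (sig n i) ⟨k, hk⟩
    rw [this, toPerm_sig_val h]; rfl
  · rw [sw_ne (by omega) (by omega)]
    exact Equiv.Perm.extendDomain_apply_not_subtype _ _ hk

/-- The position of the strand with index `j` among the strands other than `k`. -/
def skip (k j : ℕ) : ℕ := if j < k then j else j + 1

theorem skip_ne (k j : ℕ) : skip k j ≠ k := by unfold skip; split_ifs <;> omega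

theorem exists_skip {k p : ℕ} (h : p ≠ k) : ∃ j, skip k j = p := by
  rcases lt_or_gt_of_ne h with h | h
  · exact ⟨p, by simp [skip, h]⟩
  · exact ⟨p - 1, by rw [skip, if_neg (by omega)]; omega⟩

theorem skip_injective (k : ℕ) : Function.Injective (skip k) := by
  intro i j h
  unfold skip at h
  split_ifs at h <;> omega

theorem inv_mul_mem_of_conj {x g : FN} : (g⁻¹ * x * g) * x⁻¹ ∈ Gam FN 1 := by
  have := commutator_mem_succ (mem_zero g⁻¹) x
  simpa [commutatorElement_def, mul_assoc] using this

theorem push_right_mem {i k j j' : ℕ} (h : skip (sw i k) j' = sw i (skip k j)) :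
    (push i k).right (.of j) * (.of j')⁻¹ ∈ Gam FN 1 := by
  have h0 : ∀ i j : ℕ, art i (.of j) * (.of (sw i j))⁻¹ ∈ Gam FN 1 := by
    intro i j
    rcases (by omega : j = i ∨ j = i + 1 ∨ (j ≠ i ∧ j ≠ i + 1)) with rfl | rfl | ⟨h1, h2⟩
    · rw [art_of_self, sw_self, mul_inv_cancel]; exact one_mem _
    · rw [art_of_succ, sw_succ]; exact inv_mul_mem_of_conj
    · rw [art_of_ne h1 h2, sw_ne h1 h2, mul_inv_cancel]; exact one_mem _
  rcases (by omega : k < i ∨ k = i ∨ k = i + 1 ∨ i + 1 < k) with hk | rfl | rfl | hk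
  · obtain ⟨i, rfl⟩ : ∃ i', i = i' + 1 := ⟨i - 1, by omega⟩
    rw [push_lt hk]
    have : j' = sw i j := by
      unfold sw skip at *
      grind
    rw [this]; exact h0 i j
  · have : j' = j := by
      unfold sw skip at *
      grind
    rw [push_self, this]
    simp
  · have : j' = j := by
      unfold sw skip at *
      grind
    rw [push_succ, this]
    simp
  · have : j' = sw i j := by
      unfold sw skip at *
      grind
    rw [push_gt hk, this]; exact h0 i j

/-- Modulo commutators Artin's automorphisms only permute the generators, in the way in which the
braid permutes the untracked strands. For a pure braid this gives trivial action on the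
abelianization. -/
theorem trk_right_mem {n : ℕ} (b : BraidGroup n) (k : Fin n) {j j' : ℕ}
    (h : skip (toPerm n b k) j' = permNat n b (skip k j)) :
    (trk b k).right (.of j) * (.of j')⁻¹ ∈ Gam FN 1 := by
  induction b using braid_induction generalizing k j j' with
  | h1 =>
    simp only [map_one, Equiv.Perm.one_apply] at h
    rw [skip_injective k h, trk_one]
    simp
  | hs i hi =>
    rw [trk_sig hi]
    refine push_right_mem ?_
    rw [← permNat_sig hi, ← permNat_sig hi, permNat_val, h]
  | hm a b ha hb =>
    obtain ⟨l, hl⟩ : ∃ l, skip (toPerm n b k) l = permNat n b (skip k j) := by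
      refine exists_skip ?_
      rw [← permNat_val]
      exact fun h => skip_ne k j ((permNat n b).injective h)
    have h1 := hb k hl
    have h2 := ha (toPerm n b k) (j := l) (j' := j') (by rw [hl]; simpa using h)
    rw [trk_mul, mul_right, MulAut.mul_apply]
    have h3 := map_mem (trk a (toPerm n b k)).right.toMonoidHom h1
    have h4 := mul_mem h3 h2
    simpa using h4
  | hi a ha =>
    obtain ⟨k, rfl⟩ := (toPerm n a).surjective k
    have h1 := ha k (j := j') (j' := j) (by
      rw [map_inv, map_inv] at h
      rw [Equiv.Perm.eq_inv_iff_eq] at h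
      rw [← h]; simp)
    rw [trk_inv, inv_right]
    have h2 := map_mem ((trk a k).right⁻¹).toMonoidHom (inv_mem h1)
    simpa using h2

/-- The effect of a pure braid on its last strand and on the free group on the other strands. -/
def lastTrk (n : ℕ) : PureBraidGroup (n + 1) →* Hol :=
  MonoidHom.mk' (fun b => trk b.1 (Fin.last n)) fun a b => by
    rw [Subgroup.coe_mul, trk_mul, show toPerm (n + 1) b.1 = 1 from b.2]
    rfl

theorem lastTrk_right_mem {n : ℕ} (b : PureBraidGroup (n + 1)) (f : FN) :
    (lastTrk n b).right f * f⁻¹ ∈ Gam FN 1 := by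
  have hb : toPerm (n + 1) b.1 = 1 := b.2
  have h : (QuotientGroup.mk' (Gam FN 1)).comp ((lastTrk n b).right).toMonoidHom =
      QuotientGroup.mk' (Gam FN 1) := by
    refine FreeGroup.ext_hom _ _ fun j => ?_
    refine ((QuotientGroup.eq (s := Gam FN 1)).2 ?_).symm
    have h1 := trk_right_mem b.1 (Fin.last n) (j := j) (j' := j) (by rw [permNat]; simp [hb])
    have h2 := conj_mem h1 (FreeGroup.of j)⁻¹
    simpa [lastTrk, mul_assoc] using h2
  have h1 : (QuotientGroup.mk ((lastTrk n b).right f) : FN ⧸ Gam FN 1) = QuotientGroup.mk f :=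
    DFunLike.congr_fun h f
  have h2 := conj_mem (QuotientGroup.eq.1 h1.symm) f
  simpa [mul_assoc] using h2

/-- The pure braid group acts on the free group through `lastTrk`, and pairing the left component
with the braid itself is a homomorphism into the resulting semidirect product. Thus
`left_mem_of_mem` applies without any splitting of the pure braid group. -/
theorem lastTrk_left_mem {n k : ℕ} {b : PureBraidGroup (n + 1)}
    (hb : b ∈ Gam (PureBraidGroup (n + 1)) k) : (lastTrk n b).left ∈ Gam FN k := by
  let φ : PureBraidGroup (n + 1) →* MulAut FN := rightHom.comp (lastTrk n)
  let s : PureBraidGroup (n + 1) →* FN ⋊[φ] PureBraidGroup (n + 1) :=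
    MonoidHom.mk' (fun b => ⟨(lastTrk n b).left, b⟩) fun a b => by
      ext1
      · rw [map_mul, mul_left]; rfl
      · rfl
  exact left_mem_of_mem (φ := φ) (fun q f => lastTrk_right_mem q f) (map_mem s hb)

theorem alpha_succ {n r s : ℕ} (h : r < s) : alpha n r (s + 1) = sig n s * alpha n r s := by
  obtain ⟨d, rfl⟩ : ∃ d, s = r + 1 + d := ⟨s - (r + 1), by omega⟩
  rw [alpha, alpha, show r + 1 + d + 1 - 1 - r = d + 1 by omega,
    show r + 1 + d - 1 - r = d by omega, List.range'_concat]
  simp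

theorem alpha_self (n r : ℕ) : alpha n r (r + 1) = 1 := by simp [alpha]

theorem A_val (n r s : ℕ) :
    (A n r s : BraidGroup n) = alpha n r s * sig n r ^ 2 * (alpha n r s)⁻¹ :=
  rfl

theorem A_val_self (n r : ℕ) : (A n r (r + 1) : BraidGroup n) = sig n r ^ 2 := by
  simp [A_val, alpha_self]

theorem A_val_succ {n r s : ℕ} (h : r < s) :
    (A n r (s + 1) : BraidGroup n) = sig n s * A n r s * (sig n s)⁻¹ := by
  simp [A_val, alpha_succ h, mul_assoc]

/-- At each crossing the strand is in the position in which `push` is trivial, so it collects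
nothing on its way. -/
theorem trk_alpha {n r : ℕ} {s : ℕ} (hr : r < s) (h : s < n) :
    (toPerm n (alpha n r s) ⟨r + 1, by omega⟩ : ℕ) = s ∧
      trk (alpha n r s) ⟨r + 1, by omega⟩ = 1 := by
  obtain ⟨d, rfl⟩ : ∃ d, s = r + 1 + d := ⟨s - (r + 1), by omega⟩
  induction d with
  | zero => simp [alpha_self, trk_one]
  | succ d ih =>
    obtain ⟨h1, h2⟩ := ih (by omega) (by omega)
    simp only [← add_assoc]
    rw [alpha_succ (by omega), trk_mul, h2, trk_sig (by omega), h1, push_self, map_mul,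
      Equiv.Perm.mul_apply, toPerm_sig_val (by omega), if_pos h1, mul_one]
    exact ⟨rfl, rfl⟩

/-- Undoing `alpha` brings the last strand next to the strand `i` at no cost; the two crossings of
the square then contribute the generator and `1`. -/
theorem lastTrk_A {n : ℕ} (i : Fin n) : lastTrk n (A (n + 1) i n) = inl (.of i) := by
  have hi := i.2
  obtain ⟨h1, h2⟩ := trk_alpha (n := n + 1) hi (Nat.lt_succ_self n)
  have h3 : Fin.last n = toPerm (n + 1) (alpha (n + 1) i n) ⟨i + 1, by omega⟩ := by
    ext; rw [h1]; rfl
  change trk (A (n + 1) i n : BraidGroup (n + 1)) (Fin.last n) = _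
  -- The braid is cut into its three factors, and the position of the strand is needed at each
  -- junction.
  have e4 : toPerm (n + 1) (alpha (n + 1) i n)⁻¹ (toPerm (n + 1) (alpha (n + 1) i n)
      ⟨(i : ℕ) + 1, by omega⟩) = ⟨i + 1, by omega⟩ := by simp
  have e5 : toPerm (n + 1) (sig (n + 1) i ^ 2) = 1 := toPerm_sig_sq _ _
  have e6 : (toPerm (n + 1) (sig (n + 1) i) ⟨(i : ℕ) + 1, by omega⟩ : ℕ) = i := by
    rw [toPerm_sig_val (by omega)]; simp
  rw [A_val, h3, trk_mul, trk_inv, e4, trk_mul, e5, Equiv.Perm.one_apply, h2, pow_two, trk_mul,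
    trk_sig (by omega), trk_sig (by omega), e6, push_self]
  simp [push_succ]

/-- The homomorphism from the free group to the pure braid group whose values on the generators are
the braids in which the last strand links once around another strand. -/
def fib (n : ℕ) : FreeGroup (Fin n) →* PureBraidGroup (n + 1) :=
  FreeGroup.lift fun i => A (n + 1) i n

theorem left_lastTrk_fib {n : ℕ} (f : FreeGroup (Fin n)) :
    lastTrk n (fib n f) = inl (FreeGroup.map (fun i : Fin n => (i : ℕ)) f) := by
  have h : (lastTrk n).comp (fib n) = inl.comp (FreeGroup.map (fun i : Fin n => (i : ℕ))) := by
    refine FreeGroup.ext_hom _ _ fun i => ?_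
    simp [fib, lastTrk_A]
  exact DFunLike.congr_fun h f

/-- The left component of `lastTrk` returns the word itself and respects stages, so `fib` is strict
for the central series. -/
theorem mem_of_fib_mem {n k : ℕ} {f : FreeGroup (Fin n)}
    (h : fib n f ∈ Gam (PureBraidGroup (n + 1)) k) : f ∈ Gam (FreeGroup (Fin n)) k := by
  have h1 := lastTrk_left_mem h
  rw [left_lastTrk_fib, left_inl] at h1
  let g : FN →* FreeGroup (Fin n) :=
    FreeGroup.lift fun j => if hj : j < n then .of ⟨j, hj⟩ else 1
  have h2 : g.comp (FreeGroup.map (fun i : Fin n => (i : ℕ))) = MonoidHom.id _ := by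
    refine FreeGroup.ext_hom _ _ fun i => ?_
    simp [g]
  have h3 := map_mem g h1
  rwa [← MonoidHom.comp_apply, h2] at h3

end Braid

end

/-! ### Linking classes and the infinitesimal braid relations -/

noncomputable section

namespace LCS

variable {G H K : Type*} [Group G] [Group H] [Group K]

theorem E0.map_mk (f : G →* H) {k : ℕ} {x : G} (hx : x ∈ Gam G k) :
    E0.map f (E0.mk k x hx) = E0.mk k (f x) (map_mem f hx) := E0.addMap_mk f hx

theorem E0.map_map (f : G →* H) (g : H →* K) (u : E0 G) :
    E0.map g (E0.map f u) = E0.map (g.comp f) u := by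
  induction u using E0.induction with
  | h0 => simp
  | ha u v hu hv => simp only [map_add, hu, hv]
  | hm k x hx => simp only [E0.map_mk]; rfl

theorem E0.map_id (u : E0 G) : E0.map (MonoidHom.id G) u = u := by
  induction u using E0.induction with
  | h0 => simp
  | ha u v hu hv => simp only [map_add, hu, hv]
  | hm k x hx => simp only [E0.map_mk]; rfl

/-- The class of an element in degree zero. -/
def cl (g : G) : E0 G := E0.mk 0 g (mem_zero g)

theorem cl_mul (g h : G) : cl (g * h) = cl g + cl h := E0.mk_mul (mem_zero g) (mem_zero h)

theorem cl_one : cl (1 : G) = 0 := by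
  rw [cl, E0.mk, cls_eq_one _ (one_mem _), ofMul_one, map_zero]

theorem cl_inv (g : G) : cl g⁻¹ = - cl g := E0.mk_inv (mem_zero g)

theorem cl_conj (g h : G) : cl (g * h * g⁻¹) = cl h := E0.mk_conj (mem_zero h) g

theorem map_cl (f : G →* H) (g : G) : E0.map f (cl g) = cl (f g) := E0.map_mk f (mem_zero g)

theorem cl_lie_eq_zero {g h : G} (hc : Commute g h) : ⁅cl g, cl h⁆ = 0 := by
  rw [cl, cl, E0.mk_lie_mk, E0.mk, cls_eq_one, ofMul_one, map_zero]
  rw [commutatorElement_eq_one_iff_commute.2 hc]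
  exact one_mem _

end LCS

namespace Braid

open LCS

section Words

variable {n : ℕ}

theorem commute_sig {i j : ℕ} (h : i + 2 ≤ j ∨ j + 2 ≤ i ∨ i = j) :
    Commute (sig n i) (sig n j) := by
  rcases h with h | h | rfl
  · exact sig_comm n h
  · exact (sig_comm n h).symm
  · exact Commute.refl _

theorem commute_sig_A_outer {i j k : ℕ} (hij : i < j) (hk : k + 1 < i ∨ j < k) :
    Commute (sig n k) (A n i j : BraidGroup n) := by
  induction j, hij using Nat.le_induction with
  | base => rw [A_val_self]; exact (commute_sig (by omega)).pow_right 2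
  | succ j hj ih =>
    rw [A_val_succ hj]
    have h1 : Commute (sig n k) (sig n j) := commute_sig (by omega)
    exact (h1.mul_right (ih (by omega))).mul_right h1.inv_right

/-- In the first case both braids are conjugates by `c = sig (k + 1) * sig k`: of `sig (k + 1)`, by
the braid relation, and of `A i k`. These two commute since `k + 1` lies outside the range from `i`
to `k`. -/
theorem commute_sig_A_inner {i j k : ℕ} (hik : i < k) (hkj : k + 1 < j) (hj : j < n) :
    Commute (sig n k) (A n i j : BraidGroup n) := by
  induction j, hkj using Nat.le_induction with
  | base =>
    rw [A_val_succ (by omega), A_val_succ (by omega)]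
    have h1 : Commute (sig n (k + 1)) (A n i k : BraidGroup n) :=
      commute_sig_A_outer hik (by omega)
    have h2 := sig_braid (n := n) (i := k) (by omega)
    generalize (A n i k : BraidGroup n) = x at h1
    generalize sig n k = s at h1 h2 ⊢
    generalize sig n (k + 1) = t at h1 h2 ⊢
    have h4 : t⁻¹ * x = x * t⁻¹ := h1.inv_left
    have h3 : t * (s * x * s⁻¹) * t⁻¹ = (t * s) * x * (t * s)⁻¹ := by group
    rw [h3]
    have h5 : s * (t * s) = (t * s) * t := by rw [← mul_assoc, h2]
    have h6 : s = (t * s) * t * (t * s)⁻¹ := by rw [← h5]; group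
    generalize t * s = c at h6 ⊢
    rw [h6]
    have : Commute (c * t * c⁻¹) (c * x * c⁻¹) := by
      rw [← MulAut.conj_apply, ← MulAut.conj_apply]
      exact h1.map (MulAut.conj c)
    exact this
  | succ j hj ih =>
    rw [A_val_succ (by omega)]
    have h1 : Commute (sig n k) (sig n j) := commute_sig (by omega)
    exact (h1.mul_right (ih (by omega))).mul_right h1.inv_right

theorem sig_conj_A {i j : ℕ} (hij : i + 1 < j) (hj : j < n) :
    sig n i * A n i j * (sig n i)⁻¹ = (A n (i + 1) j : BraidGroup n) := by
  induction j, hij using Nat.le_induction with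
  | base =>
    rw [A_val_succ (by omega), A_val_self, A_val_self]
    have h2 := sig_braid (n := n) (i := i) (by omega)
    generalize sig n i = s at h2 ⊢
    generalize sig n (i + 1) = t at h2 ⊢
    have h5 : s * t * s = t * (s * t) := by rw [h2, mul_assoc]
    have h6 : s = (s * t)⁻¹ * t * (s * t) := by rw [mul_assoc, ← h5]; group
    have h3 : s * (t * s ^ 2 * t⁻¹) * s⁻¹ = ((s * t) * s * (s * t)⁻¹) ^ 2 := by
      rw [conj_pow]; group
    rw [h3]
    congr 1
    rw [h5]; group
  | succ j hj ih =>
    rw [A_val_succ (by omega), A_val_succ (by omega), ← ih (by omega)]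
    have h1 : sig n i * sig n j = sig n j * sig n i := sig_comm n (by omega)
    have h2 : (sig n j)⁻¹ * (sig n i)⁻¹ = (sig n i)⁻¹ * (sig n j)⁻¹ := by
      rw [← mul_inv_rev, ← mul_inv_rev, h1]
    calc _ = (sig n i * sig n j) * A n i j * ((sig n j)⁻¹ * (sig n i)⁻¹) := by group
      _ = _ := by rw [h1, h2]; group

end Words

/-- Conjugation by a braid, on the pure braid group. -/
def conjHom {n : ℕ} (b : BraidGroup n) : PureBraidGroup n →* PureBraidGroup n :=
  (MulAut.conjNormal b).toMonoidHom

theorem conjHom_val {n : ℕ} (b : BraidGroup n) (p : PureBraidGroup n) :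
    (conjHom b p : BraidGroup n) = b * p * b⁻¹ := MulAut.conjNormal_apply b p

/-- The action of the braid group on the Lie algebra of the pure braid group. -/
def cj {n : ℕ} (b : BraidGroup n) : E0 (PureBraidGroup n) →ₗ⁅ℤ⁆ E0 (PureBraidGroup n) :=
  E0.map (conjHom b)

theorem cj_mul {n : ℕ} (a b : BraidGroup n) (u : E0 (PureBraidGroup n)) :
    cj (a * b) u = cj a (cj b u) := by
  rw [cj, cj, cj, E0.map_map]
  congr 2
  ext p
  simp [conjHom_val, mul_assoc]

theorem cj_one {n : ℕ} (u : E0 (PureBraidGroup n)) : cj (1 : BraidGroup n) u = u := by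
  have : conjHom (1 : BraidGroup n) = MonoidHom.id _ := by
    ext p
    simp [conjHom_val]
  rw [cj, this, E0.map_id]

theorem cj_cl {n : ℕ} (b : BraidGroup n) (p : PureBraidGroup n) :
    cj b (cl p) = cl (conjHom b p) := map_cl _ p

theorem cl_eq_of_conj {n : ℕ} {g : BraidGroup n} (hg : toPerm n g = 1) {p q : PureBraidGroup n}
    (h : (p : BraidGroup n) = g * q * g⁻¹) : cl p = cl q := by
  have : p = (⟨g, hg⟩ : PureBraidGroup n) * q * (⟨g, hg⟩ : PureBraidGroup n)⁻¹ := Subtype.ext h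
  rw [this, cl_conj]

/-- The class of the pure braid in which the strands `i` and `j` link once, as a function of
unordered pairs. -/
def lk (n i j : ℕ) : E0 (PureBraidGroup n) :=
  if i < j then cl (A n i j) else if j < i then cl (A n j i) else 0

theorem lk_of_lt {n i j : ℕ} (h : i < j) : lk n i j = cl (A n i j) := if_pos h

theorem lk_symm (n i j : ℕ) : lk n i j = lk n j i := by
  unfold lk
  split_ifs <;> first | rfl | omega

theorem lk_self (n i : ℕ) : lk n i i = 0 := by simp [lk]

/-- Conjugation by a generator gives the expected braid, possibly up to conjugation by the square of
that generator. The square is pure, so it does not affect classes. -/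
theorem cj_sig_lk_of_lt {n i j k : ℕ} (hij : i < j) (hj : j < n) :
    cj (sig n k) (lk n i j) = lk n (sw k i) (sw k j) := by
  have hsq : toPerm n (sig n k * sig n k) = 1 := by rw [← pow_two]; exact toPerm_sig_sq n k
  have hc : Commute (sig n k) (A n i j : BraidGroup n) → cj (sig n k) (lk n i j) = lk n i j := by
    intro h
    rw [lk_of_lt hij, cj_cl]
    congr 1
    ext
    rw [conjHom_val, h.eq, mul_inv_cancel_right]
  rcases (by omega : k + 1 < i ∨ k + 1 = i ∨ (k = i ∧ i + 1 = j) ∨ (k = i ∧ i + 1 < j) ∨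
    (i < k ∧ k + 1 < j) ∨ (i < k ∧ k + 1 = j) ∨ k = j ∨ j < k) with
    h | rfl | ⟨rfl, rfl⟩ | ⟨rfl, h⟩ | ⟨h1, h2⟩ | ⟨h1, rfl⟩ | rfl | h
  · rw [sw_ne (by omega) (by omega), sw_ne (by omega) (by omega)]
    exact hc (commute_sig_A_outer hij (by omega))
  · rw [sw_succ, sw_ne (by omega) (by omega), lk_of_lt hij, lk_of_lt (by omega), cj_cl]
    refine cl_eq_of_conj hsq ?_
    rw [conjHom_val, ← sig_conj_A (by omega) hj]
    group
  · rw [sw_self, sw_succ, lk_symm n (k + 1)]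
    refine hc ?_
    rw [A_val_self]
    exact (Commute.refl _).pow_right 2
  · rw [sw_self, sw_ne (by omega) (by omega), lk_of_lt hij, lk_of_lt (by omega), cj_cl]
    congr 1
    ext
    rw [conjHom_val, sig_conj_A (by omega) hj]
  · rw [sw_ne (by omega) (by omega), sw_ne (by omega) (by omega)]
    exact hc (commute_sig_A_inner h1 h2 hj)
  · rw [sw_succ, sw_ne (by omega) (by omega), lk_of_lt hij, lk_of_lt h1, cj_cl]
    refine cl_eq_of_conj hsq ?_
    rw [conjHom_val, A_val_succ h1]
    group
  · rw [sw_self, sw_ne (by omega) (by omega), lk_of_lt hij, lk_of_lt (by omega), cj_cl]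
    congr 1
    ext
    rw [conjHom_val, A_val_succ hij]
  · rw [sw_ne (by omega) (by omega), sw_ne (by omega) (by omega)]
    exact hc (commute_sig_A_outer hij (by omega))

/-- The braid group acts on the linking classes through permutations. Since it surjects onto the
symmetric group, an identity between these classes can be moved to the first strands. -/
theorem cj_lk {n : ℕ} (b : BraidGroup n) (i j : Fin n) :
    cj b (lk n i j) = lk n (toPerm n b i) (toPerm n b j) := by
  induction b using braid_induction generalizing i j with
  | h1 => simp [cj_one]
  | hs k hk =>
    have h : ∀ i : Fin n, (toPerm n (sig n k) i : ℕ) = sw k i := fun i => toPerm_sig_val hk i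
    rw [h, h]
    rcases lt_trichotomy (i : ℕ) j with hij | hij | hij
    · exact cj_sig_lk_of_lt hij j.2
    · rw [hij, lk_self, lk_self, map_zero]
    · rw [lk_symm, lk_symm n (sw k i)]
      exact cj_sig_lk_of_lt hij i.2
  | hm a b ha hb => rw [cj_mul, hb, ha, map_mul]; rfl
  | hi a ha =>
    have h := ha (toPerm n a⁻¹ i) (toPerm n a⁻¹ j)
    simp only [← Equiv.Perm.mul_apply, ← map_mul, mul_inv_cancel, map_one,
      Equiv.Perm.one_apply] at h
    rw [← h, ← cj_mul, inv_mul_cancel, cj_one]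

theorem toPerm_surjective (n : ℕ) : Function.Surjective (toPerm n) := by
  cases n with
  | zero => intro p; exact ⟨1, Subsingleton.elim _ _⟩
  | succ n =>
    intro p
    have hp : p ∈ Submonoid.closure
        (Set.range fun i : Fin n => Equiv.swap i.castSucc i.succ) := by
      rw [Equiv.Perm.mclosure_swap_castSucc_succ]; trivial
    induction hp using Submonoid.closure_induction with
    | mem p hp =>
      obtain ⟨i, rfl⟩ := hp
      exact ⟨PresentedGroup.of i, lift_of _ _ _ _⟩
    | one => exact ⟨1, map_one _⟩
    | mul p q _ _ hp hq =>
      obtain ⟨a, rfl⟩ := hp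
      obtain ⟨b, rfl⟩ := hq
      exact ⟨a * b, map_mul _ _ _⟩

theorem exists_braid {n r : ℕ} (x y : Fin r ↪ Fin n) :
    ∃ b : BraidGroup n, ∀ t, toPerm n b (x t) = y t := by
  have := Equiv.Perm.isMultiplyPretransitive (Fin n) r
  obtain ⟨p, hp⟩ := MulAction.exists_smul_eq (Equiv.Perm (Fin n)) x y
  obtain ⟨b, rfl⟩ := toPerm_surjective n p
  exact ⟨b, fun t => DFunLike.congr_fun hp t⟩

/-- The inclusion of the first `r` strands. -/
def firstStrands {n r : ℕ} (y : Fin r ↪ Fin n) : Fin r ↪ Fin n :=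
  Fin.castLEEmb (by simpa using Fintype.card_le_of_embedding y)

theorem lk_lie_lk_of_ne {n : ℕ} {i j k l : Fin n} (hij : i ≠ j) (hik : i ≠ k) (hil : i ≠ l)
    (hjk : j ≠ k) (hjl : j ≠ l) (hkl : k ≠ l) : ⁅lk n i j, lk n k l⁆ = 0 := by
  let y : Fin 4 ↪ Fin n := ⟨![i, j, k, l], by
    intro s t
    fin_cases s <;> fin_cases t <;> simp [*, Ne.symm hij, Ne.symm hik, Ne.symm hil, Ne.symm hjk,
      Ne.symm hjl, Ne.symm hkl]⟩
  have hn : 4 ≤ n := by simpa using Fintype.card_le_of_embedding y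
  obtain ⟨b, hb⟩ := exists_braid (firstStrands y) y
  have h : ⁅lk n 0 1, lk n 2 3⁆ = 0 := by
    rw [lk_of_lt (by omega), lk_of_lt (by omega)]
    refine cl_lie_eq_zero (Subtype.ext ?_)
    change (A n 0 (0 + 1) : BraidGroup n) * A n 2 (2 + 1) = A n 2 (2 + 1) * A n 0 (0 + 1)
    rw [A_val_self, A_val_self]
    exact (commute_sig (by omega)).pow_pow 2 2
  have h' := congrArg (cj b) h
  have e0 := cj_lk b (firstStrands y 0) (firstStrands y 1)
  have e1 := cj_lk b (firstStrands y 2) (firstStrands y 3)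
  rw [hb, hb] at e0 e1
  rw [LieHom.map_lie, map_zero] at h'
  exact (congrArg₂ Bracket.bracket e0 e1).symm.trans h'

/-- On the first three strands, with `s` and `t` the two generators, the product of the braids
linking the third strand to the first two is `t * s * (s * t)`, and this commutes with `s` by the
braid relation. -/
theorem lk_lie_add {n : ℕ} {i j k : Fin n} (hij : i ≠ j) (hik : i ≠ k) (hjk : j ≠ k) :
    ⁅lk n i j, lk n i k + lk n j k⁆ = 0 := by
  let y : Fin 3 ↪ Fin n := ⟨![i, j, k], by
    intro s t
    fin_cases s <;> fin_cases t <;> simp [*, Ne.symm hij, Ne.symm hik, Ne.symm hjk]⟩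
  have hn : 3 ≤ n := by simpa using Fintype.card_le_of_embedding y
  obtain ⟨b, hb⟩ := exists_braid (firstStrands y) y
  have h : ⁅lk n 0 1, lk n 0 2 + lk n 1 2⁆ = 0 := by
    rw [lk_of_lt (by omega), lk_of_lt (by omega), lk_of_lt (by omega), ← cl_mul]
    refine cl_lie_eq_zero (Subtype.ext ?_)
    change (A n 0 (0 + 1) : BraidGroup n) * (A n 0 (0 + 1 + 1) * A n 1 (1 + 1)) =
      A n 0 (0 + 1 + 1) * A n 1 (1 + 1) * A n 0 (0 + 1)
    rw [A_val_succ (s := 0 + 1) (by omega), A_val_self, A_val_self]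
    have h2 := sig_braid (n := n) (i := 0) (by omega)
    simp only [zero_add] at h2 ⊢
    generalize sig n 0 = s at h2 ⊢
    generalize sig n 1 = t at h2 ⊢
    have e : t * s ^ 2 * t⁻¹ * t ^ 2 = t * s * (s * t) := by rw [pow_two s]; group
    have e1 : s * (t * s) = t * s * t := by rw [← mul_assoc, h2]
    have e2 : t * (s * t) = s * t * s := by rw [← mul_assoc, h2]
    have hc : Commute s (t * s * (s * t)) := by
      change s * (t * s * (s * t)) = t * s * (s * t) * s
      rw [← mul_assoc, e1, mul_assoc (t * s) t, e2]
      group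
    rw [e]
    exact hc.pow_left 2
  have h' := congrArg (cj b) h
  have e0 := cj_lk b (firstStrands y 0) (firstStrands y 1)
  have e1 := cj_lk b (firstStrands y 0) (firstStrands y 2)
  have e2 := cj_lk b (firstStrands y 1) (firstStrands y 2)
  rw [hb, hb] at e0 e1 e2
  rw [LieHom.map_lie, map_zero, map_add] at h'
  exact (congrArg₂ Bracket.bracket e0 (congrArg₂ HAdd.hAdd e1 e2)).symm.trans h'

end Braid

end

/-! ### Doubling strands and the values of `Theta` in weight one -/

noncomputable section

namespace Braid

open LCS

/-- A braid with the strand that starts in the position `k` doubled. -/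
def dbr {n : ℕ} (b : BraidGroup n) (k : Fin n) : BraidGroup (n + 1) := (dbl n b (k, 1)).2

theorem dbl_apply {n : ℕ} (b : BraidGroup n) (k : Fin n) (g : BraidGroup (n + 1)) :
    dbl n b (k, g) = (toPerm n b k, dbr b k * g) := by
  have h := dblInv_dbl b
  have h1 := h.mul (k, 1) g
  simp only [one_mul] at h1
  rw [h1, h.fst]
  rfl

theorem dbr_mul {n : ℕ} (a b : BraidGroup n) (k : Fin n) :
    dbr (a * b) k = dbr a (toPerm n b k) * dbr b k := by
  rw [dbr, map_mul, Equiv.Perm.mul_apply, dbl_apply b, dbl_apply a]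
  simp

theorem dbr_one {n : ℕ} (k : Fin n) : dbr (1 : BraidGroup n) k = 1 := by simp [dbr]

theorem dbr_inv {n : ℕ} (b : BraidGroup n) (k : Fin n) :
    dbr b⁻¹ (toPerm n b k) = (dbr b k)⁻¹ := by
  rw [eq_inv_iff_mul_eq_one, ← dbr_mul, inv_mul_cancel, dbr_one]

theorem dbr_sig {n i : ℕ} (h : i < n - 1) (k : Fin n) : dbr (sig n i) k = dblSig n i k := by
  rw [sig, dif_pos h, dbr, dbl, lift_of]
  simp [dblGen]

theorem degen_val {n : ℕ} (t : Fin n) (p : PureBraidGroup n) :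
    (degen t p : BraidGroup (n + 1)) = dbr p.1 t := rfl

/-- Doubling is multiplicative once the position of the doubled strand is followed. This
equivariance is what lets `map_degen_lk` be reduced to the first two strands. -/
theorem degen_conjHom {n : ℕ} (b : BraidGroup n) (k : Fin n) (p : PureBraidGroup n) :
    degen (toPerm n b k) (conjHom b p) = conjHom (dbr b k) (degen k p) := by
  have hp : toPerm n p.1 = 1 := p.2
  ext
  rw [degen_val, conjHom_val, conjHom_val, degen_val, dbr_mul, dbr_inv, dbr_mul]
  simp [hp]

theorem map_degen_cj {n : ℕ} (b : BraidGroup n) (k : Fin n) (u : E0 (PureBraidGroup n)) :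
    E0.map (degen (toPerm n b k)) (cj b u) = cj (dbr b k) (E0.map (degen k) u) := by
  rw [cj, cj, E0.map_map, E0.map_map]
  congr 2
  exact MonoidHom.ext (degen_conjHom b k)

/-- `Fin.predAbove` merges the two copies of the doubled strand; the permutation of the doubled
braid covers the original one. -/
theorem predAbove_toPerm_dbr {n : ℕ} (b : BraidGroup n) (k : Fin n) (x : Fin (n + 1)) :
    (toPerm n b k).predAbove (toPerm (n + 1) (dbr b k) x) = toPerm n b (k.predAbove x) := by
  have h := dblInv_dbl b
  have h1 : ∀ j, toPerm (n + 1) (dbr b k) (pos k j) = pos (toPerm n b k) (toPerm n b j) := by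
    intro j
    have := h.pos (k, 1) j
    rw [dbl_apply] at this
    simp only [mul_one, map_one, inv_one, Equiv.Perm.one_apply] at this
    rw [Equiv.Perm.inv_eq_iff_eq] at this
    exact this.symm
  have h2 : toPerm (n + 1) (dbr b k) k.succ = (toPerm n b k).succ := by
    have := h.succ (k, 1)
    rw [dbl_apply] at this
    simp only [mul_one, map_one, inv_one, Equiv.Perm.one_apply] at this
    rw [Equiv.Perm.inv_eq_iff_eq] at this
    exact this.symm
  have h3 : ∀ k j : Fin n, k.predAbove (pos k j) = j := by
    intro k j
    unfold pos
    split_ifs with hj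
    · exact Fin.predAbove_castSucc_of_le _ _ hj
    · exact Fin.predAbove_succ_of_le _ _ (not_le.1 hj).le
  by_cases hx : x = k.succ
  · rw [hx, h2, Fin.predAbove_succ_self, Fin.predAbove_succ_self]
  · obtain ⟨j, rfl⟩ : ∃ j, x = pos k j := by
      rcases lt_or_gt_of_ne hx with hx | hx
      · refine ⟨x.castPred ?_, ?_⟩
        · rintro rfl
          exact absurd (Fin.le_last k.succ) (not_le.2 hx)
        · rw [pos, if_pos, Fin.castSucc_castPred]
          rw [Fin.lt_def] at hx
          rw [Fin.le_def]
          simp at hx ⊢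
          omega
      · refine ⟨x.pred ?_, ?_⟩
        · rintro rfl
          exact absurd (Fin.zero_le k.succ) (not_le.2 hx)
        · rw [pos, if_neg, Fin.succ_pred]
          rw [Fin.lt_def] at hx
          rw [Fin.le_def]
          simp at hx ⊢
          omega
    rw [h1, h3, h3]

/-- The sum of the classes `lk` over all pairs of strands that replace the strands `i` and `j` when
the strand `t` is doubled. -/
def lkDouble {n : ℕ} (t i j : Fin n) : E0 (PureBraidGroup (n + 1)) :=
  ∑ x : Fin (n + 1) × Fin (n + 1),
    if t.predAbove x.1 = i ∧ t.predAbove x.2 = j then lk (n + 1) x.1 x.2 else 0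

theorem cj_lkDouble {n : ℕ} (b : BraidGroup n) (k i j : Fin n) :
    cj (dbr b k) (lkDouble k i j) =
      lkDouble (toPerm n b k) (toPerm n b i) (toPerm n b j) := by
  rw [lkDouble, lkDouble, map_sum]
  refine Fintype.sum_equiv
    ((toPerm (n + 1) (dbr b k)).prodCongr (toPerm (n + 1) (dbr b k))) _ _ fun x => ?_
  simp only [Equiv.prodCongr_apply, Prod.map_fst, Prod.map_snd, predAbove_toPerm_dbr,
    EmbeddingLike.apply_eq_iff_eq]
  split_ifs
  · exact cj_lk _ _ _
  · exact map_zero _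

theorem predAbove_val {n : ℕ} (t : Fin n) (x : Fin (n + 1)) :
    (t.predAbove x : ℕ) = if (t : ℕ) < x then (x : ℕ) - 1 else x := by
  unfold Fin.predAbove
  simp only [Fin.lt_def, Fin.val_castSucc]
  split_ifs <;> simp

theorem lkDouble_eq {n : ℕ} {t i j : Fin n} (s : Finset (Fin (n + 1) × Fin (n + 1)))
    (h : ∀ x, t.predAbove x.1 = i ∧ t.predAbove x.2 = j ↔ x ∈ s) :
    lkDouble t i j = ∑ x ∈ s, lk (n + 1) x.1 x.2 := by
  rw [lkDouble, ← Finset.sum_filter]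
  refine Finset.sum_congr (Finset.ext fun x => ?_) fun _ _ => rfl
  rw [Finset.mem_filter, h]
  simp

/-- The explicit double of the square of the first generator, according to whether the doubled
strand is the first, the second or a later one. -/
theorem map_degen_lk_zero_one {n : ℕ} (t : Fin (n + 2)) :
    E0.map (degen t) (lk (n + 2) 0 1) = lkDouble t 0 1 := by
  have h1 := sig_braid (n := n + 3) (i := 0) (by omega)
  have hd : ((degen t (A (n + 2) 0 1) : PureBraidGroup (n + 3)) : BraidGroup (n + 3)) =
      dblSig (n + 2) 0 (sw 0 t) * dblSig (n + 2) 0 t := by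
    rw [degen_val, show (A (n + 2) 0 1 : BraidGroup (n + 2)) = _ from A_val_self (n + 2) 0, pow_two,
      dbr_mul, dbr_sig (by omega), dbr_sig (by omega), toPerm_sig_val (by omega)]
    rfl
  let a0 : Fin (n + 3) := ⟨0, by omega⟩
  let a1 : Fin (n + 3) := ⟨1, by omega⟩
  let a2 : Fin (n + 3) := ⟨2, by omega⟩
  rw [lk_of_lt (by omega), map_cl]
  rcases (by omega : (t : ℕ) = 0 ∨ (t : ℕ) = 1 ∨ 1 < (t : ℕ)) with ht | ht | ht
  · rw [lkDouble_eq {(a0, a2), (a1, a2)}, Finset.sum_pair (by simp [a0, a1])]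
    · change _ = lk (n + 3) 0 2 + lk (n + 3) 1 2
      rw [lk_of_lt (by omega), lk_of_lt (by omega), ← cl_mul]
      congr 1
      ext
      rw [hd, ht]
      change _ = (A (n + 3) 0 (0 + 1 + 1) : BraidGroup (n + 3)) * A (n + 3) 1 (1 + 1)
      rw [A_val_succ (s := 0 + 1) (by omega), A_val_self, A_val_self]
      simp only [sw, dblSig, zero_add, if_true, lt_irrefl, if_false, not_lt_zero, one_ne_zero]
      rw [pow_two, pow_two]
      group
    · rintro ⟨x, y⟩
      simp only [Fin.ext_iff, predAbove_val, ht, Finset.mem_insert, Finset.mem_singleton,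
        Prod.mk.injEq, a0, a1, a2, Fin.val_zero, Fin.val_one]
      split_ifs <;> omega
  · rw [lkDouble_eq {(a0, a1), (a0, a2)}, Finset.sum_pair (by simp [Fin.ext_iff, a1, a2])]
    · change _ = lk (n + 3) 0 1 + lk (n + 3) 0 2
      -- Doubling the second strand produces a conjugate of `A 1 2` by the first generator; its
      -- class is nevertheless that of the standard braid.
      have e : lk (n + 3) 0 2 = cl (conjHom (sig (n + 3) 0) (A (n + 3) 1 2)) := by
        have := cj_lk (sig (n + 3) 0) a1 a2
        rw [toPerm_sig_val (by omega), toPerm_sig_val (by omega)] at this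
        rw [← cj_cl, ← lk_of_lt (by omega)]
        exact this.symm
      rw [e, lk_of_lt (by omega), add_comm (cl _), ← cl_mul]
      congr 1
      ext
      rw [hd, ht]
      change _ = ((conjHom (sig (n + 3) 0) (A (n + 3) 1 (1 + 1)) : PureBraidGroup (n + 3)) :
        BraidGroup (n + 3)) * A (n + 3) 0 (0 + 1)
      rw [conjHom_val, A_val_self, A_val_self]
      simp only [sw, dblSig, zero_add, if_true, lt_irrefl, if_false, not_lt_zero, one_ne_zero]
      rw [pow_two, pow_two]
      group
    · rintro ⟨x, y⟩
      simp only [Fin.ext_iff, predAbove_val, ht, Finset.mem_insert, Finset.mem_singleton,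
        Prod.mk.injEq, a0, a1, a2, Fin.val_zero, Fin.val_one]
      split_ifs <;> omega
  · rw [lkDouble_eq {(a0, a1)}, Finset.sum_singleton]
    · change _ = lk (n + 3) 0 1
      rw [lk_of_lt (by omega)]
      congr 1
      ext
      rw [hd]
      change _ = (A (n + 3) 0 (0 + 1) : BraidGroup (n + 3))
      rw [A_val_self, sw_ne (by omega) (by omega), pow_two]
      simp only [dblSig, if_neg (show ¬ (t : ℕ) < 0 by omega), if_neg (show ¬ (t : ℕ) = 0 by omega),
        if_neg (show ¬ (t : ℕ) = 0 + 1 by omega)]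
    · rintro ⟨x, y⟩
      simp only [Fin.ext_iff, predAbove_val, Finset.mem_singleton,
        Prod.mk.injEq, a0, a1, Fin.val_zero, Fin.val_one]
      split_ifs <;> omega

theorem map_degen_lk {n : ℕ} (t i j : Fin n) (hij : i ≠ j) :
    E0.map (degen t) (lk n i j) = lkDouble t i j := by
  obtain ⟨n, rfl⟩ : ∃ m, n = m + 2 := ⟨n - 2, by have := i.2; have := j.2; omega⟩
  let x : Fin 2 ↪ Fin (n + 2) := ⟨![0, 1], by
    intro s t
    fin_cases s <;> fin_cases t <;> simp⟩
  let y : Fin 2 ↪ Fin (n + 2) := ⟨![i, j], by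
    intro s t
    fin_cases s <;> fin_cases t <;> simp [hij, hij.symm]⟩
  obtain ⟨b, hb⟩ := exists_braid x y
  have h0 : toPerm (n + 2) b 0 = i := hb 0
  have h1 : toPerm (n + 2) b 1 = j := hb 1
  obtain ⟨k, rfl⟩ := (toPerm (n + 2) b).surjective t
  have e : lk (n + 2) i j = cj b (lk (n + 2) 0 1) := by
    have := cj_lk b 0 1
    rw [h0, h1] at this
    exact this.symm
  rw [e, map_degen_cj, map_degen_lk_zero_one, cj_lkDouble, h0, h1]

/-- The sum of the classes `lk` over all pairs of strands which are separated by the cut between the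
first `m` strands and the other ones. -/
def cut (n m : ℕ) : E0 (PureBraidGroup n) :=
  ∑ x : Fin n × Fin n, if (x.1 : ℕ) < m ∧ m ≤ x.2 then lk n x.1 x.2 else 0

/-- Every pair of new strands lies over exactly one pair of old ones, and by hypothesis it is
separated by the new cut exactly when that pair is separated by the old cut. -/
theorem map_degen_cut {n m m' : ℕ} (t : Fin n)
    (h : ∀ x : Fin (n + 1), (t.predAbove x : ℕ) < m ↔ (x : ℕ) < m') :
    E0.map (degen t) (cut n m) = cut (n + 1) m' := by
  have e : ∀ x : Fin n × Fin n,
      E0.map (degen t) (if (x.1 : ℕ) < m ∧ m ≤ x.2 then lk n x.1 x.2 else 0) =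
      ∑ y : Fin (n + 1) × Fin (n + 1), if x = (t.predAbove y.1, t.predAbove y.2) then
        (if (x.1 : ℕ) < m ∧ m ≤ x.2 then lk (n + 1) y.1 y.2 else 0) else 0 := by
    rintro ⟨i, j⟩
    by_cases hx : (i : ℕ) < m ∧ m ≤ j
    · simp only [hx, and_self, if_true, Prod.mk.injEq]
      rw [map_degen_lk t i j (by rintro rfl; omega), lkDouble]
      exact Finset.sum_congr rfl fun y _ => by simp only [eq_comm]
    · simp only [hx, if_false, map_zero, ite_self, Finset.sum_const_zero]
  rw [cut, map_sum, Finset.sum_congr rfl fun x _ => e x, Finset.sum_comm, cut]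
  refine Finset.sum_congr rfl fun y _ => ?_
  rw [Finset.sum_ite_eq' Finset.univ]
  have h1 := h y.1
  have h2 := h y.2
  simp only [Finset.mem_univ, if_true]
  congr 1
  rw [eq_iff_iff]
  omega

/-- Doubling the first strand adds a strand before the cut, and doubling the last one adds a strand
behind it. The recursion for `thetaGen` moves the cut accordingly. -/
theorem cl_thetaGen (n : ℕ) (q : Fin (n + 1)) : cl (thetaGen n q) = cut (n + 2) (n + 1 - q) := by
  induction n with
  | zero =>
    rw [cut, Fintype.sum_prod_type]
    simp [Fin.sum_univ_two]
    rw [lk_of_lt (by omega)]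
    rfl
  | succ n ih =>
    induction q using Fin.lastCases with
    | last =>
      rw [thetaGen]
      beta_reduce
      rw [Fin.lastCases_last, ← map_cl, ih,
        map_degen_cut (m' := n + 1 + 1 - Fin.last (n + 1))]
      intro x
      rw [predAbove_val]
      simp only [Fin.val_last]
      split_ifs <;> omega
    | cast q =>
      rw [thetaGen]
      beta_reduce
      rw [Fin.lastCases_castSucc, ← map_cl, ih,
        map_degen_cut (m' := n + 1 + 1 - q.castSucc)]
      intro x
      have := q.2
      rw [predAbove_val, Fin.val_castSucc]
      by_cases hx : ((0 : Fin (n + 2)) : ℕ) < x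
      · rw [if_pos hx]
        rw [Fin.val_zero] at hx
        omega
      · rw [if_neg hx]
        rw [Fin.val_zero] at hx
        omega

theorem map_Theta_gen (n : ℕ) (q : Fin (n + 1)) :
    E0.map (Theta (n + 1)) (gen q) = cut (n + 2) (n + 1 - q) := by
  rw [← cl_thetaGen, show gen q = cl (FreeGroup.of q) from rfl, map_cl]
  congr 1
  exact FreeGroup.lift_apply_of ..

end Braid

end

/-! ### The peeling argument -/

noncomputable section

namespace Peel

variable {R Q ι : Type*} [Ring R] [AddCommGroup Q]

/-- The subring generated by the letters in a finite set. -/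
def words (s : ι → R) (A : Finset ι) : Subring R := Subring.closure (s '' A)

theorem letter_mem {s : ι → R} {A : Finset ι} {l : ι} (h : l ∈ A) : s l ∈ words s A :=
  Subring.subset_closure ⟨l, h, rfl⟩

/-- A product of letters either avoids `c` or splits at the last occurrence of `c`. -/
theorem map_words_eq_zero [DecidableEq ι] {s : ι → R} {A : Finset ι} {c : ι} (G : R →+ Q)
    (h1 : ∀ w ∈ words s (A.erase c), G w = 0)
    (h2 : ∀ w ∈ words s A, ∀ v ∈ words s (A.erase c), G (w * s c * v) = 0) :
    ∀ w ∈ words s A, G w = 0 := by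
  intro w hw
  rw [words, Subring.mem_closure_iff] at hw
  induction hw using AddSubgroup.closure_induction with
  | zero => exact map_zero G
  | add u v _ _ hu hv => rw [map_add, hu, hv, add_zero]
  | neg u _ hu => rw [map_neg, hu, neg_zero]
  | mem w hw =>
    have key : w ∈ words s (A.erase c) ∨
        ∃ u ∈ words s A, ∃ v ∈ words s (A.erase c), w = u * s c * v := by
      induction hw using Submonoid.closure_induction_right with
      | one => exact Or.inl (one_mem _)
      | mul_right w hw y hy ih =>
        obtain ⟨l, hl, rfl⟩ := hy
        by_cases hc : l = c
        · subst hc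
          refine Or.inr ⟨w, ?_, 1, one_mem _, (mul_one _).symm⟩
          have : Submonoid.closure (s '' (A : Set ι)) ≤ (words s A).toSubmonoid :=
            Submonoid.closure_le.2 Subring.subset_closure
          exact this hw
        · have hl' : s l ∈ words s (A.erase c) := letter_mem (Finset.mem_erase.2 ⟨hc, hl⟩)
          rcases ih with ih | ⟨u, hu, v, hv, rfl⟩
          · exact Or.inl (mul_mem ih hl')
          · exact Or.inr ⟨u, hu, v * s l, mul_mem hv hl', by rw [mul_assoc]⟩
    rcases key with h | ⟨u, hu, v, hv, rfl⟩
    · exact h1 w h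
    · exact h2 u hu v hv

theorem comm_mem {s : ι → R} {A : Finset ι} {x : R}
    (h : ∀ l ∈ A, x * s l - s l * x ∈ words s A) {w : R} (hw : w ∈ words s A) :
    x * w - w * x ∈ words s A := by
  have key : w ∈ words s A ∧ x * w - w * x ∈ words s A := by
    induction hw using Subring.closure_induction with
    | mem w hw => obtain ⟨l, hl, rfl⟩ := hw; exact ⟨letter_mem hl, h l hl⟩
    | zero => simp
    | one => simp
    | add u v _ _ hu hv =>
      refine ⟨add_mem hu.1 hv.1, ?_⟩
      rw [show x * (u + v) - (u + v) * x = (x * u - u * x) + (x * v - v * x) by noncomm_ring]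
      exact add_mem hu.2 hv.2
    | neg u _ hu =>
      refine ⟨neg_mem hu.1, ?_⟩
      rw [show x * -u - -u * x = -(x * u - u * x) by noncomm_ring]
      exact neg_mem hu.2
    | mul u v _ _ hu hv =>
      refine ⟨mul_mem hu.1 hv.1, ?_⟩
      rw [show x * (u * v) - u * v * x = (x * u - u * x) * v + u * (x * v - v * x) by noncomm_ring]
      exact add_mem (mul_mem hu.2 hv.1) (mul_mem hu.1 hv.2)
  exact key.2

theorem comm_eq {s : ι → R} {A : Finset ι} {x y : R}
    (h : ∀ l ∈ A, x * s l - s l * x = y * s l - s l * y) {w : R} (hw : w ∈ words s A) :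
    x * w - w * x = y * w - w * y := by
  induction hw using Subring.closure_induction with
  | mem w hw => obtain ⟨l, hl, rfl⟩ := hw; exact h l hl
  | zero => simp
  | one => simp
  | add u v _ _ hu hv =>
    rw [show x * (u + v) - (u + v) * x = (x * u - u * x) + (x * v - v * x) by noncomm_ring, hu, hv]
    noncomm_ring
  | neg u _ hu =>
    rw [show x * -u - -u * x = -(x * u - u * x) by noncomm_ring, hu]
    noncomm_ring
  | mul u v _ _ hu hv =>
    rw [show x * (u * v) - u * v * x = (x * u - u * x) * v + u * (x * v - v * x) by noncomm_ring,
      hu, hv]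
    noncomm_ring

/-- The additive subgroup generated by the products of elements of `U` and words, followed by a
fixed letter. -/
def tail (s : ι → R) (A : Finset ι) (U : AddSubgroup R) (c : ι) : AddSubgroup R :=
  AddSubgroup.closure {z | ∃ u ∈ U, ∃ w ∈ words s A, z = u * w * s c}

theorem mem_tail {s : ι → R} {A : Finset ι} {U : AddSubgroup R} {c : ι} {u w : R} (hu : u ∈ U)
    (hw : w ∈ words s A) : u * w * s c ∈ tail s A U c :=
  AddSubgroup.subset_closure ⟨u, hu, w, hw, rfl⟩

theorem tail_induction {s : ι → R} {A : Finset ι} {U V : AddSubgroup R} {c : ι} (D : R →+ R)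
    (h : ∀ u ∈ U, ∀ w ∈ words s A, D (u * w * s c) ∈ V) : ∀ z ∈ tail s A U c, D z ∈ V := by
  intro z hz
  have : tail s A U c ≤ V.comap D := by
    rw [tail, AddSubgroup.closure_le]
    rintro _ ⟨u, hu, w, hw, rfl⟩
    exact h u hu w hw
  exact this hz

theorem tail_map_eq_zero {s : ι → R} {A : Finset ι} {U : AddSubgroup R} {c : ι} (F : R →+ Q)
    (h : ∀ u ∈ U, ∀ w ∈ words s A, F (u * w * s c) = 0) : ∀ z ∈ tail s A U c, F z = 0 := by
  intro z hz
  have : tail s A U c ≤ F.ker := by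
    rw [tail, AddSubgroup.closure_le]
    rintro _ ⟨u, hu, w, hw, rfl⟩
    exact h u hu w hw
  exact this hz

/-- The additive map `u ↦ x * u - u * (x - 2 * s)`. -/
def der (x s : R) : R →+ R :=
  AddMonoidHom.mulLeft x - AddMonoidHom.mulRight (x - 2 * s)

theorem der_apply (x s u : R) : der x s u = x * u - u * x + 2 * (u * s) := by
  simp only [der, AddMonoidHom.sub_apply, AddMonoidHom.coe_mulLeft, AddMonoidHom.coe_mulRight]
  noncomm_ring

/-- Two families of elements of a filtered ring with commutator relations, and an additive map which
does not see the first family. -/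
structure Data (R Q ι : Type*) [Ring R] [AddCommGroup Q] [LinearOrder ι] where
  s : ι → R
  x : ι → R
  F : R →+ Q
  fil : ℕ → AddSubgroup R
  top : ℕ
  comm_add : ∀ {l m}, l ≤ m →
    x m * s l - s l * x m = (s m * s l - s l * s m) + (s m * s l - s l * s m)
  comm_of_lt : ∀ {l m}, m < l → x m * s l - s l * x m = 0
  F_left : ∀ m u, F (x m * u) = 0
  F_right : ∀ m u, F (u * x m) = F (u * s m)
  fil_mul_s : ∀ {k u} l, u ∈ fil k → u * s l ∈ fil (k + 1)
  fil_mul_x : ∀ {k u} l, u ∈ fil k → u * x l ∈ fil (k + 1)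
  fil_x_mul : ∀ {k u} l, u ∈ fil k → x l * u ∈ fil (k + 1)
  fil_anti : Antitone fil
  one_mem_fil : 1 ∈ fil 0
  F_fil : ∀ u ∈ fil top, F u = 0

namespace Data

variable [LinearOrder ι] (D : Data R Q ι)

theorem comm_of_le {l m : ι} (h : l ≤ m) :
    D.x m * D.s l - D.s l * D.x m = 2 * (D.s m * D.s l - D.s l * D.s m) := by
  rw [D.comm_add h, two_mul]

theorem fil_mul_words {A : Finset ι} {k : ℕ} {u w : R} (hu : u ∈ D.fil k) (hw : w ∈ words D.s A) :
    u * w ∈ D.fil k := by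
  induction hw using Subring.closure_induction generalizing u with
  | mem w hw => obtain ⟨l, -, rfl⟩ := hw; exact D.fil_anti (Nat.le_succ k) (D.fil_mul_s l hu)
  | zero => simp
  | one => simpa
  | add v w _ _ hv hw => rw [mul_add]; exact add_mem (hv hu) (hw hu)
  | neg v _ hv => rw [mul_neg]; exact neg_mem (hv hu)
  | mul v w _ _ hv hw => rw [← mul_assoc]; exact hw (hv hu)

theorem comm_letter_mem {A : Finset ι} {m : ι} (hm : m ∈ A) (l : ι) (hl : l ∈ A) :
    D.x m * D.s l - D.s l * D.x m ∈ words D.s A := by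
  rcases le_or_gt l m with h | h
  · rw [D.comm_of_le h]
    exact mul_mem (ofNat_mem _ 2) (sub_mem (mul_mem (letter_mem hm) (letter_mem hl))
      (mul_mem (letter_mem hl) (letter_mem hm)))
  · rw [D.comm_of_lt h]; exact zero_mem _

/-- Stability under the commutators with the elements `x m`. -/
def Plus (A : Finset ι) (U : AddSubgroup R) : Prop :=
  ∀ u ∈ U, ∀ m ∈ A, D.x m * u - u * D.x m ∈ U

/-- Stability under the commutators with the elements `x m`, up to a correction. -/
def Minus (A : Finset ι) (U : AddSubgroup R) : Prop :=
  ∀ u ∈ U, ∀ m ∈ A, D.x m * u - u * D.x m + 2 * (u * D.s m) ∈ U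

/-- The vanishing of `F` on the products of elements of `U` and words. -/
def Van (A : Finset ι) (U : AddSubgroup R) : Prop :=
  ∀ u ∈ U, ∀ w ∈ words D.s A, D.F (u * w) = 0

variable {D}

theorem Plus.inf {A : Finset ι} {U : AddSubgroup R} (h : D.Plus A U) (k : ℕ) :
    D.Plus A (U ⊓ D.fil k) := fun u hu m hm =>
  ⟨h u hu.1 m hm, D.fil_anti (Nat.le_succ k)
    (sub_mem (D.fil_x_mul m hu.2) (D.fil_mul_x m hu.2))⟩

theorem Minus.mem_fil {m : ι} {k : ℕ} {u : R} (hu : u ∈ D.fil k) :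
    D.x m * u - u * D.x m + 2 * (u * D.s m) ∈ D.fil (k + 1) := by
  have := D.fil_mul_s m hu
  rw [two_mul]
  exact add_mem (sub_mem (D.fil_x_mul m hu) (D.fil_mul_x m hu)) (add_mem this this)

theorem Minus.inf {A : Finset ι} {U : AddSubgroup R} (h : D.Minus A U) (k : ℕ) :
    D.Minus A (U ⊓ D.fil k) := fun u hu m hm =>
  ⟨h u hu.1 m hm, D.fil_anti (Nat.le_succ k) (Minus.mem_fil hu.2)⟩

/-- Descending induction on the filtration, starting at `top`, where `F` vanishes. -/
theorem van_of_fil {A : Finset ι} {U : AddSubgroup R} (hU : U ≤ D.fil 0)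
    (h : ∀ k, D.Van A (U ⊓ D.fil (k + 1)) → D.Van A (U ⊓ D.fil k)) : D.Van A U := by
  have key : ∀ j k, k + j = D.top → D.Van A (U ⊓ D.fil k) := by
    intro j
    induction j with
    | zero =>
      rintro k rfl u hu w hw
      exact D.F_fil _ (D.fil_mul_words hu.2 hw)
    | succ j ih => exact fun k hk => h k (ih (k + 1) (by omega))
  intro u hu
  exact key D.top 0 (zero_add _) u ⟨hu, hU hu⟩

/-- Everything up to the last `c` is absorbed into the subgroup, so that only words in fewer letters
remain. -/
theorem van_of_tail {A : Finset ι} {U : AddSubgroup R} {c : ι} (h1 : D.Van (A.erase c) U)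
    (h2 : D.Van (A.erase c) (tail D.s A U c)) : D.Van A U := by
  intro u hu w hw
  refine map_words_eq_zero (c := c) (D.F.comp (AddMonoidHom.mulLeft u)) (fun w hw => h1 u hu w hw)
    (fun w hw v hv => ?_) w hw
  have := h2 _ (mem_tail hu hw) v hv
  simpa only [AddMonoidHom.comp_apply, AddMonoidHom.coe_mulLeft, mul_assoc] using this

/-- `F` vanishes on products beginning with `x c` and cannot distinguish `x c` from `s c` at the
end, so a final letter can be traded for a commutator. -/
theorem F_letter {c : ι} (y : R) :
    D.F (y * D.s c) = - D.F (D.x c * y - y * D.x c) := by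
  rw [map_sub, D.F_left, D.F_right, zero_sub, neg_neg]

/-- For minimal `c` the commutator of `x m` with the final `s c` contributes `2 (s m s c - s c s
m)`. The summand ending in `s m` is cancelled by the correction term in `Minus`, and what remains
again ends in `s c`. -/
theorem Plus.tail {A : Finset ι} {U : AddSubgroup R} {c : ι} (h : D.Plus A U)
    (hmin : ∀ m ∈ A, c ≤ m) : D.Minus (A.erase c) (tail D.s A U c) := by
  intro z hz m hm
  have hm' := Finset.mem_of_mem_erase hm
  rw [← der_apply]
  refine tail_induction _ (fun u hu w hw => ?_) z hz
  have e : der (D.x m) (D.s m) (u * w * D.s c) = (D.x m * u - u * D.x m) * w * D.s c +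
      u * (D.x m * w - w * D.x m) * D.s c + u * w * (D.x m * D.s c - D.s c * D.x m)
      + 2 * (u * w * D.s c * D.s m) := by
    rw [der_apply]; noncomm_ring
  rw [e, D.comm_of_le (hmin m hm')]
  have e2 : (D.x m * u - u * D.x m) * w * D.s c + u * (D.x m * w - w * D.x m) * D.s c +
      u * w * (2 * (D.s m * D.s c - D.s c * D.s m)) + 2 * (u * w * D.s c * D.s m) =
      (D.x m * u - u * D.x m) * w * D.s c + u * (D.x m * w - w * D.x m) * D.s c +
      u * (w * (2 * D.s m)) * D.s c := by noncomm_ring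
  rw [e2]
  exact add_mem (add_mem (mem_tail (h u hu m hm') hw)
    (mem_tail hu (comm_mem (D.comm_letter_mem hm') hw)))
    (mem_tail hu (mul_mem hw (mul_mem (ofNat_mem _ 2) (letter_mem hm'))))

/-- For maximal `c` the other `x m` commute with `s c`, so no correction is created at the end. The
correction already present is moved into the middle word. -/
theorem Minus.tail {A : Finset ι} {U : AddSubgroup R} {c : ι} (h : D.Minus A U)
    (hmax : ∀ m ∈ A, m ≤ c) : D.Plus (A.erase c) (tail D.s A U c) := by
  intro z hz m hm
  have hm' := Finset.mem_of_mem_erase hm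
  have hlt : m < c := lt_of_le_of_ne (hmax m hm') (Finset.ne_of_mem_erase hm)
  have e0 : ∀ z, D.x m * z - z * D.x m = der (D.x m) 0 z := fun z => by rw [der_apply]; simp
  rw [e0]
  refine tail_induction _ (fun u hu w hw => ?_) z hz
  have e : der (D.x m) 0 (u * w * D.s c) =
      (D.x m * u - u * D.x m + 2 * (u * D.s m)) * w * D.s c - u * (2 * (D.s m * w)) * D.s c +
      u * (D.x m * w - w * D.x m) * D.s c + u * w * (D.x m * D.s c - D.s c * D.x m) := by
    rw [der_apply]; noncomm_ring
  rw [e, D.comm_of_lt hlt, mul_zero, add_zero]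
  exact add_mem (sub_mem (mem_tail (h u hu m hm') hw)
    (mem_tail hu (mul_mem (ofNat_mem _ 2) (mul_mem (letter_mem hm') hw))))
    (mem_tail hu (comm_mem (D.comm_letter_mem hm') hw))

theorem tail_le_fil {A : Finset ι} {U : AddSubgroup R} {c : ι} {k : ℕ} :
    tail D.s A (U ⊓ D.fil k) c ≤ D.fil 0 := by
  rw [tail, AddSubgroup.closure_le]
  rintro _ ⟨u, hu, w, hw, rfl⟩
  exact D.fil_anti (Nat.zero_le _) (D.fil_mul_s c (D.fil_mul_words hu.2 hw))

/-- Strong induction on the alphabet, with an inner induction on the filtration. Under `Plus` the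
smallest letter is peeled off and the tails satisfy `Minus`; under `Minus` the largest letter is
peeled off and the tails satisfy `Plus`. To start each smaller case `F` must vanish on the tails,
which follows from `F_letter` and the vanishing one filtration step higher. -/
theorem van (A : Finset ι) :
    (∀ U ≤ D.fil 0, (∀ u ∈ U, D.F u = 0) → D.Plus A U → D.Van A U) ∧
    (∀ U ≤ D.fil 0, (∀ u ∈ U, D.F u = 0) → D.Minus A U → D.Van A U) := by
  induction A using Finset.strongInduction with
  | H A ih =>
  rcases A.eq_empty_or_nonempty with rfl | hA
  · have : ∀ U : AddSubgroup R, (∀ u ∈ U, D.F u = 0) → D.Van ∅ U := by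
      intro U hU u hu w hw
      have hw' : w ∈ (⊥ : Subring R) := by simpa [words] using hw
      obtain ⟨k, rfl⟩ := Subring.mem_bot.1 hw'
      rw [← Int.cast_comm, ← zsmul_eq_mul, map_zsmul, hU u hu, smul_zero]
    exact ⟨fun U _ hU _ => this U hU, fun U _ hU _ => this U hU⟩
  constructor
  · intro U hU0 hU hp
    let c := A.min' hA
    have hc : c ∈ A := A.min'_mem hA
    have hmin : ∀ m ∈ A, c ≤ m := fun m hm => A.min'_le m hm
    obtain ⟨ihp, ihm⟩ := ih _ (Finset.erase_ssubset hc)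
    refine van_of_fil hU0 fun k hk => van_of_tail (c := c) ?_ ?_
    · exact ihp _ (inf_le_left.trans hU0) (fun u hu => hU u hu.1)
        (fun u hu m hm => hp.inf k u hu m (Finset.mem_of_mem_erase hm))
    · refine ihm _ tail_le_fil (tail_map_eq_zero _ fun u hu w hw => ?_) ((hp.inf k).tail hmin)
      have e : D.x c * (u * w) - u * w * D.x c =
          (D.x c * u - u * D.x c) * w + u * (D.x c * w - w * D.x c) := by noncomm_ring
      -- For minimal `c` the element `x c` commutes with every letter, including `s c` itself.
      have e2 : D.x c * w - w * D.x c = 0 := by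
        have := comm_eq (x := D.x c) (y := 0) (fun l hl => ?_) hw
        · simpa using this
        · rcases (hmin l hl).lt_or_eq with h | h
          · rw [D.comm_of_lt h]; simp
          · rw [← h, D.comm_of_le le_rfl]; simp
      rw [F_letter, e, e2, mul_zero, add_zero, neg_eq_zero]
      have hf : D.x c * u - u * D.x c ∈ D.fil (k + 1) :=
        sub_mem (D.fil_x_mul c hu.2) (D.fil_mul_x c hu.2)
      exact hk _ ⟨hp u hu.1 c hc, hf⟩ w hw
  · intro U hU0 hU hp
    let c := A.max' hA
    have hc : c ∈ A := A.max'_mem hA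
    have hmax : ∀ m ∈ A, m ≤ c := fun m hm => A.le_max' m hm
    obtain ⟨ihp, ihm⟩ := ih _ (Finset.erase_ssubset hc)
    refine van_of_fil hU0 fun k hk => van_of_tail (c := c) ?_ ?_
    · exact ihm _ (inf_le_left.trans hU0) (fun u hu => hU u hu.1)
        (fun u hu m hm => hp.inf k u hu m (Finset.mem_of_mem_erase hm))
    · refine ihp _ tail_le_fil (tail_map_eq_zero _ fun u hu w hw => ?_) ((hp.inf k).tail hmax)
      -- For maximal `c` the commutators with `x c` and with `2 * s c` agree on all letters, hence
      -- on all words.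
      have e2 : D.x c * w - w * D.x c = 2 * D.s c * w - w * (2 * D.s c) :=
        comm_eq (fun l hl => by rw [D.comm_of_le (hmax l hl)]; noncomm_ring) hw
      have e : D.x c * (u * w) - u * w * D.x c =
          (D.x c * u - u * D.x c + 2 * (u * D.s c)) * w - (u * w * D.s c + u * w * D.s c) := by
        have : D.x c * (u * w) - u * w * D.x c =
          (D.x c * u - u * D.x c) * w + u * (D.x c * w - w * D.x c) := by noncomm_ring
        rw [this, e2]; noncomm_ring
      have h0 := hk _ ⟨hp u hu.1 c hc, Minus.mem_fil hu.2⟩ w hw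
      have h1 := F_letter (D := D) (c := c) (u * w)
      rw [e, map_sub, h0, zero_sub, neg_neg, map_add] at h1
      -- The equation has become `a = a + a`, so no division by two is needed.
      exact left_eq_add.1 h1

/-- The multiples of `1` satisfy `Plus` because they commute with everything. -/
theorem F_words_eq_zero [Fintype ι] (h1 : D.F 1 = 0) {w : R} (hw : w ∈ words D.s Finset.univ) :
    D.F w = 0 := by
  have h := (van (D := D) Finset.univ).1 (AddSubgroup.zmultiples 1)
    (AddSubgroup.zmultiples_le_of_mem D.one_mem_fil)
    (fun u hu => by
      obtain ⟨k, rfl⟩ := AddSubgroup.mem_zmultiples_iff.1 hu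
      rw [map_zsmul, h1, smul_zero])
    (fun u hu m _ => by
      obtain ⟨k, rfl⟩ := AddSubgroup.mem_zmultiples_iff.1 hu
      rw [mul_smul_comm, smul_mul_assoc, mul_one, one_mul, sub_self]
      exact zero_mem _)
  simpa using h 1 (AddSubgroup.mem_zmultiples 1) w hw

end Data

end Peel

end

/-! ### Brackets of the cut classes with the partial sums -/

noncomputable section

namespace Braid

open LCS

/-- The class of the pure braid in which the strand `i` and the last strand link once. -/
def lst (n i : ℕ) : E0 (PureBraidGroup (n + 2)) := lk (n + 2) i (n + 1)

/-- The sum of the classes `lst n i` for the first `m` strands. -/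
def part (n m : ℕ) : E0 (PureBraidGroup (n + 2)) := ∑ i ∈ Finset.range m, lst n i

theorem cut_eq {n m : ℕ} (hm : m ≤ n) :
    cut n m = ∑ i ∈ Finset.range m, ∑ j ∈ Finset.Ico m n, lk n i j := by
  have h : ∀ i j : ℕ, (if i < m ∧ m ≤ j then lk n i j else 0) =
      if i < m then (if m ≤ j then lk n i j else 0) else 0 := by
    intro i j
    split_ifs <;> first | rfl | omega
  rw [cut, Fintype.sum_prod_type,
    Fin.sum_univ_eq_sum_range (fun i => ∑ j : Fin n, if i < m ∧ m ≤ j then lk n i j else 0) n]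
  have h2 : ∀ i ∈ Finset.range n, (∑ j : Fin n, if i < m ∧ m ≤ (j : ℕ) then lk n i j else 0) =
      if i < m then ∑ j ∈ Finset.Ico m n, lk n i j else 0 := by
    intro i _
    rw [Fin.sum_univ_eq_sum_range (fun j => if i < m ∧ m ≤ j then lk n i j else 0) n]
    simp only [h]
    split_ifs with hi
    · rw [← Finset.sum_filter]
      refine Finset.sum_congr (Finset.ext fun x => ?_) fun _ _ => rfl
      simp only [Finset.mem_filter, Finset.mem_range, Finset.mem_Ico]
      omega
    · simp
  rw [Finset.sum_congr rfl h2, ← Finset.sum_filter]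
  refine Finset.sum_congr (Finset.ext fun x => ?_) fun _ _ => rfl
  simp only [Finset.mem_filter, Finset.mem_range]
  omega

theorem cut_eq_add {n m : ℕ} (hm : m ≤ n + 1) :
    cut (n + 2) m =
      ∑ i ∈ Finset.range m, ∑ j ∈ Finset.Ico m (n + 1), lk (n + 2) i j + part n m := by
  rw [cut_eq (by omega), part, ← Finset.sum_add_distrib]
  exact Finset.sum_congr rfl fun i _ => Finset.sum_Ico_succ_top hm _

theorem cut_last (n : ℕ) : cut (n + 2) (n + 1) = part n (n + 1) := by
  rw [cut_eq_add le_rfl]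
  simp

/-- The nonzero cases are the three-strand relation for `i`, `j` and the last strand; disjoint pairs
give zero. -/
theorem lk_lie_lst {n i j l : ℕ} (hi : i < n + 1) (hj : j < n + 1) (hl : l < n + 1) (hij : i ≠ j) :
    ⁅lk (n + 2) i j, lst n l⁆ =
      ⁅lst n l, (if l = i then lst n j else 0) + (if l = j then lst n i else 0)⁆ := by
  have key : ∀ i j : ℕ, i < n + 1 → j < n + 1 → i ≠ j →
      ⁅lk (n + 2) i j, lst n i⁆ = ⁅lst n i, lst n j⁆ := by
    intro i j hi hj hij
    have h := lk_lie_add (n := n + 2) (i := ⟨i, by omega⟩) (j := ⟨n + 1, by omega⟩)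
      (k := ⟨j, by omega⟩) (by simp [Fin.ext_iff]; omega) (by simp [Fin.ext_iff]; omega)
      (by simp [Fin.ext_iff]; omega)
    simp only [lie_add] at h
    rw [lk_symm (n + 2) (n + 1) j] at h
    rw [← lie_skew, neg_eq_iff_add_eq_zero]
    exact h
  by_cases h1 : l = i
  · subst h1
    rw [if_pos rfl, if_neg hij, add_zero, key l j hi hj hij]
  · by_cases h2 : l = j
    · subst h2
      rw [if_pos rfl, if_neg h1, zero_add, lk_symm, key l i hj hi hij.symm]
    · rw [if_neg h1, if_neg h2, add_zero, lie_zero]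
      exact lk_lie_lk_of_ne (i := (⟨i, by omega⟩ : Fin (n + 2))) (j := ⟨j, by omega⟩)
        (k := ⟨l, by omega⟩) (l := ⟨n + 1, by omega⟩)
        (by simp [Fin.ext_iff]; omega) (by simp [Fin.ext_iff]; omega)
        (by simp [Fin.ext_iff]; omega) (by simp [Fin.ext_iff]; omega)
        (by simp [Fin.ext_iff]; omega) (by simp [Fin.ext_iff]; omega)

/-- For `l < m` the pairs across the cut contribute the bracket of `lst n l` with the sum behind the
cut, and `part n m` adds a further copy of the bracket with the sum before it, whence the factor
two. For `l ≥ m` the two contributions cancel. -/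
theorem cut_lie_lst {n m l : ℕ} (hm : m ≤ n + 1) (hl : l < n + 1) :
    ⁅cut (n + 2) m, lst n l⁆ =
      if l < m then ⁅lst n l, part n (n + 1)⁆ - 2 • ⁅lst n l, part n m⁆ else 0 := by
  have hs : part n (n + 1) = part n m + ∑ j ∈ Finset.Ico m (n + 1), lst n j :=
    (Finset.sum_range_add_sum_Ico _ hm).symm
  have e : ∀ i ∈ Finset.range m, ⁅∑ j ∈ Finset.Ico m (n + 1), lk (n + 2) i j, lst n l⁆ =
      ⁅lst n l, ∑ j ∈ Finset.Ico m (n + 1), ((if l = i then lst n j else 0) +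
        (if l = j then lst n i else 0))⁆ := by
    intro i hi
    rw [sum_lie, lie_sum]
    refine Finset.sum_congr rfl fun j hj => ?_
    rw [Finset.mem_range] at hi
    rw [Finset.mem_Ico] at hj
    exact lk_lie_lst (by omega) hj.2 hl (by omega)
  rw [cut_eq_add hm, add_lie, sum_lie, Finset.sum_congr rfl e, ← lie_sum]
  simp only [Finset.sum_add_distrib]
  rw [Finset.sum_comm]
  simp only [Finset.sum_ite_eq, Finset.mem_range, Finset.mem_Ico]
  rw [← lie_skew (part n m), lie_add]
  by_cases h : l < m
  · have h' : ¬ (m ≤ l ∧ l < n + 1) := by omega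
    simp only [h, h', if_true, if_false, Finset.sum_const_zero, lie_zero, add_zero]
    rw [hs, lie_add]
    abel
  · have h' : m ≤ l ∧ l < n + 1 := by omega
    simp only [h, h', and_self, if_true, if_false, Finset.sum_const_zero, lie_zero, zero_add]
    rw [part, add_neg_cancel]

theorem cut_lie_part_of_le {n m l : ℕ} (hm : m ≤ n + 1) (hl : l ≤ m) :
    ⁅cut (n + 2) m, part n l⁆ = ⁅part n l, part n (n + 1)⁆ - 2 • ⁅part n l, part n m⁆ := by
  rw [part, lie_sum, sum_lie, sum_lie, Finset.smul_sum,
    ← Finset.sum_sub_distrib]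
  refine Finset.sum_congr rfl fun i hi => ?_
  rw [Finset.mem_range] at hi
  rw [cut_lie_lst hm (by omega), if_pos (by omega)]

theorem cut_lie_part_of_ge {n m l : ℕ} (hl : l ≤ n + 1) (hm : m ≤ l) :
    ⁅cut (n + 2) m, part n l⁆ = ⁅part n m, part n (n + 1)⁆ := by
  have h : part n l = part n m + ∑ j ∈ Finset.Ico m l, lst n j :=
    (Finset.sum_range_add_sum_Ico _ hm).symm
  rw [h, lie_add, cut_lie_part_of_le (hm.trans hl) le_rfl, lie_self, lie_sum,
    Finset.sum_eq_zero, smul_zero, sub_zero, add_zero]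
  intro j hj
  rw [Finset.mem_Ico] at hj
  rw [cut_lie_lst (by omega) (by omega), if_neg (by omega)]

end Braid

end

/-! ### Truncation by degree and spans of iterated brackets -/

noncomputable section

namespace LCS

variable {G : Type*} [Group G]

/-- The projection to the sum of the summands with index less than `d`. -/
def E0.trunc (d : ℕ) : E0 G →+ E0 G := E0.lift fun k => if k < d then E0.of k else 0

theorem E0.trunc_mk_of_lt {d k : ℕ} (h : k < d) {g : G} (hg : g ∈ Gam G k) :
    E0.trunc d (E0.mk k g hg) = E0.mk k g hg := by
  rw [E0.trunc, E0.mk, E0.lift_of, if_pos h]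

theorem E0.trunc_mk_of_le {d k : ℕ} (h : d ≤ k) {g : G} (hg : g ∈ Gam G k) :
    E0.trunc d (E0.mk k g hg) = 0 := by
  rw [E0.trunc, E0.mk, E0.lift_of, if_neg (by omega), AddMonoidHom.zero_apply]

theorem E0.exists_trunc (u : E0 G) : ∃ d, ∀ e, d ≤ e → E0.trunc e u = u := by
  induction u using E0.induction with
  | h0 => exact ⟨0, fun _ _ => map_zero _⟩
  | hm k x hx => exact ⟨k + 1, fun e he => E0.trunc_mk_of_lt (by omega) hx⟩
  | ha u v hu hv =>
    obtain ⟨d, hd⟩ := hu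
    obtain ⟨d', hd'⟩ := hv
    exact ⟨max d d', fun e he => by
      rw [map_add, hd e (by omega), hd' e (by omega)]⟩

theorem E0.trunc_lie (d : ℕ) (v u : E0 G) :
    E0.trunc (d + 1) ⁅v, u⁆ = E0.trunc (d + 1) ⁅v, E0.trunc d u⁆ := by
  induction u using E0.induction with
  | h0 => simp
  | ha u w hu hw => simp only [lie_add, map_add, hu, hw]
  | hm k x hx =>
    rcases lt_or_ge k d with h | h
    · rw [E0.trunc_mk_of_lt h]
    · rw [E0.trunc_mk_of_le h, lie_zero, map_zero]
      induction v using E0.induction with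
      | h0 => simp
      | ha u w hu hw => simp only [add_lie, map_add, hu, hw, add_zero]
      | hm l y hy => rw [E0.mk_lie_mk, E0.trunc_mk_of_le (by omega)]

/-- A class of weight one raises the index by exactly one. For a general element only the weaker
`E0.trunc_lie` is available. -/
theorem E0.trunc_cl_lie (d : ℕ) (g : G) (u : E0 G) :
    E0.trunc (d + 1) ⁅cl g, u⁆ = ⁅cl g, E0.trunc d u⁆ := by
  induction u using E0.induction with
  | h0 => simp
  | ha u w hu hw => simp only [lie_add, map_add, hu, hw]
  | hm k x hx =>
    rcases lt_or_ge k d with h | h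
    · rw [E0.trunc_mk_of_lt h, cl, E0.mk_lie_mk, E0.trunc_mk_of_lt (by omega)]
    · rw [E0.trunc_mk_of_le h, lie_zero, cl, E0.mk_lie_mk, E0.trunc_mk_of_le (by omega)]

theorem E0.trunc_zero (u : E0 G) : E0.trunc 0 u = 0 := by
  induction u using E0.induction with
  | h0 => simp
  | ha u w hu hw => simp only [map_add, hu, hw, add_zero]
  | hm k x hx => exact E0.trunc_mk_of_le (Nat.zero_le k) hx

end LCS

namespace LieSpan

variable {E ι : Type*} [LieRing E]

/-- The smallest additive subgroup which contains `z` and is stable under the brackets with the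
elements `s i`. -/
def adSpan (s : ι → E) (z : E) : AddSubgroup E :=
  sInf {T | z ∈ T ∧ ∀ i, ∀ u ∈ T, ⁅s i, u⁆ ∈ T}

variable {s : ι → E} {z : E}

theorem mem_adSpan : z ∈ adSpan s z := AddSubgroup.mem_sInf.2 fun _ hT => hT.1

theorem lie_mem_adSpan (i : ι) {u : E} (hu : u ∈ adSpan s z) : ⁅s i, u⁆ ∈ adSpan s z :=
  AddSubgroup.mem_sInf.2 fun T hT => hT.2 i u (AddSubgroup.mem_sInf.1 hu T hT)

theorem adSpan_le {T : AddSubgroup E} (hz : z ∈ T) (h : ∀ i, ∀ u ∈ T, ⁅s i, u⁆ ∈ T) :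
    adSpan s z ≤ T := sInf_le ⟨hz, h⟩

/-- The elements whose brackets preserve an additive subgroup. -/
def stab (T : AddSubgroup E) : LieSubalgebra ℤ E where
  carrier := {u | ∀ t ∈ T, ⁅u, t⁆ ∈ T}
  add_mem' := fun {u v} hu hv t ht => by rw [add_lie]; exact add_mem (hu t ht) (hv t ht)
  zero_mem' := fun t _ => by rw [zero_lie]; exact zero_mem T
  smul_mem' := fun k u hu t ht => by rw [zsmul_lie]; exact zsmul_mem (hu t ht) k
  lie_mem' := fun {u v} hu hv t ht => by
    rw [lie_lie]; exact sub_mem (hu _ (hv t ht)) (hv _ (hu t ht))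

theorem mem_stab_letter (i : ι) : s i ∈ stab (adSpan s z) := fun _ => lie_mem_adSpan i

/-- The stabilizer is a Lie subalgebra containing the letters. Once it contains `z` it contains the
whole span, which is then closed under brackets. -/
theorem adSpan_le_stab (h : z ∈ stab (adSpan s z)) :
    adSpan s z ≤ (stab (adSpan s z)).toAddSubgroup :=
  adSpan_le h fun i _ hu => (stab (adSpan s z)).lie_mem (mem_stab_letter i) hu

end LieSpan

end

/-! ### Comparison of two spans of iterated brackets -/

noncomputable section

namespace LieSpan

open LCS

section Abelianization

variable {E : Type*} [LieRing E] (K : AddSubgroup E)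

/-- The additive subgroup generated by the brackets of elements of `K`. -/
def derived : AddSubgroup K := AddSubgroup.closure {v | ∃ a ∈ K, ∃ b ∈ K, (v : E) = ⁅a, b⁆}

/-- The quotient of `K` by the brackets. -/
abbrev Ab : Type _ := K ⧸ derived K

variable {K}

/-- The class of an element of `K`. -/
def Ab.mk (k : E) (hk : k ∈ K) : Ab K := QuotientAddGroup.mk ⟨k, hk⟩

theorem Ab.mk_add {k l : E} (hk : k ∈ K) (hl : l ∈ K) :
    Ab.mk (k + l) (add_mem hk hl) = Ab.mk k hk + Ab.mk l hl := rfl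

theorem Ab.mk_sub {k l : E} (hk : k ∈ K) (hl : l ∈ K) :
    Ab.mk (k - l) (sub_mem hk hl) = Ab.mk k hk - Ab.mk l hl := rfl

theorem Ab.mk_congr {k l : E} (hk : k ∈ K) (h : k = l) : Ab.mk k hk = Ab.mk l (h ▸ hk) := by
  subst h; rfl

theorem Ab.exists_mk (v : Ab K) : ∃ (k : E) (hk : k ∈ K), v = Ab.mk k hk := by
  obtain ⟨⟨k, hk⟩, rfl⟩ := QuotientAddGroup.mk_surjective v
  exact ⟨k, hk, rfl⟩

theorem Ab.mk_lie {a b : E} (ha : a ∈ K) (hb : b ∈ K) (h : ⁅a, b⁆ ∈ K) : Ab.mk ⁅a, b⁆ h = 0 :=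
  (QuotientAddGroup.eq_zero_iff _).2 (AddSubgroup.subset_closure ⟨a, ha, b, hb, rfl⟩)

/-- The additive map on the quotient of `K` by the brackets induced by an additive map which
vanishes on brackets. -/
def Ab.lift {Q : Type*} [AddCommGroup Q] (f : E →+ Q)
    (hf : ∀ a ∈ K, ∀ b ∈ K, f ⁅a, b⁆ = 0) : Ab K →+ Q :=
  QuotientAddGroup.lift _ (f.comp K.subtype) (by
    rw [derived, AddSubgroup.closure_le]
    rintro v ⟨a, ha, b, hb, h⟩
    change f v = 0
    rw [h, hf a ha b hb])

/-- The bracket with an element which preserves `K`. -/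
def adOn (u : E) (hu : u ∈ stab K) : K →+ K where
  toFun k := ⟨⁅u, k.1⁆, hu k.1 k.2⟩
  map_zero' := Subtype.ext (lie_zero u)
  map_add' k l := Subtype.ext (lie_add u k.1 l.1)

/-- The endomorphism of the quotient of `K` by the brackets induced by the bracket with an element
which preserves `K`. -/
def adAb (hK : K ≤ (stab K).toAddSubgroup) (u : E) (hu : u ∈ stab K) : AddMonoid.End (Ab K) :=
  QuotientAddGroup.map _ _ (adOn u hu) (by
    rw [derived, AddSubgroup.closure_le]
    rintro v ⟨a, ha, b, hb, h⟩
    have e1 : ⁅⁅u, a⁆, b⁆ ∈ K := hK (hu a ha) b hb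
    have e2 : ⁅a, ⁅u, b⁆⁆ ∈ K := hK ha _ (hu b hb)
    have e : adOn u hu v = ⟨_, e1⟩ + ⟨_, e2⟩ := by
      apply Subtype.ext
      change ⁅u, v.1⁆ = ⁅⁅u, a⁆, b⁆ + ⁅a, ⁅u, b⁆⁆
      rw [h, leibniz_lie]
    change adOn u hu v ∈ derived K
    rw [e]
    exact add_mem (AddSubgroup.subset_closure ⟨_, hu a ha, b, hb, rfl⟩)
      (AddSubgroup.subset_closure ⟨a, ha, _, hu b hb, rfl⟩))

theorem adAb_mk (hK : K ≤ (stab K).toAddSubgroup) {u : E} (hu : u ∈ stab K) {k : E} (hk : k ∈ K) :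
    adAb hK u hu (Ab.mk k hk) = Ab.mk ⁅u, k⁆ (hu k hk) := rfl

theorem adAb_comm_mk (hK : K ≤ (stab K).toAddSubgroup) {u v : E} (hu : u ∈ stab K)
    (hv : v ∈ stab K) {k : E} (hk : k ∈ K) :
    (adAb hK u hu * adAb hK v hv - adAb hK v hv * adAb hK u hu) (Ab.mk k hk) =
      Ab.mk ⁅⁅u, v⁆, k⁆ ((stab K).lie_mem hu hv k hk) := by
  rw [Ab.mk_congr _ (lie_lie u v k)]
  rfl

end Abelianization

section Main

variable {G : Type*} [Group G] {N : ℕ} {s x : Fin (N + 1) → E0 G}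

/-- The bracket of `x m` with a letter is a combination of brackets of letters, and with the last
letter it already lies in the span; the Leibniz rule does the rest. -/
theorem stab_of_relations
    (hle : ∀ {l m}, l ≤ m → ⁅x m, s l⁆ = ⁅s l, s (Fin.last N)⁆ - 2 • ⁅s l, s m⁆)
    (hge : ∀ {l m}, m ≤ l → ⁅x m, s l⁆ = ⁅s m, s (Fin.last N)⁆) (m : Fin (N + 1)) :
    x m ∈ stab (adSpan s (s (Fin.last N))) := by
  have h : adSpan s (s (Fin.last N)) ≤ adSpan s (s (Fin.last N)) ⊓
      (adSpan s (s (Fin.last N))).comap (AddMonoidHom.mk' (fun u => ⁅x m, u⁆) (lie_add (x m))) := by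
    refine adSpan_le ⟨mem_adSpan, ?_⟩ ?_
    · change ⁅x m, s (Fin.last N)⁆ ∈ adSpan s (s (Fin.last N))
      rw [hge (Fin.le_last m)]
      exact lie_mem_adSpan m mem_adSpan
    · rintro l u ⟨hu, hxu⟩
      refine ⟨lie_mem_adSpan l hu, ?_⟩
      change ⁅x m, ⁅s l, u⁆⁆ ∈ adSpan s (s (Fin.last N))
      rw [leibniz_lie]
      refine add_mem ?_ (lie_mem_adSpan l hxu)
      have hs : ∀ i, s i ∈ stab (adSpan s (s (Fin.last N))) := mem_stab_letter
      have hxs : ⁅x m, s l⁆ ∈ stab (adSpan s (s (Fin.last N))) := by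
        rcases le_total l m with hlm | hlm
        · rw [hle hlm]
          exact sub_mem (LieSubalgebra.lie_mem _ (hs _) (hs _))
            (nsmul_mem (LieSubalgebra.lie_mem _ (hs _) (hs _)) 2)
        · rw [hge hlm]
          exact LieSubalgebra.lie_mem _ (hs _) (hs _)
      exact hxs u hu
  exact fun u hu => (h hu).2

/-- All `x m` have weight one, so the span of their iterated brackets is graded. -/
theorem trunc_mem_adSpan (hx : ∀ m, ∃ g, x m = cl g) (l : Fin (N + 1)) {u : E0 G}
    (hu : u ∈ adSpan x (x l)) (d : ℕ) : E0.trunc d u ∈ adSpan x (x l) := by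
  let T : AddSubgroup (E0 G) := ⨅ d, (adSpan x (x l)).comap (E0.trunc d)
  have h : adSpan x (x l) ≤ T := by
    refine adSpan_le ?_ ?_
    · refine AddSubgroup.mem_iInf.2 fun d => ?_
      change E0.trunc d (x l) ∈ adSpan x (x l)
      cases d with
      | zero => rw [E0.trunc_zero]; exact zero_mem _
      | succ d =>
        obtain ⟨g, hg⟩ := hx l
        rw [hg, cl, E0.trunc_mk_of_lt (Nat.succ_pos d)]
        exact mem_adSpan
    · intro m u hu
      refine AddSubgroup.mem_iInf.2 fun d => ?_
      change E0.trunc d ⁅x m, u⁆ ∈ adSpan x (x l)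
      cases d with
      | zero => rw [E0.trunc_zero]; exact zero_mem _
      | succ d =>
        obtain ⟨g, hg⟩ := hx m
        rw [hg, E0.trunc_cl_lie, ← hg]
        exact lie_mem_adSpan m (AddSubgroup.mem_iInf.1 hu d)
  exact AddSubgroup.mem_iInf.1 (h hu) d

/-- The image in the quotient by the brackets of the elements without components of index less than
`j`. -/
def Ab.high (K : AddSubgroup (E0 G)) (j : ℕ) : AddSubgroup (Ab K) :=
  ((E0.trunc j).comp K.subtype).ker.map (QuotientAddGroup.mk' (derived K))

theorem Ab.mem_high {K : AddSubgroup (E0 G)} {j : ℕ} {v : Ab K} :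
    v ∈ Ab.high K j ↔ ∃ k, ∃ hk : k ∈ K, E0.trunc j k = 0 ∧ v = Ab.mk k hk := by
  constructor
  · rintro ⟨⟨k, hk⟩, h, rfl⟩
    exact ⟨k, hk, h, rfl⟩
  · rintro ⟨k, hk, h, rfl⟩
    exact ⟨⟨k, hk⟩, h, rfl⟩

theorem trunc_lie_eq_zero {j : ℕ} (v : E0 G) {u : E0 G} (h : E0.trunc j u = 0) :
    E0.trunc (j + 1) ⁅v, u⁆ = 0 := by
  rw [E0.trunc_lie, h, lie_zero, map_zero]

theorem trunc_eq_zero_of_le {i j : ℕ} (hij : i ≤ j) {u : E0 G} (h : E0.trunc j u = 0) :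
    E0.trunc i u = 0 := by
  have e : E0.trunc i u = E0.trunc i (E0.trunc j u) := by
    clear h
    induction u using E0.induction with
    | h0 => simp
    | ha u w hu hw => simp only [map_add, hu, hw]
    | hm k x hx =>
      rcases lt_or_ge k j with h | h
      · rw [E0.trunc_mk_of_lt h]
      · rw [E0.trunc_mk_of_le h, E0.trunc_mk_of_le (hij.trans h), map_zero]
  rw [e, h, map_zero]

/-- The endomorphisms which raise the index of components by at least `k`. -/
def raise (K : AddSubgroup (E0 G)) (k : ℕ) : AddSubgroup (AddMonoid.End (Ab K)) where
  carrier := {f | ∀ j, ∀ v ∈ Ab.high K j, f v ∈ Ab.high K (j + k)}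
  add_mem' := fun hf hg j v hv => add_mem (hf j v hv) (hg j v hv)
  zero_mem' := fun _ _ _ => zero_mem _
  neg_mem' := fun hf j v hv => neg_mem (hf j v hv)

theorem raise_anti (K : AddSubgroup (E0 G)) : Antitone (raise K) := by
  intro k l hkl f hf j v hv
  obtain ⟨u, hu, h, e⟩ := Ab.mem_high.1 (hf j v hv)
  exact Ab.mem_high.2 ⟨u, hu, trunc_eq_zero_of_le (by omega) h, e⟩

theorem mul_mem_raise {K : AddSubgroup (E0 G)} {k l : ℕ} {f g : AddMonoid.End (Ab K)}
    (hf : f ∈ raise K k) (hg : g ∈ raise K l) : f * g ∈ raise K (k + l) := by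
  intro j v hv
  have := hf _ _ (hg j v hv)
  rwa [add_assoc, add_comm l k] at this

theorem adAb_mem_raise {K : AddSubgroup (E0 G)} (hK : K ≤ (stab K).toAddSubgroup) {u : E0 G}
    (hu : u ∈ stab K) : adAb hK u hu ∈ raise K 1 := by
  intro j v hv
  obtain ⟨k, hk, h, rfl⟩ := Ab.mem_high.1 hv
  rw [adAb_mk]
  exact Ab.mem_high.2 ⟨_, _, trunc_lie_eq_zero u h, rfl⟩

/-- Induction on the degree. If `K` lies in `I` up to degree `d`, then brackets of elements of `K`
lie in `J`, that is, in `I` up to degree `d + 1`. The quotient by `J` therefore factors through `K`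
modulo brackets, where the adjoint actions satisfy the relations of `Peel.Data`. -/
theorem le_sup_ker_trunc
    (hle : ∀ {l m}, l ≤ m → ⁅x m, s l⁆ = ⁅s l, s (Fin.last N)⁆ - 2 • ⁅s l, s m⁆)
    (hge : ∀ {l m}, m ≤ l → ⁅x m, s l⁆ = ⁅s m, s (Fin.last N)⁆)
    (hlast : x (Fin.last N) = s (Fin.last N)) (d : ℕ) :
    adSpan s (s (Fin.last N)) ≤ adSpan x (s (Fin.last N)) ⊔ (E0.trunc d).ker := by
  set z := s (Fin.last N) with hz
  set K := adSpan s z with hKdef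
  set I := adSpan x z with hIdef
  have hKs : K ≤ (stab K).toAddSubgroup := adSpan_le_stab (mem_stab_letter (Fin.last N))
  have hIs : I ≤ (stab I).toAddSubgroup := adSpan_le_stab (by
    rw [← hlast]; exact mem_stab_letter (Fin.last N))
  have hxK : ∀ m, x m ∈ stab K := stab_of_relations hle hge
  have hsK : ∀ m, s m ∈ stab K := mem_stab_letter
  induction d with
  | zero => exact fun u _ => AddSubgroup.mem_sup_right (E0.trunc_zero u)
  | succ d ih =>
    set J := I ⊔ (E0.trunc (d + 1) : E0 G →+ E0 G).ker with hJ
    -- A bracket raises the degree, so an error beyond `d` becomes an error beyond `d + 1`.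
    have hI : ∀ v, v ∈ stab I → ∀ k ∈ K, ⁅v, k⁆ ∈ J := by
      intro v hv k hk
      obtain ⟨i, hi, e, he, rfl⟩ := AddSubgroup.mem_sup.1 (ih hk)
      rw [lie_add]
      exact add_mem (AddSubgroup.mem_sup_left (hv i hi))
        (AddSubgroup.mem_sup_right (trunc_lie_eq_zero v he))
    have hKK : ∀ a ∈ K, ∀ b ∈ K, ⁅a, b⁆ ∈ J := by
      intro a ha b hb
      obtain ⟨i, hi, e, he, rfl⟩ := AddSubgroup.mem_sup.1 (ih ha)
      rw [add_lie]
      refine add_mem (hI i (hIs hi) b hb) (AddSubgroup.mem_sup_right ?_)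
      rw [← lie_skew]
      exact neg_mem (trunc_lie_eq_zero b he)
    let φ : Ab K →+ E0 G ⧸ J := Ab.lift (QuotientAddGroup.mk' J)
      (fun a ha b hb => (QuotientAddGroup.eq_zero_iff _).2 (hKK a ha b hb))
    have hφ : ∀ k, ∀ hk : k ∈ K, φ (Ab.mk k hk) = 0 ↔ k ∈ J :=
      fun k hk => QuotientAddGroup.eq_zero_iff _
    have hzK : z ∈ K := mem_adSpan
    -- The ring is that of endomorphisms of `K` modulo brackets, and `F` applies an endomorphism to
    -- the class of `z` and reduces modulo `J`. Left factors `x m` are invisible because they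
    -- preserve `I`; right factors `x m` and `s m` agree on `z`.
    let D : Peel.Data (AddMonoid.End (Ab K)) (E0 G ⧸ J) (Fin (N + 1)) :=
      { s := fun l => adAb hKs (s l) (hsK l)
        x := fun m => adAb hKs (x m) (hxK m)
        F := φ.comp (AddMonoidHom.eval (Ab.mk z hzK))
        fil := raise K
        top := d + 1
        comm_add := by
          intro l m hlm
          refine DFunLike.ext _ _ fun v => ?_
          obtain ⟨k, hk, rfl⟩ := Ab.exists_mk v
          change _ = (adAb hKs (s m) (hsK m) * adAb hKs (s l) (hsK l) -
              adAb hKs (s l) (hsK l) * adAb hKs (s m) (hsK m)) (Ab.mk k hk) +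
            (adAb hKs (s m) (hsK m) * adAb hKs (s l) (hsK l) -
              adAb hKs (s l) (hsK l) * adAb hKs (s m) (hsK m)) (Ab.mk k hk)
          rw [adAb_comm_mk, adAb_comm_mk, ← Ab.mk_add, ← sub_eq_zero, ← Ab.mk_sub]
          -- The discrepancy is the action of `⁅s l, z⁆`, an element of `K`, and this is zero modulo
          -- brackets.
          have e2 : ⁅⁅x m, s l⁆, k⁆ - (⁅⁅s m, s l⁆, k⁆ + ⁅⁅s m, s l⁆, k⁆) = ⁅⁅s l, z⁆, k⁆ := by
            rw [hle hlm, ← lie_skew (s m) (s l), sub_lie, two_smul, add_lie, neg_lie]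
            abel
          rw [Ab.mk_congr _ e2]
          exact Ab.mk_lie (lie_mem_adSpan l mem_adSpan) hk _
        comm_of_lt := by
          intro l m hlm
          refine DFunLike.ext _ _ fun v => ?_
          obtain ⟨k, hk, rfl⟩ := Ab.exists_mk v
          rw [adAb_comm_mk, Ab.mk_congr _ (congrArg (⁅·, k⁆) (hge hlm.le))]
          exact Ab.mk_lie (lie_mem_adSpan m mem_adSpan) hk _
        F_left := by
          intro m f
          obtain ⟨k, hk, e⟩ := Ab.exists_mk (f (Ab.mk z hzK))
          change φ (adAb hKs (x m) (hxK m) (f (Ab.mk z hzK))) = 0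
          rw [e, adAb_mk, hφ]
          exact hI _ (mem_stab_letter m) k hk
        F_right := by
          intro m f
          change φ (f (Ab.mk ⁅x m, z⁆ _)) = φ (f (Ab.mk ⁅s m, z⁆ _))
          rw [Ab.mk_congr _ (hge (Fin.le_last m))]
        fil_mul_s := fun {_ _} l hu => mul_mem_raise hu (adAb_mem_raise hKs (hsK l))
        fil_mul_x := fun {_ _} l hu => mul_mem_raise hu (adAb_mem_raise hKs (hxK l))
        fil_x_mul := fun {_ _} l hu => by
          rw [add_comm]; exact mul_mem_raise (adAb_mem_raise hKs (hxK l)) hu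
        fil_anti := raise_anti K
        one_mem_fil := fun _ _ hv => hv
        F_fil := by
          intro f hf
          obtain ⟨k, hk, h, e⟩ := Ab.mem_high.1 (hf 0 (Ab.mk z hzK)
            (Ab.mem_high.2 ⟨z, hzK, E0.trunc_zero z, rfl⟩))
          change φ (f (Ab.mk z hzK)) = 0
          rw [e, hφ]
          rw [zero_add] at h
          exact AddSubgroup.mem_sup_right h }
    have hD1 : D.F 1 = 0 := (hφ z hzK).2 (AddSubgroup.mem_sup_left mem_adSpan)
    -- The elements of `K` whose class is a word in the `s l` applied to the class of `z`; these
    -- turn out to be all of `K`.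
    let T : AddSubgroup (E0 G) :=
      (((Peel.words D.s Finset.univ).toAddSubgroup.map
        (AddMonoidHom.eval (Ab.mk z hzK))).comap (QuotientAddGroup.mk' (derived K))).map K.subtype
    have hT : ∀ k, k ∈ T ↔ ∃ hk : k ∈ K, ∃ w ∈ Peel.words D.s Finset.univ,
        w (Ab.mk z hzK) = Ab.mk k hk := by
      intro k
      constructor
      · rintro ⟨⟨k, hk⟩, ⟨w, hw, e⟩, rfl⟩
        exact ⟨hk, w, hw, e⟩
      · rintro ⟨hk, w, hw, e⟩
        exact ⟨⟨k, hk⟩, ⟨w, hw, e⟩, rfl⟩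
    have hKT : K ≤ T := by
      refine adSpan_le ((hT z).2 ⟨hzK, 1, one_mem _, rfl⟩) fun l u hu => ?_
      obtain ⟨hk, w, hw, e⟩ := (hT u).1 hu
      refine (hT _).2 ⟨lie_mem_adSpan l hk, D.s l * w,
        mul_mem (Peel.letter_mem (Finset.mem_univ l)) hw, ?_⟩
      change adAb hKs (s l) (hsK l) (w (Ab.mk z hzK)) = _
      rw [e]
      rfl
    intro k hk
    obtain ⟨_, w, hw, e⟩ := (hT k).1 (hKT hk)
    rw [← hφ k hk, ← e]
    exact Peel.Data.F_words_eq_zero hD1 hw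

/-- Two families of elements with these commutator relations span the same additive subgroup by
iterated brackets with their common last element. -/
theorem adSpan_eq (hx : ∀ m, ∃ g, x m = cl g)
    (hle : ∀ {l m}, l ≤ m → ⁅x m, s l⁆ = ⁅s l, s (Fin.last N)⁆ - 2 • ⁅s l, s m⁆)
    (hge : ∀ {l m}, m ≤ l → ⁅x m, s l⁆ = ⁅s m, s (Fin.last N)⁆)
    (hlast : x (Fin.last N) = s (Fin.last N)) :
    adSpan x (s (Fin.last N)) = adSpan s (s (Fin.last N)) := by
  refine le_antisymm (adSpan_le mem_adSpan fun m u hu => stab_of_relations hle hge m u hu) ?_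
  intro u hu
  obtain ⟨d, hd⟩ := E0.exists_trunc u
  -- With `d` beyond all components of `u`, truncation removes the error term and leaves `I` stable.
  obtain ⟨i, hi, e, he, h⟩ := AddSubgroup.mem_sup.1 (le_sup_ker_trunc hle hge hlast d hu)
  have h2 := hd d le_rfl
  rw [← h, map_add, show E0.trunc d e = 0 from he, add_zero] at h2
  rw [← h, ← h2]
  rw [← hlast] at hi ⊢
  exact trunc_mem_adSpan hx _ hi d

end Main

end LieSpan

end

/-! ### Strictness, finite generation and the Hopfian property -/

noncomputable section

namespace LCS

variable {G H : Type*} [Group G] [Group H]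

theorem E0.mk_eq_zero_iff {k : ℕ} {x : G} (hx : x ∈ Gam G k) :
    E0.mk k x hx = 0 ↔ x ∈ Gam G (k + 1) := by
  have hi : Function.Injective (E0.of k : Additive (Quo G k) →+ E0 G) := DirectSum.of_injective k
  rw [E0.mk, map_eq_zero_iff _ hi]
  exact (QuotientGroup.eq_one_iff _).trans Subgroup.mem_subgroupOf

/-- The hypothesis is strictness of the filtrations, which amounts to injectivity on each summand.
-/
theorem E0.map_injective (f : G →* H)
    (h : ∀ k x, x ∈ Gam G k → f x ∈ Gam H (k + 1) → x ∈ Gam G (k + 1)) :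
    Function.Injective (E0.map f) := by
  have e : E0.addMap f = DirectSum.map fun k => MonoidHom.toAdditive (quoMap f k) := by
    refine DirectSum.addHom_ext fun k y => ?_
    exact (E0.lift_of _ k y).trans
      (DirectSum.map_of (fun k => MonoidHom.toAdditive (quoMap f k)) k y).symm
  have h1 : Function.Injective (E0.addMap f) := by
    rw [e]
    refine (DirectSum.map_injective _).2 fun k => ?_
    refine (injective_iff_map_eq_one (quoMap f k)).2 fun a ha => ?_
    obtain ⟨x, hx, rfl⟩ := exists_cls a
    have h2 : cls k (f x) (map_mem f hx) = 1 := ha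
    refine cls_eq_one hx (h k x hx ?_)
    exact Subgroup.mem_subgroupOf.1 ((QuotientGroup.eq_one_iff _).1 h2)
  exact h1

theorem E0.trunc_map (f : G →* H) (d : ℕ) (u : E0 G) :
    E0.trunc d (E0.map f u) = E0.map f (E0.trunc d u) := by
  induction u using E0.induction with
  | h0 => simp
  | ha u v hu hv => simp only [map_add, hu, hv]
  | hm k x hx =>
    rw [E0.map_mk]
    rcases lt_or_ge k d with h | h
    · rw [E0.trunc_mk_of_lt h, E0.trunc_mk_of_lt h, E0.map_mk]
    · rw [E0.trunc_mk_of_le h, E0.trunc_mk_of_le h, map_zero]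

theorem E0.trunc_trunc (d : ℕ) (u : E0 G) : E0.trunc d (E0.trunc d u) = E0.trunc d u := by
  induction u using E0.induction with
  | h0 => simp
  | ha u v hu hv => simp only [map_add, hu, hv]
  | hm k x hx =>
    rcases lt_or_ge k d with h | h
    · rw [E0.trunc_mk_of_lt h, E0.trunc_mk_of_lt h]
    · rw [E0.trunc_mk_of_le h, map_zero]

/-- The iterated brackets of generators in the summand with index `k`. -/
def basic (X : Type) : ℕ → Set (E0 (FreeGroup X))
  | 0 => Set.range gen
  | k + 1 => Set.image2 (fun u v => ⁅u, v⁆) (basic X k) (Set.range gen)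

theorem basic_finite (X : Type) [Finite X] (k : ℕ) : (basic X k).Finite := by
  induction k with
  | zero => exact Set.finite_range _
  | succ k ih => exact Set.Finite.image2 _ ih (Set.finite_range _)

theorem cl_mem_span {X : Type} (g : FreeGroup X) : cl g ∈ Submodule.span ℤ (basic X 0) := by
  induction g using FreeGroup.induction_on with
  | C1 => rw [cl_one]; exact zero_mem _
  | of x => exact Submodule.subset_span ⟨x, rfl⟩
  | inv_of x hx => rw [cl_inv]; exact neg_mem hx
  | mul x y hx hy => rw [cl_mul]; exact add_mem hx hy

theorem lie_mem_span {X : Type} {k : ℕ} {u v : E0 (FreeGroup X)}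
    (hu : u ∈ Submodule.span ℤ (basic X k)) (hv : v ∈ Submodule.span ℤ (basic X 0)) :
    ⁅u, v⁆ ∈ Submodule.span ℤ (basic X (k + 1)) := by
  induction hu using Submodule.span_induction with
  | zero => rw [zero_lie]; exact zero_mem _
  | add u w _ _ hu hw => rw [add_lie]; exact add_mem hu hw
  | smul c u _ hu => rw [zsmul_lie]; exact Submodule.smul_mem _ c hu
  | mem u hu =>
    induction hv using Submodule.span_induction with
    | zero => rw [lie_zero]; exact zero_mem _
    | add v w _ _ hv hw => rw [lie_add]; exact add_mem hv hw
    | smul c v _ hv => rw [lie_zsmul]; exact Submodule.smul_mem _ c hv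
    | mem v hv => exact Submodule.subset_span ⟨u, hu, v, hv, rfl⟩

theorem mk_mem_span {X : Type} {k : ℕ} {x : FreeGroup X} (hx : x ∈ Gam (FreeGroup X) k) :
    E0.mk k x hx ∈ Submodule.span ℤ (basic X k) := by
  induction k generalizing x with
  | zero => exact cl_mem_span x
  | succ k ih =>
    have hx' := hx
    rw [Gam, Subgroup.lowerCentralSeries_succ, Subgroup.commutator_def] at hx'
    suffices key : ∃ hx : x ∈ Gam (FreeGroup X) (k + 1),
        E0.mk (k + 1) x hx ∈ Submodule.span ℤ (basic X (k + 1)) from key.2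
    clear hx
    induction hx' using Subgroup.closure_induction with
    | mem x hx =>
      obtain ⟨y, hy, g, -, rfl⟩ := hx
      refine ⟨commutator_mem_succ hy g, ?_⟩
      have e := E0.mk_lie_mk hy (mem_zero g)
      have : E0.mk (k + 1) ⁅y, g⁆ (commutator_mem_succ hy g) = ⁅E0.mk k y hy, cl g⁆ := e.symm
      rw [this]
      exact lie_mem_span (ih hy) (cl_mem_span g)
    | one =>
      refine ⟨one_mem _, ?_⟩
      rw [(E0.mk_eq_zero_iff _).2 (one_mem _)]
      exact zero_mem _
    | mul x y _ _ hx hy =>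
      obtain ⟨h1, h2⟩ := hx
      obtain ⟨h3, h4⟩ := hy
      refine ⟨mul_mem h1 h3, ?_⟩
      rw [E0.mk_mul h1 h3]
      exact add_mem h2 h4
    | inv x _ hx =>
      obtain ⟨h1, h2⟩ := hx
      refine ⟨inv_mem h1, ?_⟩
      rw [E0.mk_inv h1]
      exact neg_mem h2

/-- For finitely many generators each degree is spanned by finitely many iterated brackets. This is
the finiteness needed for the Hopfian argument. -/
theorem trunc_range_fg (X : Type) [Finite X] (d : ℕ) :
    (E0.trunc d : E0 (FreeGroup X) →+ _).toIntLinearMap.range.FG := by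
  have hfin : (⋃ k ∈ Set.Iio d, basic X k).Finite :=
    (Set.finite_Iio d).biUnion fun k _ => basic_finite X k
  have hle : (E0.trunc d : E0 (FreeGroup X) →+ _).toIntLinearMap.range ≤
      Submodule.span ℤ (⋃ k ∈ Set.Iio d, basic X k) := by
    rintro _ ⟨u, rfl⟩
    change E0.trunc d u ∈ Submodule.span ℤ (⋃ k ∈ Set.Iio d, basic X k)
    induction u using E0.induction with
    | h0 => rw [map_zero]; exact zero_mem _
    | ha u v hu hv => rw [map_add]; exact add_mem hu hv
    | hm k x hx =>
      rcases lt_or_ge k d with h | h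
      · rw [E0.trunc_mk_of_lt h]
        exact Submodule.span_mono (Set.subset_biUnion_of_mem (u := basic X) (Set.mem_Iio.2 h))
          (mk_mem_span hx)
      · rw [E0.trunc_mk_of_le h]; exact zero_mem _
  have : IsNoetherian ℤ (Submodule.span ℤ (⋃ k ∈ Set.Iio d, basic X k)) :=
    isNoetherian_of_fg_of_noetherian _ ⟨hfin.toFinset, by rw [hfin.coe_toFinset]⟩
  exact Submodule.FG.of_le (T := Submodule.span ℤ (⋃ k ∈ Set.Iio d, basic X k))
    ⟨hfin.toFinset, by rw [hfin.coe_toFinset]⟩ hle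

end LCS

/-- On the submodule of elements that `α` sends into the range of `β`, the map `α` followed by the
inverse of `β` is onto `M`. A surjection from a submodule of a finitely generated module onto that
module is injective (Orzech), and this submodule contains the kernel of `α`. -/
theorem injective_of_range_le {M N : Type*} [AddCommGroup M] [AddCommGroup N] [Module.Finite ℤ M]
    {α β : M →ₗ[ℤ] N} (hβ : Function.Injective β) (h : β.range ≤ α.range) :
    Function.Injective α := by
  let C : Submodule ℤ M := β.range.comap α
  let e : M ≃ₗ[ℤ] β.range := LinearEquiv.ofInjective β hβ
  let g : C →ₗ[ℤ] M := e.symm.toLinearMap.comp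
    ((α.comp C.subtype).codRestrict β.range fun c => c.2)
  have hg : Function.Surjective g := by
    intro m
    obtain ⟨c, hc⟩ := h ⟨m, rfl⟩
    refine ⟨⟨c, ?_⟩, ?_⟩
    · change α c ∈ β.range
      rw [hc]; exact ⟨m, rfl⟩
    · change e.symm _ = m
      rw [LinearEquiv.symm_apply_eq]
      exact Subtype.ext hc
  have hi := OrzechProperty.injective_of_surjective_of_submodule g hg
  rw [injective_iff_map_eq_zero]
  intro m hm
  have hmC : m ∈ C := by change α m ∈ β.range; rw [hm]; exact zero_mem _
  have : g ⟨m, hmC⟩ = 0 := by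
    change e.symm _ = 0
    rw [LinearEquiv.map_eq_zero_iff]
    exact Subtype.ext hm
  have h2 := hi (this.trans (map_zero g).symm)
  exact congrArg Subtype.val h2

/-! ### Kernels as spans of iterated brackets -/

namespace LieSpan

section Ker

variable {E E' ι : Type*} [LieRing E] [LieRing E']

theorem map_adSpan (f : E →ₗ⁅ℤ⁆ E') (t : ι → E) (z : E) :
    (adSpan t z).map (f : E →+ E') = adSpan (f ∘ t) (f z) := by
  apply le_antisymm
  · rw [AddSubgroup.map_le_iff_le_comap]
    refine adSpan_le mem_adSpan fun i u hu => ?_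
    change f ⁅t i, u⁆ ∈ adSpan (f ∘ t) (f z)
    rw [LieHom.map_lie]
    exact lie_mem_adSpan i hu
  · refine adSpan_le ⟨z, mem_adSpan, rfl⟩ ?_
    rintro i _ ⟨u, hu, rfl⟩
    exact ⟨⁅t i, u⁆, lie_mem_adSpan i hu, LieHom.map_lie f _ _⟩

/-- Since the `t i` generate, the span is an ideal, and it lies in the kernel. Modulo this ideal `q
∘ p` is the identity on generators, hence everywhere. -/
theorem mem_ker_iff_mem_adSpan {p : E →ₗ⁅ℤ⁆ E'} {q : E' →ₗ⁅ℤ⁆ E} (hpq : ∀ v, p (q v) = v)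
    {t : ι → E} {z : E} (hgen : ∀ S : LieSubalgebra ℤ E, (∀ i, t i ∈ S) → ∀ u, u ∈ S)
    (hz : p z = 0) (ht : ∀ i, ∃ v, t i - q v ∈ adSpan t z) (u : E) :
    p u = 0 ↔ u ∈ adSpan t z := by
  have hs : ∀ v, v ∈ stab (adSpan t z) := hgen _ mem_stab_letter
  have hs' : ∀ v ∈ adSpan t z, ∀ w, ⁅v, w⁆ ∈ adSpan t z := fun v hv w => by
    rw [← lie_skew]; exact neg_mem (hs w v hv)
  have hp : ∀ v ∈ adSpan t z, p v = 0 := by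
    have : adSpan t z ≤ (p : E →+ E').ker := by
      refine adSpan_le hz fun i v hv => ?_
      change p ⁅t i, v⁆ = 0
      rw [LieHom.map_lie, show p v = 0 from hv, lie_zero]
    exact fun v hv => this hv
  refine ⟨fun hu => ?_, hp u⟩
  let S : LieSubalgebra ℤ E :=
    { carrier := {u | u - q (p u) ∈ adSpan t z}
      zero_mem' := by
        change (0 : E) - q (p 0) ∈ adSpan t z
        rw [map_zero, map_zero, sub_zero]; exact zero_mem _
      add_mem' := fun {v w} hv hw => by
        change v + w - q (p (v + w)) ∈ adSpan t z
        rw [map_add, map_add, add_sub_add_comm]; exact add_mem hv hw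
      smul_mem' := fun k v hv => by
        change k • v - q (p (k • v)) ∈ adSpan t z
        rw [map_zsmul, map_zsmul, ← smul_sub]; exact zsmul_mem hv k
      lie_mem' := fun {v w} hv hw => by
        change ⁅v, w⁆ - q (p ⁅v, w⁆) ∈ adSpan t z
        have e : ⁅v, w⁆ - q (p ⁅v, w⁆) = ⁅v - q (p v), w⁆ + ⁅q (p v), w - q (p w)⁆ := by
          rw [LieHom.map_lie, LieHom.map_lie, sub_lie, lie_sub]; abel
        rw [e]
        exact add_mem (hs' _ hv w) (hs _ _ hw) }
  have h := hgen S (fun i => by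
    obtain ⟨v, hv⟩ := ht i
    have h1 := hp _ hv
    rw [map_sub, hpq, sub_eq_zero] at h1
    change t i - q (p (t i)) ∈ adSpan t z
    rwa [h1]) u
  have h' : u - q (p u) ∈ adSpan t z := h
  rwa [hu, map_zero, sub_zero] at h'

end Ker

end LieSpan

end

/-! ### The kernels of `face` and `proj` and their common image -/

noncomputable section

namespace Braid

open LCS LieSpan

theorem map_fib_injective (n : ℕ) : Function.Injective (E0.map (fib n)) :=
  E0.map_injective _ fun _ _ _ h => mem_of_fib_mem h

theorem fibre_of {n : ℕ} (i : Fin n) :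
    fibre n (FreeLieAlgebra.of ℤ i) = cl (A (n + 1) i n) := FreeLie.lift_of (lastClass n) i

theorem map_fib_gen {n : ℕ} (i : Fin n) : E0.map (fib n) (gen i) = cl (A (n + 1) i n) := by
  rw [show gen i = cl (FreeGroup.of i) from rfl, map_cl, fib, FreeGroup.lift_apply_of]

theorem fibre_eq (n : ℕ) : fibre n = (E0.map (fib n)).comp (freeMap (Fin n)) := by
  apply FreeLie.hom_ext
  intro i
  rw [fibre_of, LieHom.comp_apply, freeMap_of, map_fib_gen]

theorem fibre_injective (n : ℕ) : Function.Injective (fibre n) := by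
  rw [fibre_eq]
  exact (map_fib_injective n).comp (freeMap_injective (Fin n))

theorem cl_A_last {n i : ℕ} (hi : i < n + 1) : cl (A (n + 2) i (n + 1)) = lst n i :=
  (lk_of_lt hi).symm

theorem face_of_zero (n : ℕ) : face n (FreeGroup.of 0) = 1 := by
  rw [face, FreeGroup.lift_apply_of, Fin.cases_zero]

theorem face_of_succ {n : ℕ} (j : Fin n) : face n (FreeGroup.of j.succ) = FreeGroup.of j := by
  rw [face, FreeGroup.lift_apply_of, Fin.cases_succ]

theorem map_face_gen_zero (n : ℕ) : E0.map (face n) (gen 0) = 0 := by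
  rw [show gen (0 : Fin (n + 1)) = cl (FreeGroup.of 0) from rfl, map_cl, face_of_zero, cl_one]

/-- The generators are listed in reverse so that `Theta` takes the one with index `m.rev` to the cut
class `m + 1`; the span itself does not depend on the order. -/
theorem map_face_eq_zero_iff {n : ℕ} (u : E0 (FreeGroup (Fin (n + 1)))) :
    E0.map (face n) u = 0 ↔ u ∈ adSpan (fun m : Fin (n + 1) => gen m.rev) (gen 0) := by
  refine mem_ker_iff_mem_adSpan (q := E0.map (FreeGroup.map Fin.succ)) (fun v => ?_)
    (fun S hS => mem_of_gen S fun x => by simpa using hS x.rev) (map_face_gen_zero n)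
    (fun m => ?_) u
  · rw [E0.map_map]
    have : (face n).comp (FreeGroup.map Fin.succ) = MonoidHom.id _ := by
      ext j
      simp [face_of_succ]
    rw [this, E0.map_id]
  · generalize m.rev = i
    induction i using Fin.cases with
    | zero => exact ⟨0, by rw [map_zero, sub_zero]; exact mem_adSpan⟩
    | succ j =>
      refine ⟨gen j, ?_⟩
      have : E0.map (FreeGroup.map Fin.succ) (gen j) = gen j.succ := by
        rw [show gen j = cl (FreeGroup.of j) from rfl, map_cl, FreeGroup.map.of]
        rfl
      rw [this, sub_self]
      exact zero_mem _

theorem map_Theta_ker (n : ℕ) :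
    (adSpan (fun m : Fin (n + 1) => gen m.rev) (gen 0)).map
        (E0.map (Theta (n + 1)) : E0 (FreeGroup (Fin (n + 1))) →+ E0 (PureBraidGroup (n + 2))) =
      adSpan (fun m : Fin (n + 1) => cut (n + 2) (m + 1)) (part n (n + 1)) := by
  rw [map_adSpan, map_Theta_gen, ← cut_last]
  congr 1
  funext m
  rw [Function.comp_apply, map_Theta_gen, Fin.val_rev]
  congr 1
  omega

/-- The cut classes and the partial sums satisfy the relations of `adSpan_eq`, and the last members
of the two families coincide. -/
theorem adSpan_cut (n : ℕ) :
    adSpan (fun m : Fin (n + 1) => cut (n + 2) (m + 1)) (part n (n + 1)) =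
      adSpan (fun m : Fin (n + 1) => part n (m + 1)) (part n (n + 1)) := by
  refine adSpan_eq (s := fun m : Fin (n + 1) => part n (m + 1))
    (fun m => ⟨thetaGen n m.rev, ?_⟩) (fun {l m} h => ?_) (fun {l m} h => ?_) (cut_last n)
  · rw [cl_thetaGen, Fin.val_rev]
    congr 1
    omega
  · rw [Fin.le_def] at h
    exact cut_lie_part_of_le (by omega) (by omega)
  · rw [Fin.le_def] at h
    exact cut_lie_part_of_ge (by omega) (by omega)

/-- The generator with index `i` of the free Lie algebra, for a natural number `i`. -/
def fgen (n i : ℕ) : FreeLieAlgebra ℤ (Fin (n + 1)) :=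
  if h : i < n + 1 then FreeLieAlgebra.of ℤ ⟨i, h⟩ else 0

theorem fgen_val {n : ℕ} (i : Fin (n + 1)) : fgen n i = FreeLieAlgebra.of ℤ i := dif_pos i.2

/-- The sum of the first `m` generators of the free Lie algebra. -/
def fpart (n m : ℕ) : FreeLieAlgebra ℤ (Fin (n + 1)) := ∑ i ∈ Finset.range m, fgen n i

theorem fpart_last (n : ℕ) :
    fpart n (n + 1) = FreeLieAlgebra.of ℤ 0 + ∑ j : Fin n, FreeLieAlgebra.of ℤ j.succ := by
  rw [fpart, ← Fin.sum_univ_eq_sum_range, Fin.sum_univ_succ]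
  simp only [fgen_val]

theorem fibre_fpart {n m : ℕ} (hm : m ≤ n + 1) : fibre (n + 1) (fpart n m) = part n m := by
  rw [fpart, part, map_sum]
  refine Finset.sum_congr rfl fun i hi => ?_
  have hi' : i < n + 1 := by rw [Finset.mem_range] at hi; omega
  rw [fgen, dif_pos hi', fibre_of]
  exact cl_A_last hi'

theorem proj_of_zero (n : ℕ) :
    proj n (FreeLieAlgebra.of ℤ 0) = - ∑ j : Fin n, FreeLieAlgebra.of ℤ j :=
  FreeLieAlgebra.lift_of_apply _ _

theorem proj_of_succ {n : ℕ} (j : Fin n) :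
    proj n (FreeLieAlgebra.of ℤ j.succ) = FreeLieAlgebra.of ℤ j :=
  FreeLieAlgebra.lift_of_apply _ _

theorem proj_fpart_last (n : ℕ) : proj n (fpart n (n + 1)) = 0 := by
  rw [fpart_last, map_add, proj_of_zero, map_sum]
  simp only [proj_of_succ]
  exact neg_add_cancel _

/-- The section of `proj` that sends generators to generators. -/
def projSection (n : ℕ) : FreeLieAlgebra ℤ (Fin n) →ₗ⁅ℤ⁆ FreeLieAlgebra ℤ (Fin (n + 1)) :=
  FreeLie.lift fun j => FreeLieAlgebra.of ℤ j.succ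

theorem projSection_of {n : ℕ} (j : Fin n) :
    projSection n (FreeLieAlgebra.of ℤ j) = FreeLieAlgebra.of ℤ j.succ := FreeLie.lift_of _ j

theorem proj_projSection {n : ℕ} (v : FreeLieAlgebra ℤ (Fin n)) : proj n (projSection n v) = v := by
  have : (proj n).comp (projSection n) = LieHom.id := by
    apply FreeLie.hom_ext
    intro j
    rw [LieHom.comp_apply, projSection_of, proj_of_succ]
    rfl
  exact LieHom.congr_fun this v

/-- Each generator is a difference of two consecutive partial sums. -/
theorem mem_of_fpart {n : ℕ} (S : LieSubalgebra ℤ (FreeLieAlgebra ℤ (Fin (n + 1))))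
    (hS : ∀ m : Fin (n + 1), fpart n (m + 1) ∈ S) (u : FreeLieAlgebra ℤ (Fin (n + 1))) : u ∈ S := by
  refine FreeLie.mem_of_generators S (fun i => ?_) u
  have h1 : fpart n i ∈ S := by
    rcases Nat.eq_zero_or_pos (i : ℕ) with h | h
    · rw [h]; exact S.zero_mem
    · have := hS ⟨i - 1, by omega⟩
      simp only [Nat.sub_add_cancel h] at this
      exact this
  have h2 : FreeLieAlgebra.of ℤ i = fpart n (i + 1) - fpart n i := by
    rw [fpart, Finset.sum_range_succ, fgen_val, fpart, add_sub_cancel_left]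
  rw [h2]
  exact S.sub_mem (hS i) h1

theorem exists_fgen_sub_mem {n i : ℕ} (hi : i < n + 1) : ∃ v, fgen n i - projSection n v ∈
    adSpan (fun m : Fin (n + 1) => fpart n (m + 1)) (fpart n (n + 1)) := by
  rw [fgen, dif_pos hi]
  generalize (⟨i, hi⟩ : Fin (n + 1)) = i
  induction i using Fin.cases with
  | zero =>
    refine ⟨- ∑ j : Fin n, FreeLieAlgebra.of ℤ j, ?_⟩
    rw [map_neg, map_sum, sub_neg_eq_add]
    simp only [projSection_of]
    rw [← fpart_last]
    exact mem_adSpan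
  | succ j =>
    refine ⟨FreeLieAlgebra.of ℤ j, ?_⟩
    rw [projSection_of, sub_self]
    exact zero_mem _

theorem exists_fpart_sub_mem {n m : ℕ} (hm : m ≤ n + 1) : ∃ v, fpart n m - projSection n v ∈
    adSpan (fun m : Fin (n + 1) => fpart n (m + 1)) (fpart n (n + 1)) := by
  induction m with
  | zero => exact ⟨0, by rw [map_zero, sub_zero]; exact zero_mem _⟩
  | succ m ih =>
    obtain ⟨v, hv⟩ := ih (by omega)
    obtain ⟨w, hw⟩ := exists_fgen_sub_mem (show m < n + 1 by omega)
    refine ⟨v + w, ?_⟩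
    have e : fpart n (m + 1) = fpart n m + fgen n m := Finset.sum_range_succ _ _
    rw [e, map_add, add_sub_add_comm]
    exact add_mem hv hw

theorem proj_eq_zero_iff {n : ℕ} (u : FreeLieAlgebra ℤ (Fin (n + 1))) :
    proj n u = 0 ↔ u ∈ adSpan (fun m : Fin (n + 1) => fpart n (m + 1)) (fpart n (n + 1)) :=
  mem_ker_iff_mem_adSpan proj_projSection mem_of_fpart (proj_fpart_last n)
    (fun _ => exists_fpart_sub_mem (by omega)) u

theorem map_fibre_ker (n : ℕ) :
    (adSpan (fun m : Fin (n + 1) => fpart n (m + 1)) (fpart n (n + 1))).map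
        (fibre (n + 1) : FreeLieAlgebra ℤ (Fin (n + 1)) →+ E0 (PureBraidGroup (n + 2))) =
      adSpan (fun m : Fin (n + 1) => part n (m + 1)) (part n (n + 1)) := by
  rw [map_adSpan, fibre_fpart le_rfl]
  congr 1
  funext m
  exact fibre_fpart (by omega)

/-- This and `mem_adSpan_part_iff_fibre` describe the same subgroup as the image of two different
kernels, which is where the isomorphism of the theorem comes from. -/
theorem mem_adSpan_part_iff_Theta {n : ℕ} {w : E0 (PureBraidGroup (n + 2))} :
    w ∈ adSpan (fun m : Fin (n + 1) => part n (m + 1)) (part n (n + 1)) ↔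
      ∃ u, E0.map (face n) u = 0 ∧ E0.map (Theta (n + 1)) u = w := by
  rw [← adSpan_cut, ← map_Theta_ker]
  simp only [map_face_eq_zero_iff]
  rfl

theorem mem_adSpan_part_iff_fibre {n : ℕ} {w : E0 (PureBraidGroup (n + 2))} :
    w ∈ adSpan (fun m : Fin (n + 1) => part n (m + 1)) (part n (n + 1)) ↔
      ∃ u, proj n u = 0 ∧ fibre (n + 1) u = w := by
  rw [← map_fibre_ker]
  simp only [proj_eq_zero_iff]
  rfl

end Braid

end

/-! ### The centralizer of a generator -/

noncomputable section

namespace FreeLie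

section

attribute [local instance] LieRing.ofAssociativeRing

open FreeLieAlgebra

/-- The representation by matrices in which the first generator acts as an elementary nilpotent
matrix and the other ones act in one diagonal entry. -/
def toMatrix (n : ℕ) :
    FreeLieAlgebra ℤ (Fin (n + 1)) →ₗ⁅ℤ⁆ Matrix (Fin 2) (Fin 2) (FreeAlgebra ℤ (Fin n)) :=
  lift (Fin.cases (Matrix.single 0 1 1) fun j => Matrix.single 0 0 (FreeAlgebra.ι ℤ j))

/-- The morphism of free Lie algebras that kills the first generator and lowers the index of the
other ones. -/
def dropFirst (n : ℕ) : FreeLieAlgebra ℤ (Fin (n + 1)) →ₗ⁅ℤ⁆ FreeLieAlgebra ℤ (Fin n) :=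
  lift (Fin.cases 0 (of ℤ))

theorem dropFirst_zero (n : ℕ) : dropFirst n (of ℤ 0) = 0 := lift_of _ _

theorem dropFirst_succ {n : ℕ} (j : Fin n) : dropFirst n (of ℤ j.succ) = of ℤ j := lift_of _ _

theorem toMatrix_zero (n : ℕ) : toMatrix n (of ℤ 0) = Matrix.single 0 1 1 := lift_of _ _

theorem toMatrix_succ {n : ℕ} (j : Fin n) :
    toMatrix n (of ℤ j.succ) = Matrix.single 0 0 (FreeAlgebra.ι ℤ j) := lift_of _ _

theorem toMatrix_entries {n : ℕ} (u : FreeLieAlgebra ℤ (Fin (n + 1))) :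
    toMatrix n u 1 0 = 0 ∧ toMatrix n u 1 1 = 0 ∧
      toMatrix n u 0 0 = toAssoc (Fin n) (dropFirst n u) := by
  let S : LieSubalgebra ℤ (FreeLieAlgebra ℤ (Fin (n + 1))) :=
    { carrier := {u | toMatrix n u 1 0 = 0 ∧ toMatrix n u 1 1 = 0 ∧
        toMatrix n u 0 0 = toAssoc (Fin n) (dropFirst n u)}
      zero_mem' := by simp
      add_mem' := fun {u v} hu hv => by
        simp only [Set.mem_ofPred_eq] at hu hv ⊢
        simp only [map_add, Matrix.add_apply, hu, hv, add_zero, and_self]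
      smul_mem' := fun k u hu => by
        simp only [Set.mem_ofPred_eq] at hu ⊢
        simp only [map_zsmul, Matrix.smul_apply, hu, smul_zero, and_self]
      lie_mem' := fun {u v} hu hv => by
        simp only [Set.mem_ofPred_eq] at hu hv
        simp only [Set.mem_ofPred_eq, LieHom.map_lie, LieRing.of_associative_ring_bracket,
          Matrix.sub_apply, Matrix.mul_apply, Fin.sum_univ_two, hu, hv]
        simp }
  refine mem_of_generators S (fun i => ?_) u
  induction i using Fin.cases with
  | zero =>
    change _ ∧ _ ∧ _
    rw [toMatrix_zero, dropFirst_zero]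
    simp
  | succ j =>
    change _ ∧ _ ∧ _
    rw [toMatrix_succ, dropFirst_succ, toAssoc_of]
    simp

/-- In the matrix representation the upper right entry of the bracket with the elementary nilpotent
matrix is the difference of the diagonal entries. The lower one is zero and the upper one is the
associative image of `dropFirst n u`. -/
theorem dropFirst_eq_zero_of_lie_eq_zero {n : ℕ} {u : FreeLieAlgebra ℤ (Fin (n + 1))}
    (h : ⁅u, of ℤ (0 : Fin (n + 1))⁆ = 0) : dropFirst n u = 0 := by
  apply toAssoc_injective (Fin n)
  obtain ⟨-, h2, h3⟩ := toMatrix_entries u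
  have h1 := congrArg (fun M => M 0 1) (congrArg (toMatrix n) h)
  simp only [LieHom.map_lie, toMatrix_zero, LieRing.of_associative_ring_bracket, Matrix.sub_apply,
    Matrix.mul_apply, Fin.sum_univ_two, h2, map_zero, Matrix.zero_apply] at h1
  rw [map_zero, ← h3]
  simpa using h1

end

end FreeLie

namespace Braid

open LCS LieSpan

theorem map_face_freeMap {n : ℕ} (v : FreeLieAlgebra ℤ (Fin (n + 1))) :
    E0.map (face n) (freeMap _ v) = freeMap _ (FreeLie.dropFirst n v) := by
  have : (E0.map (face n)).comp (freeMap _) = (freeMap _).comp (FreeLie.dropFirst n) := by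
    apply FreeLie.hom_ext
    intro i
    rw [LieHom.comp_apply, LieHom.comp_apply, freeMap_of]
    induction i using Fin.cases with
    | zero => rw [map_face_gen_zero, FreeLie.dropFirst_zero, map_zero]
    | succ j =>
      rw [FreeLie.dropFirst_succ, freeMap_of, show gen j.succ = cl (FreeGroup.of j.succ) from rfl,
        map_cl, face_of_succ]
      rfl
  exact LieHom.congr_fun this v

theorem map_face_eq_zero_of_lie_eq_zero {n : ℕ} {u : E0 (FreeGroup (Fin (n + 1)))}
    (h : ⁅u, gen (0 : Fin (n + 1))⁆ = 0) : E0.map (face n) u = 0 := by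
  obtain ⟨v, rfl⟩ := freeMap_surjective _ u
  rw [← freeMap_of, ← LieHom.map_lie] at h
  have h' := freeMap_injective _ (h.trans (map_zero _).symm)
  rw [map_face_freeMap, FreeLie.dropFirst_eq_zero_of_lie_eq_zero h', map_zero]

/-! ### Injectivity of `Theta` and the isomorphism of kernels -/

section Hopf

variable (n : ℕ)

/-- The product of all generators but the first one. -/
def tailProd : FreeGroup (Fin (n + 1)) := (List.ofFn fun j : Fin n => FreeGroup.of j.succ).prod

/-- The automorphism of the free group that multiplies the first generator by all the other ones. -/
def sumHom : FreeGroup (Fin (n + 1)) →* FreeGroup (Fin (n + 1)) :=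
  FreeGroup.lift (Fin.cases (FreeGroup.of 0 * tailProd n) fun j => FreeGroup.of j.succ)

/-- The inverse of `sumHom`. -/
def sumInv : FreeGroup (Fin (n + 1)) →* FreeGroup (Fin (n + 1)) :=
  FreeGroup.lift (Fin.cases (FreeGroup.of 0 * (tailProd n)⁻¹) fun j => FreeGroup.of j.succ)

variable {n}

theorem sumHom_zero : sumHom n (FreeGroup.of 0) = FreeGroup.of 0 * tailProd n := by
  rw [sumHom, FreeGroup.lift_apply_of, Fin.cases_zero]

theorem sumHom_succ (j : Fin n) : sumHom n (FreeGroup.of j.succ) = FreeGroup.of j.succ := by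
  rw [sumHom, FreeGroup.lift_apply_of, Fin.cases_succ]

theorem sumInv_zero : sumInv n (FreeGroup.of 0) = FreeGroup.of 0 * (tailProd n)⁻¹ := by
  rw [sumInv, FreeGroup.lift_apply_of, Fin.cases_zero]

theorem sumInv_succ (j : Fin n) : sumInv n (FreeGroup.of j.succ) = FreeGroup.of j.succ := by
  rw [sumInv, FreeGroup.lift_apply_of, Fin.cases_succ]

theorem sumInv_comp_sumHom : (sumInv n).comp (sumHom n) = MonoidHom.id _ := by
  have ht : sumInv n (tailProd n) = tailProd n := by
    rw [tailProd, map_list_prod, List.map_ofFn]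
    simp only [Function.comp_def, sumInv_succ]
  ext i
  rw [MonoidHom.comp_apply, MonoidHom.id_apply]
  induction i using Fin.cases with
  | zero => rw [sumHom_zero, map_mul, sumInv_zero, ht, inv_mul_cancel_right]
  | succ j => rw [sumHom_succ, sumInv_succ]

theorem map_sumHom_injective : Function.Injective (E0.map (sumHom n)) := by
  refine Function.LeftInverse.injective (g := E0.map (sumInv n)) fun u => ?_
  rw [E0.map_map, sumInv_comp_sumHom, E0.map_id]

theorem cl_list_prod {G : Type*} [Group G] (l : List G) : cl l.prod = (l.map cl).sum := by
  induction l with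
  | nil => exact cl_one
  | cons a l ih => rw [List.prod_cons, cl_mul, ih, List.map_cons, List.sum_cons]

theorem map_fib_sumHom_gen_zero :
    E0.map ((fib (n + 1)).comp (sumHom n)) (gen 0) = part n (n + 1) := by
  have h : ∀ i : Fin (n + 1), E0.map (fib (n + 1)) (cl (FreeGroup.of i)) = lst n i := fun i =>
    (map_fib_gen i).trans (cl_A_last i.2)
  rw [← E0.map_map, show gen (0 : Fin (n + 1)) = cl (FreeGroup.of 0) from rfl, map_cl, sumHom_zero,
    cl_mul, tailProd, cl_list_prod, List.map_ofFn, List.sum_ofFn, map_add, map_sum, part,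
    ← Fin.sum_univ_eq_sum_range, Fin.sum_univ_succ]
  simp only [Function.comp_apply, h]

theorem map_fib_sumHom_gen_succ (j : Fin n) :
    E0.map ((fib (n + 1)).comp (sumHom n)) (gen j.succ) = part n (j + 2) - part n (j + 1) := by
  rw [← E0.map_map, show gen j.succ = cl (FreeGroup.of j.succ) from rfl, map_cl, sumHom_succ,
    show cl (FreeGroup.of j.succ) = gen j.succ from rfl, map_fib_gen, part,
    Finset.sum_range_succ _ ((j : ℕ) + 1), part, add_sub_cancel_left]
  exact cl_A_last (by omega)

/-- `sumHom` turns the first generator into an element whose class maps to the sum of all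
last-strand classes. Hence the injective map induced by `fib` and `sumHom` carries the kernel of
`face` into the subgroup that `Theta` reaches from the same kernel. -/
theorem map_fib_sumHom_mem {u : E0 (FreeGroup (Fin (n + 1)))} (hu : E0.map (face n) u = 0) :
    E0.map ((fib (n + 1)).comp (sumHom n)) u ∈
      adSpan (fun m : Fin (n + 1) => part n (m + 1)) (part n (n + 1)) := by
  rw [map_face_eq_zero_iff] at hu
  set K := adSpan (fun m : Fin (n + 1) => part n (m + 1)) (part n (n + 1)) with hK
  have hs : ∀ m : ℕ, m < n + 1 → part n (m + 1) ∈ stab K := fun m hm =>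
    mem_stab_letter (s := fun m : Fin (n + 1) => part n (m + 1)) ⟨m, hm⟩
  have hle : adSpan (fun m : Fin (n + 1) => gen m.rev) (gen 0) ≤
      K.comap (E0.map ((fib (n + 1)).comp (sumHom n)) : E0 _ →+ E0 _) := by
    refine adSpan_le ?_ fun i v hv => ?_
    · change E0.map ((fib (n + 1)).comp (sumHom n)) (gen 0) ∈ K
      rw [map_fib_sumHom_gen_zero]
      exact mem_adSpan
    · change E0.map ((fib (n + 1)).comp (sumHom n)) ⁅gen i.rev, v⁆ ∈ K
      rw [LieHom.map_lie]
      have hg : E0.map ((fib (n + 1)).comp (sumHom n)) (gen i.rev) ∈ stab K := by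
        generalize i.rev = j
        induction j using Fin.cases with
        | zero => rw [map_fib_sumHom_gen_zero]; exact hs n (by omega)
        | succ j =>
          rw [map_fib_sumHom_gen_succ]
          exact (stab K).sub_mem (hs (j + 1) (by omega)) (hs j (by omega))
      exact hg _ hv
  exact hle hu

/-- On the part of the kernel of `face` below degree `d`, a finitely generated group, the map `β` is
injective with range inside that of `α`, the restriction of `Theta`. The Hopfian property makes `α`
injective. -/
theorem eq_zero_of_map_Theta_eq_zero {u : E0 (FreeGroup (Fin (n + 1)))}
    (hu : E0.map (face n) u = 0) (h : E0.map (Theta (n + 1)) u = 0) : u = 0 := by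
  obtain ⟨d, hd⟩ := E0.exists_trunc u
  have hd := hd d le_rfl
  let V : Submodule ℤ (E0 (FreeGroup (Fin (n + 1)))) :=
    (E0.trunc d : E0 (FreeGroup (Fin (n + 1))) →+ _).toIntLinearMap.range
  let M : Submodule ℤ (E0 (FreeGroup (Fin (n + 1)))) := (E0.map (face n)).toLinearMap.ker ⊓ V
  have hM : Module.Finite ℤ M :=
    Module.Finite.iff_fg.2 (Submodule.FG.of_le (trunc_range_fg _ d) inf_le_right)
  let α : M →ₗ[ℤ] E0 (PureBraidGroup (n + 2)) :=
    (E0.map (Theta (n + 1))).toLinearMap.comp M.subtype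
  let β : M →ₗ[ℤ] E0 (PureBraidGroup (n + 2)) :=
    (E0.map ((fib (n + 1)).comp (sumHom n))).toLinearMap.comp M.subtype
  have hβ : Function.Injective β := by
    intro a b hab
    have hab' : E0.map ((fib (n + 1)).comp (sumHom n)) a.1 =
      E0.map ((fib (n + 1)).comp (sumHom n)) b.1 := hab
    rw [← E0.map_map, ← E0.map_map] at hab'
    exact Subtype.ext (map_sumHom_injective (map_fib_injective _ hab'))
  have hr : β.range ≤ α.range := by
    rintro _ ⟨⟨w, hw1, hw2⟩, rfl⟩
    have hw1' : E0.map (face n) w = 0 := hw1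
    have hw : E0.trunc d w = w := by
      obtain ⟨v, rfl⟩ := hw2
      exact E0.trunc_trunc d v
    obtain ⟨v, hv1, hv2⟩ := mem_adSpan_part_iff_Theta.1 (map_fib_sumHom_mem hw1')
    -- Induced maps commute with truncation, so the preimage may be cut off at `d`.
    refine ⟨⟨E0.trunc d v, ?_, ⟨v, rfl⟩⟩, ?_⟩
    · change E0.map (face n) (E0.trunc d v) = 0
      rw [← E0.trunc_map, hv1, map_zero]
    · change E0.map (Theta (n + 1)) (E0.trunc d v) = E0.map ((fib (n + 1)).comp (sumHom n)) w
      rw [← E0.trunc_map, hv2, E0.trunc_map, hw]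
  have hα := injective_of_range_le hβ hr
  have huM : u ∈ M := ⟨hu, ⟨u, hd⟩⟩
  have h0 : α ⟨u, huM⟩ = α 0 := by
    rw [map_zero]
    exact h
  exact congrArg Subtype.val (hα h0)

end Hopf

/-- For `u` in the kernel, the bracket with the first generator is killed by both `Theta` and
`face`, hence is zero. Elements commuting with that generator are killed by `face`, so the previous
case applies to `u` itself. -/
theorem map_Theta_injective (n : ℕ) : Function.Injective (E0.map (Theta n)) := by
  cases n with
  | zero =>
    refine E0.map_injective _ fun k x _ _ => ?_
    rw [Subsingleton.elim x 1]
    exact one_mem _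
  | succ n =>
    rw [injective_iff_map_eq_zero]
    intro u hu
    have h1 : ⁅u, gen (0 : Fin (n + 1))⁆ = 0 := by
      refine eq_zero_of_map_Theta_eq_zero ?_ ?_
      · rw [LieHom.map_lie, map_face_gen_zero, lie_zero]
      · rw [LieHom.map_lie, hu, zero_lie]
    exact eq_zero_of_map_Theta_eq_zero (map_face_eq_zero_of_lie_eq_zero h1) hu

/-- Injectivity on the Lie algebras pushes an element of the kernel into one stage after another,
and the stages of a free group intersect trivially. -/
theorem Theta_injective (n : ℕ) : Function.Injective (Theta n) := by
  rw [injective_iff_map_eq_one]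
  intro g hg
  refine Magnus.eq_one_of_forall_mem fun k => ?_
  induction k with
  | zero => exact mem_zero g
  | succ k ih =>
    rw [← E0.mk_eq_zero_iff ih]
    apply map_Theta_injective n
    rw [E0.map_mk, map_zero, E0.mk_eq_zero_iff, hg]
    exact one_mem _

/-- The isomorphism between the kernels of `E0.map (face n)` and `proj n` induced by `Theta`. -/
theorem exists_kerEquiv (n : ℕ) : ∃ e : (E0.map (face n)).ker ≃ₗ⁅ℤ⁆ (proj n).ker,
    ∀ z, fibre (n + 1) (e z) = E0.map (Theta (n + 1)) z := by
  have hf : ∀ z : (E0.map (face n)).ker, ∃ w : (proj n).ker,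
      fibre (n + 1) w = E0.map (Theta (n + 1)) z := by
    intro z
    obtain ⟨w, hw1, hw2⟩ := mem_adSpan_part_iff_fibre.1
      (mem_adSpan_part_iff_Theta.2 ⟨z.1, LieHom.mem_ker.1 z.2, rfl⟩)
    exact ⟨⟨w, LieHom.mem_ker.2 hw1⟩, hw2⟩
  -- Since `fibre` is injective, the chosen preimages are unique, and so the choice is automatically
  -- a morphism of Lie algebras.
  choose f hf using hf
  have hinj : ∀ {a b : (proj n).ker}, fibre (n + 1) a = fibre (n + 1) b → a = b :=
    fun h => Subtype.ext (fibre_injective (n + 1) h)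
  let g : (E0.map (face n)).ker →ₗ⁅ℤ⁆ (proj n).ker :=
    { toFun := f
      map_add' := fun a b => hinj (by
        change _ = fibre (n + 1) ((f a).1 + (f b).1)
        rw [map_add, hf, hf, hf]
        exact map_add (E0.map (Theta (n + 1))) a.1 b.1)
      map_smul' := fun k a => hinj (by
        change _ = fibre (n + 1) (k • (f a).1)
        rw [map_zsmul, hf, hf]
        exact map_zsmul (E0.map (Theta (n + 1))) k a.1)
      map_lie' := fun {a b} => hinj (by
        change fibre (n + 1) (f ⁅a, b⁆) = fibre (n + 1) ⁅(f a).1, (f b).1⁆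
        rw [LieHom.map_lie, hf, hf, hf]
        exact LieHom.map_lie (E0.map (Theta (n + 1))) a.1 b.1) }
  have hg : ∀ z, fibre (n + 1) (g z) = E0.map (Theta (n + 1)) z := hf
  refine ⟨LieEquiv.ofBijective g ⟨fun a b hab => ?_, fun w => ?_⟩, hg⟩
  · refine Subtype.ext (map_Theta_injective (n + 1) ?_)
    rw [← hg, ← hg, hab]
  · obtain ⟨u, hu1, hu2⟩ := mem_adSpan_part_iff_Theta.1
      (mem_adSpan_part_iff_fibre.2 ⟨w.1, LieHom.mem_ker.1 w.2, rfl⟩)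
    exact ⟨⟨u, LieHom.mem_ker.2 hu1⟩, hinj ((hg _).trans hu2)⟩

end Braid

end

theorem mainTheorem5 :
    (∀ n : ℕ, Function.Injective (LCS.E0.map (Braid.Theta n)) ∧
      Function.Injective (Braid.Theta n)) ∧
    (∀ n : ℕ, Function.Injective (Braid.fibre (n + 1)) ∧
      ∃ e : (LCS.E0.map (Braid.face n)).ker ≃ₗ⁅ℤ⁆ (Braid.proj n).ker,
        ∀ z, Braid.fibre (n + 1) (e z) = LCS.E0.map (Braid.Theta (n + 1)) z) :=
  ⟨fun n => ⟨Braid.map_Theta_injective n, Braid.Theta_injective n⟩,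
    fun n => ⟨Braid.fibre_injective (n + 1), Braid.exists_kerEquiv n⟩⟩
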